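/- Let $M$ be a nonempty finite-dimensional smooth manifold (Hausdorff, second countable), and let $E\to M$ be a smooth oriented complex hermitian vector bundle of rank $n$ (oriented: equipped with a smooth determinant form of norm $1$ on its fibers). Let $P$ be its $SU(n)$-principal frame bundle, whose points are the orthonormal frames of fibers of $E$ on which the determinant form equals $1$, and let $\mathfrak A$ be the algebra of smooth sections of $\mathrm{End}(E)$. Let $\mathfrak B=\mathcal F(P)\otimes M_n(\mathbb C)$ be the algebra of smooth $M_n(\mathbb C)$-valued functions on $P$. For a complex associative unital algebra $A$ with center $Z(A)$ and Lie algebra of derivations $\mathrm{Der}(A)$, the derivation-based calculus $(\Omega_{\mathrm{Der}}(A),\hat d)$ is the smallest differential graded subalgebra containing $A$ of the algebra of alternating $Z(A)$-multilinear maps $\mathrm{Der}(A)^p\to A$ $(p\ge 0)$, with the exterior product of $A$-valued forms and the Koszul differential $$\hat d\omega(X_0,\dots,X_p)=\sum_i(-1)^iX_i\,\omega(\dots,\widehat{X_i},\dots)+\sum_{i<j}(-1)^{i+j}\omega([X_i,X_j],\dots,\widehat{X_i},\dots,\widehat{X_j},\dots).$$ For $A\in\mathfrak{su}(n)$ let $A^v$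 be the associated vertical vector field on $P$, $(A^vf)(p)=\frac{d}{dt}\big|_{t=0}f(p\exp(tA))$, and $\mathrm{ad}_A(b)=[A,b]$. Then: 1. For each $A\in\mathfrak{su}(n)$, $A^v+\mathrm{ad}_A$ is a derivation of $\mathfrak B$, and $A\mapsto A^v+\mathrm{ad}_A$ is an isomorphism of real Lie algebras from $\mathfrak{su}(n)$ onto a Lie subalgebra of $\mathrm{Der}(\mathfrak B)$. 2. The interior products $i_A=i_{A^v+\mathrm{ad}_A}$ define a Cartan operation of $\mathfrak{su}(n)$ on $\Omega_{\mathrm{Der}}(\mathfrak B)$: they map $\Omega_{\mathrm{Der}}(\mathfrak B)$ to itself, depend linearly on $A$, are antiderivations of degree $-1$, and satisfy $i_Ai_B+i_Bi_A=0$ and $[L_A,i_B]=i_{[A,B]}$, where $L_A=i_A\hat d+\hat d\,i_A$. 3. Sending a section $a$ of $\mathrm{End}(E)$ to the function that assigns to each frame the matrix of $a$ in this frame defines an injective homomorphism of algebras $\mathfrak A\to\mathfrak B$. It extends to an injective homomorphism of differential graded algebras $\Omega_{\mathrm{Der}}(\mathfrak A)\to\Omega_{\mathrm{Der}}(\mathfrak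 B)$ whose image is the basic subalgebra $$\Omega_{\mathrm{Der},\mathrm{Bas}}(\mathfrak B)=\{\omega\in\Omega_{\mathrm{Der}}(\mathfrak B)\;:\;i_A\omega=0,\ L_A\omega=0\ \text{ for all }A\in\mathfrak{su}(n)\}.$$ In this sense $\Omega_{\mathrm{Der}}(\mathfrak A)=\Omega_{\mathrm{Der},\mathrm{Bas}}(\mathfrak B)$. -/

import Mathlib

open scoped Manifold ContDiff Matrix Bundle

attribute [local instance] LieRing.ofAssociativeRing

noncomputable section

namespace DerCalc

/-! ## The differential calculus based on derivations -/

/-- The complex Lie algebra of all derivations of an associative complex algebra `A` (with the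
commutator bracket). -/
def Der (A : Type*) [Ring A] [Algebra ℂ A] : LieSubalgebra ℂ (Module.End ℂ A) where
  carrier := {X | ∀ a b : A, X (a * b) = X a * b + a * X b}
  add_mem' := by
    intro X Y hX hY a b
    simp only [LinearMap.add_apply, hX a b, hY a b, add_mul, mul_add]
    abel
  zero_mem' := by
    intro a b
    simp
  smul_mem' := by
    intro c X hX a b
    simp only [LinearMap.smul_apply, hX a b, smul_add, smul_mul_assoc, mul_smul_comm]
  lie_mem' := by
    intro X Y hX hY a b
    simp only [Ring.lie_def, LinearMap.sub_apply, Module.End.mul_apply, hX _ _, hY _ _, map_add,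
      sub_mul, mul_sub]
    abel

/-- Cochains `α = (α 0, α 1, …)` on `Der A` with values in `A`; the component `α p` is a function
of `p` derivations. The differential forms below are generated by elements of `A`
inside this space; the products and differentials of (families of) alternating `Z(A)`-multilinear
maps are of the same kind, so every element of `Ω_Der(A)` has alternating `Z(A)`-multilinear
components, only finitely many of which are nonzero. -/
abbrev Cochain (A : Type*) [Ring A] [Algebra ℂ A] :=
  (p : ℕ) → (Fin p → Der A) → A

section Cochains

variable {A : Type*} [Ring A] [Algebra ℂ A]

/-- An element of `A`, as a form of degree `0`. -/
def ofAlg (a : A) : (p : ℕ) → (Fin p → Der A) → A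
  | 0, _ => a
  | _ + 1, _ => 0

/-- `α` is homogeneous of degree `p`. -/
def IsHomogeneous (p : ℕ) (α : Cochain A) : Prop := ∀ q, q ≠ p → α q = 0

/-- The grading involution, `(-1) ^ p` in degree `p`. -/
def parity (α : Cochain A) : Cochain A := fun p X => (-1 : ℤ) ^ p • α p X

/-- The sign of the shuffle that lists first the elements of `S`, then those of its complement,
both in increasing order. -/
def shuffleSign {p : ℕ} (S : Finset (Fin p)) : ℤ :=
  (-1) ^ (((S ×ˢ Sᶜ).filter fun ij => ij.2 < ij.1).card)

/-- The exterior product of forms with values in the algebra `A`: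
`(α β)(X₁, …, Xₚ) = ∑ ± α(X_S) β(X_{Sᶜ})`, the sum running over all subsets `S` of the indices
(that is, over all shuffles). -/
def wedge (α β : Cochain A) : Cochain A := fun p X =>
  ∑ S : Finset (Fin p), shuffleSign S •
    (α S.card (fun k => X (S.orderEmbOfFin rfl k)) *
      β Sᶜ.card (fun k => X (Sᶜ.orderEmbOfFin rfl k)))

/-- The differential (Koszul formula)
`dα(X₀, …, Xₚ) = ∑ᵢ (-1)ⁱ Xᵢ α(…, X̂ᵢ, …) + ∑_{i<j} (-1)^{i+j} α([Xᵢ, Xⱼ], …, X̂ᵢ, …, X̂ⱼ, …)`,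
where in the second sum the bracket `[Xᵢ, Xⱼ]` has been moved to the place of `Xⱼ` (this
costs the sign `(-1)^{j-1}` for alternating `α`). -/
def dDer (α : Cochain A) : (p : ℕ) → (Fin p → Der A) → A
  | 0, _ => 0
  | p + 1, X => ∑ i : Fin (p + 1), (-1 : ℤ) ^ (i : ℕ) •
      ((X i : Module.End ℂ A) (α p (i.removeNth X)) -
        ∑ j ∈ Finset.Ioi i, α p (i.removeNth (Function.update X j ⁅X i, X j⁆)))

/-- The interior product `i_X`. -/
def contr (X : Der A) (α : Cochain A) : Cochain A := fun p Y => α (p + 1) (Fin.cons X Y)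

/-- The Lie derivative attached to an operation `i` on forms, `L = i d + d i`. -/
def lieD (i : Cochain A → Cochain A) (α : Cochain A) : Cochain A := i (dDer α) + dDer (i α)

end Cochains

/-- `Ω_Der(A)`: the smallest differential graded subalgebra containing `A`. -/
def OmegaDer (A : Type*) [Ring A] [Algebra ℂ A] : Submodule ℂ (Cochain A) :=
  sInf {S | (∀ a : A, ofAlg a ∈ S) ∧ (∀ α ∈ S, ∀ β ∈ S, wedge α β ∈ S) ∧ ∀ α ∈ S, dDer α ∈ S}

namespace OmegaDer

variable {A : Type*} [Ring A] [Algebra ℂ A]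

/-- An element of `A`, as an element of `Ω_Der(A)`. -/
def of (a : A) : OmegaDer A :=
  ⟨ofAlg a, Submodule.mem_sInf.2 fun _ hS => hS.1 a⟩

/-- The product of `Ω_Der(A)`. -/
def mul (α β : OmegaDer A) : OmegaDer A :=
  ⟨wedge α.1 β.1, Submodule.mem_sInf.2 fun S hS =>
    hS.2.1 _ (Submodule.mem_sInf.1 α.2 S hS) _ (Submodule.mem_sInf.1 β.2 S hS)⟩

/-- The differential of `Ω_Der(A)`. -/
def d (α : OmegaDer A) : OmegaDer A :=
  ⟨dDer α.1, Submodule.mem_sInf.2 fun S hS => hS.2.2 _ (Submodule.mem_sInf.1 α.2 S hS)⟩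

end OmegaDer

/-- `i` is a Cartan operation of the real Lie algebra `𝔤` on the differential graded algebra
`Ω_Der(A)`. -/
structure IsCartanOperation (A : Type*) [Ring A] [Algebra ℂ A] {𝔤 : Type*} [LieRing 𝔤]
    [LieAlgebra ℝ 𝔤] (i : 𝔤 → Cochain A → Cochain A) : Prop where
  mapsTo : ∀ x, ∀ α ∈ OmegaDer A, i x α ∈ OmegaDer A
  map_add : ∀ x, ∀ α ∈ OmegaDer A, ∀ β ∈ OmegaDer A, i x (α + β) = i x α + i x β
  map_smul : ∀ x (c : ℂ), ∀ α ∈ OmegaDer A, i x (c • α) = c • i x α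
  add_map : ∀ x y, ∀ α ∈ OmegaDer A, i (x + y) α = i x α + i y α
  smul_map : ∀ (c : ℝ) x, ∀ α ∈ OmegaDer A, i (c • x) α = (c : ℂ) • i x α
  degree_zero : ∀ x, ∀ α ∈ OmegaDer A, IsHomogeneous 0 α → i x α = 0
  degree_succ : ∀ x p, ∀ α ∈ OmegaDer A, IsHomogeneous (p + 1) α → IsHomogeneous p (i x α)
  antiderivation : ∀ x, ∀ α ∈ OmegaDer A, ∀ β ∈ OmegaDer A,
    i x (wedge α β) = wedge (i x α) β + wedge (parity α) (i x β)
  anticomm : ∀ x y, ∀ α ∈ OmegaDer A, i x (i y α) + i y (i x α) = 0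
  lie_contr : ∀ x y, ∀ α ∈ OmegaDer A,
    lieD (i x) (i y α) - i y (lieD (i x) α) = i ⁅x, y⁆ α

/-- The basic forms of an operation: those that are horizontal and invariant. -/
def IsBasic {A : Type*} [Ring A] [Algebra ℂ A] {𝔤 : Type*} (i : 𝔤 → Cochain A → Cochain A)
    (α : Cochain A) : Prop :=
  α ∈ OmegaDer A ∧ (∀ x, i x α = 0) ∧ ∀ x, lieD (i x) α = 0

/-! ## The Lie algebra `su(n)` and its exponential map -/

/-- The real Lie algebra of traceless anti-hermitian matrices. -/
def su (n : ℕ) : LieSubalgebra ℝ (Matrix (Fin n) (Fin n) ℂ) where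
  carrier := {A | Aᴴ = -A ∧ A.trace = 0}
  add_mem' := by
    rintro A B ⟨hA, hA'⟩ ⟨hB, hB'⟩
    refine ⟨?_, ?_⟩
    · rw [Matrix.conjTranspose_add, hA, hB]; abel
    · rw [Matrix.trace_add, hA', hB', add_zero]
  zero_mem' := by simp
  smul_mem' := by
    rintro c A ⟨hA, hA'⟩
    refine ⟨?_, ?_⟩
    · rw [Matrix.conjTranspose_smul, hA]; simp
    · rw [Matrix.trace_smul, hA', smul_zero]
  lie_mem' := by
    rintro A B ⟨hA, hA'⟩ ⟨hB, hB'⟩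
    refine ⟨?_, ?_⟩
    · rw [Ring.lie_def, Matrix.conjTranspose_sub, Matrix.conjTranspose_mul,
        Matrix.conjTranspose_mul, hA, hB]
      simp
    · rw [Ring.lie_def, Matrix.trace_sub, Matrix.trace_mul_comm, sub_self]

lemma det_exp_of_skew {n : ℕ} {A : Matrix (Fin n) (Fin n) ℂ} (hA : Aᴴ = -A) :
    (NormedSpace.exp A).det = Complex.exp A.trace := by
  have hB : (Complex.I • A).IsHermitian := by
    rw [Matrix.IsHermitian, Matrix.conjTranspose_smul, hA]
    simp
  have key := hB.spectral_theorem
  rw [Unitary.conjStarAlgAut_apply] at key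
  set U := hB.eigenvectorUnitary
  set d : Fin n → ℂ := fun i => -Complex.I * (hB.eigenvalues i : ℂ) with hd
  have hU : (U : Matrix (Fin n) (Fin n) ℂ) * star (U : Matrix (Fin n) (Fin n) ℂ) = 1 :=
    Unitary.coe_mul_star_self U
  have hU' : star (U : Matrix (Fin n) (Fin n) ℂ) * (U : Matrix (Fin n) (Fin n) ℂ) = 1 :=
    Unitary.coe_star_mul_self U
  have hA' : A = (U : Matrix (Fin n) (Fin n) ℂ) * Matrix.diagonal d *
      star (U : Matrix (Fin n) (Fin n) ℂ) := by
    have h1 : A = (-Complex.I) • (Complex.I • A) := by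
      rw [smul_smul]; simp
    have h2 : Matrix.diagonal d =
        (-Complex.I) • Matrix.diagonal (RCLike.ofReal ∘ hB.eigenvalues : Fin n → ℂ) := by
      rw [← Matrix.diagonal_smul]; rfl
    rw [h2, Matrix.mul_smul, Matrix.smul_mul]
    conv_lhs => rw [h1, key]
  let V : (Matrix (Fin n) (Fin n) ℂ)ˣ := ⟨U, star (U : Matrix (Fin n) (Fin n) ℂ), hU, hU'⟩
  have h3 := Matrix.exp_units_conj V (Matrix.diagonal d)
  have h4 : A = (V : Matrix (Fin n) (Fin n) ℂ) * Matrix.diagonal d * ((V⁻¹ : _ˣ) : Matrix _ _ ℂ) :=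
    hA'
  rw [h4, h3, Matrix.det_units_conj, Matrix.trace_units_conj, Matrix.exp_diagonal,
    Matrix.det_diagonal, Matrix.trace_diagonal, Complex.exp_sum]
  refine Finset.prod_congr rfl fun i _ => ?_
  rw [Pi.coe_exp, Complex.exp_eq_exp_ℂ]

/-- `exp(t A)` as an element of `SU(n)`. -/
def expSU {n : ℕ} (A : su n) (t : ℝ) : Matrix.specialUnitaryGroup (Fin n) ℂ :=
  ⟨NormedSpace.exp (t • (A : Matrix (Fin n) (Fin n) ℂ)), by
    obtain ⟨h1, h2⟩ : t • (A : Matrix (Fin n) (Fin n) ℂ) ∈ su n := (su n).smul_mem t A.2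
    refine Matrix.mem_specialUnitaryGroup_iff.2 ⟨?_, ?_⟩
    · rw [Matrix.mem_unitaryGroup_iff', Matrix.star_eq_conjTranspose, ← Matrix.exp_conjTranspose,
        h1, ← Matrix.exp_add_of_commute _ _
          (Commute.neg_left (Commute.refl (t • (A : Matrix (Fin n) (Fin n) ℂ)))), neg_add_cancel,
        NormedSpace.exp_zero]
    · rw [det_exp_of_skew h1, h2, Complex.exp_zero]⟩

/-! ## Oriented complex hermitian vector bundles and their frames -/

section Bundles

variable {m : ℕ} (n : ℕ) {M : Type*} [TopologicalSpace M]
  [ChartedSpace (EuclideanSpace ℝ (Fin m)) M]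
  (E : M → Type*) [TopologicalSpace (Bundle.TotalSpace (EuclideanSpace ℂ (Fin n)) E)]
  [∀ x, NormedAddCommGroup (E x)] [∀ x, InnerProductSpace ℂ (E x)]
  [FiberBundle (EuclideanSpace ℂ (Fin n)) E] [VectorBundle ℂ (EuclideanSpace ℂ (Fin n)) E]

/-- The complex vector bundle `E` over the real manifold `M` is smooth, and the inner product
of its fibers depends smoothly on the base point. -/
class IsSmoothHermitianBundle : Prop where
  smooth_coordChange : ∀ (e e' : Bundle.Trivialization (EuclideanSpace ℂ (Fin n))
      (Bundle.TotalSpace.proj : Bundle.TotalSpace (EuclideanSpace ℂ (Fin n)) E → M))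
      [MemTrivializationAtlas e] [MemTrivializationAtlas e'],
    ContMDiffOn (𝓡 m) 𝓘(ℝ, EuclideanSpace ℂ (Fin n) →L[ℂ] EuclideanSpace ℂ (Fin n)) ∞
      (fun x => (e.coordChangeL ℂ e' x : EuclideanSpace ℂ (Fin n) →L[ℂ] EuclideanSpace ℂ (Fin n)))
      (e.baseSet ∩ e'.baseSet)
  smooth_inner : ∀ (e : Bundle.Trivialization (EuclideanSpace ℂ (Fin n))
      (Bundle.TotalSpace.proj : Bundle.TotalSpace (EuclideanSpace ℂ (Fin n)) E → M))
      [MemTrivializationAtlas e] (v w : EuclideanSpace ℂ (Fin n)),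
    ContMDiffOn (𝓡 m) 𝓘(ℝ, ℂ) ∞ (fun x => inner ℂ (e.symm x v) (e.symm x w)) e.baseSet

/-- An orientation of the hermitian bundle `E` of rank `n`: a smooth determinant form of
norm one on the fibers (a unit section of the dual of `Λⁿ E`). -/
structure BundleOrientation where
  vol : ∀ x, E x [⋀^Fin n]→ₗ[ℂ] ℂ
  smooth_vol : ∀ (e : Bundle.Trivialization (EuclideanSpace ℂ (Fin n))
      (Bundle.TotalSpace.proj : Bundle.TotalSpace (EuclideanSpace ℂ (Fin n)) E → M))
      [MemTrivializationAtlas e] (v : Fin n → EuclideanSpace ℂ (Fin n)),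
    ContMDiffOn (𝓡 m) 𝓘(ℝ, ℂ) ∞ (fun x => vol x (fun k => e.symm x (v k))) e.baseSet
  norm_vol : ∀ x (u : Fin n → E x), Orthonormal ℂ u → ‖vol x u‖ = 1

/-- The algebra `𝔄` of smooth sections of `End(E)`. -/
def EndAlg : Subalgebra ℂ (∀ x, E x →L[ℂ] E x) where
  carrier := {a | ∀ (e : Bundle.Trivialization (EuclideanSpace ℂ (Fin n))
      (Bundle.TotalSpace.proj : Bundle.TotalSpace (EuclideanSpace ℂ (Fin n)) E → M))
      [MemTrivializationAtlas e],
    ContMDiffOn (𝓡 m) 𝓘(ℝ, EuclideanSpace ℂ (Fin n) →L[ℂ] EuclideanSpace ℂ (Fin n)) ∞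
      (fun x => e.continuousLinearMapAt ℂ x ∘L a x ∘L e.symmL ℂ x) e.baseSet}
  mul_mem' := by
    intro a b ha hb e _
    have hc : ContDiff ℝ ∞ (fun p : (EuclideanSpace ℂ (Fin n) →L[ℂ] EuclideanSpace ℂ (Fin n)) ×
        (EuclideanSpace ℂ (Fin n) →L[ℂ] EuclideanSpace ℂ (Fin n)) => p.1 ∘L p.2) :=
      (ContDiff.restrict_scalars ℝ (𝕜' := ℂ)
        (isBoundedBilinearMap_comp (𝕜 := ℂ)).contDiff)
    refine (hc.contMDiff.comp_contMDiffOn ((ha e).prodMk_space (hb e))).congr ?_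
    intro x hx
    ext1 v
    exact congrArg (fun w => e.continuousLinearMapAt ℂ x (a x w))
      (e.symmL_continuousLinearMapAt (R := ℂ) hx (b x (e.symmL ℂ x v))).symm
  add_mem' := by
    intro a b ha hb e _
    refine ((contDiff_add (𝕜 := ℝ)).contMDiff.comp_contMDiffOn
      ((ha e).prodMk_space (hb e))).congr ?_
    intro x _
    ext1 v
    simp
  algebraMap_mem' := by
    intro c e _
    refine (contMDiffOn_const (c := c • ContinuousLinearMap.id ℂ _)).congr ?_
    intro x hx
    ext1 v
    simp [Algebra.algebraMap_eq_smul_one, e.continuousLinearMapAt_symmL hx]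

variable {n E}

/-- The frame bundle `P`: its points are the frames `u` of `E` (orthonormal bases of a fiber of `E`)
with `vol u = 1`. -/
structure FrameBundle (o : BundleOrientation (m := m) n E) where
  base : M
  vec : Fin n → E base
  orthonormal : Orthonormal ℂ vec
  vol_eq_one : o.vol base vec = 1

namespace FrameBundle

variable {o : BundleOrientation (m := m) n E}

/-- The right action of `SU(n)` on the frames. -/
def act (p : FrameBundle o) (g : Matrix.specialUnitaryGroup (Fin n) ℂ) : FrameBundle o where
  base := p.base
  vec j := ∑ i, (g : Matrix (Fin n) (Fin n) ℂ) i j • p.vec i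
  orthonormal := by
    have hg := (Matrix.mem_unitaryGroup_iff'.1 (Matrix.mem_specialUnitaryGroup_iff.1 g.2).1)
    rw [orthonormal_iff_ite]
    intro j l
    have h := congrFun (congrFun hg j) l
    rw [Matrix.mul_apply, Matrix.one_apply] at h
    rw [← h, p.orthonormal.inner_sum]
    rfl
  vol_eq_one := by
    have hg := (Matrix.mem_specialUnitaryGroup_iff.1 g.2).2
    have h := AlternatingMap.eq_smul_basis_det (Pi.basisFun ℂ (Fin n))
      ((o.vol p.base).compLinearMap (Fintype.linearCombination ℂ p.vec))
    have h' := congrArg (fun f => f (fun j i => (g : Matrix (Fin n) (Fin n) ℂ) i j)) h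
    have h1 : (Matrix.of fun j i => (g : Matrix (Fin n) (Fin n) ℂ) i j).det = 1 :=
      (Matrix.det_transpose _).trans hg
    simpa [-Pi.basisFun_det, Fintype.linearCombination_apply, p.vol_eq_one, Pi.basisFun_det_apply,
      Pi.single_apply, ite_smul, Function.comp_def, h1] using h'

/-- The components of the frame `p` in a local trivialization `e` of `E`. This identifies the frames
over `e.baseSet` with a submanifold of `M × (ℂⁿ)ⁿ`. -/
def coord (e : Bundle.Trivialization (EuclideanSpace ℂ (Fin n))
      (Bundle.TotalSpace.proj : Bundle.TotalSpace (EuclideanSpace ℂ (Fin n)) E → M))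
    (p : FrameBundle o) : M × (Fin n → EuclideanSpace ℂ (Fin n)) :=
  (p.base, fun k => (e ⟨p.base, p.vec k⟩).2)

end FrameBundle

/-- The algebra `𝓕(P)` of smooth complex functions on `P`, where `P` carries the smooth structure
of a submanifold of the total space of `E ⊕ ⋯ ⊕ E`: a function is smooth if it is locally
the restriction of a smooth function on that space. -/
def SmoothFun (o : BundleOrientation (m := m) n E) : Subalgebra ℂ (FrameBundle o → ℂ) where
  carrier := {f | ∀ (e : Bundle.Trivialization (EuclideanSpace ℂ (Fin n))
      (Bundle.TotalSpace.proj : Bundle.TotalSpace (EuclideanSpace ℂ (Fin n)) E → M))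
      [MemTrivializationAtlas e], ∀ p : FrameBundle o, p.base ∈ e.baseSet →
    ∃ (W : Set (M × (Fin n → EuclideanSpace ℂ (Fin n))))
      (h : M × (Fin n → EuclideanSpace ℂ (Fin n)) → ℂ),
      IsOpen W ∧ p.coord e ∈ W ∧
      ContMDiffOn ((𝓡 m).prod 𝓘(ℝ, Fin n → EuclideanSpace ℂ (Fin n))) 𝓘(ℝ, ℂ) ∞ h W ∧
      ∀ q : FrameBundle o, q.base ∈ e.baseSet → q.coord e ∈ W → f q = h (q.coord e)}
  mul_mem' := by
    intro f g hf hg e _ p hp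
    obtain ⟨W, h, hW, hpW, hh, hfh⟩ := hf e p hp
    obtain ⟨W', h', hW', hpW', hh', hgh⟩ := hg e p hp
    refine ⟨W ∩ W', h * h', hW.inter hW', ⟨hpW, hpW'⟩, ?_, ?_⟩
    · exact (contDiff_mul (𝕜 := ℝ) (𝔸 := ℂ)).contMDiff.comp_contMDiffOn
        ((hh.mono Set.inter_subset_left).prodMk_space (hh'.mono Set.inter_subset_right))
    · intro q hq hqW
      simp only [Pi.mul_apply, hfh q hq hqW.1, hgh q hq hqW.2]
  add_mem' := by
    intro f g hf hg e _ p hp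
    obtain ⟨W, h, hW, hpW, hh, hfh⟩ := hf e p hp
    obtain ⟨W', h', hW', hpW', hh', hgh⟩ := hg e p hp
    refine ⟨W ∩ W', h + h', hW.inter hW', ⟨hpW, hpW'⟩, ?_, ?_⟩
    · exact (contDiff_add (𝕜 := ℝ) (F := ℂ)).contMDiff.comp_contMDiffOn
        ((hh.mono Set.inter_subset_left).prodMk_space (hh'.mono Set.inter_subset_right))
    · intro q hq hqW
      simp only [Pi.add_apply, hfh q hq hqW.1, hgh q hq hqW.2]
  algebraMap_mem' := by
    intro c e _ p hp
    exact ⟨Set.univ, fun _ => c, isOpen_univ, Set.mem_univ _, contMDiffOn_const,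
      fun q _ _ => rfl⟩

/-- The algebra `𝔅 = 𝓕(P) ⊗ Mₙ(ℂ)` of smooth matrix valued functions on `P`. -/
abbrev MatAlg (o : BundleOrientation (m := m) n E) : Type _ :=
  Matrix (Fin n) (Fin n) (SmoothFun o)

/-- The value of `b ∈ 𝔅` at the point `p` of `P`. -/
def evalAt {o : BundleOrientation (m := m) n E} (b : MatAlg o) (p : FrameBundle o) :
    Matrix (Fin n) (Fin n) ℂ :=
  Matrix.of fun i j => (b i j : FrameBundle o → ℂ) p

/-- `X` is the derivation `Aᵛ + ad_A` of `𝔅`: for all `b ∈ 𝔅` and `p ∈ P`, the matrix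
`(X b)(p) - [A, b(p)]` is the derivative of `t ↦ b(p · exp(t A))` at `t = 0`. -/
def IsVertAddAd {o : BundleOrientation (m := m) n E} (A : su n) (X : Der (MatAlg o)) : Prop :=
  ∀ (b : MatAlg o) (p : FrameBundle o) (i j : Fin n),
    HasDerivAt (fun t : ℝ => evalAt b (p.act (expSU A t)) i j)
      ((evalAt ((X : Module.End ℂ (MatAlg o)) b) p -
        ⁅(A : Matrix (Fin n) (Fin n) ℂ), evalAt b p⁆) i j) 0

/-- `b ∈ 𝔅` represents the section `a` of `End(E)`: at each frame `u`, the matrix `b(u)` is the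
matrix of `a` in the frame `u`. -/
def Represents {o : BundleOrientation (m := m) n E} (b : MatAlg o) (a : EndAlg (m := m) n E) :
    Prop :=
  ∀ (p : FrameBundle o) (i j : Fin n),
    evalAt b p i j = inner ℂ (p.vec i) ((a : ∀ x, E x →L[ℂ] E x) p.base (p.vec j))

end Bundles

end DerCalc

end

open DerCalc

/-! A section of End(E) is the same as a matrix function on P that is conjugated when the frame is
rotated. This equivariance is equivalent to the infinitesimal condition (Aᵛ + ad_A) b = 0, because
the exponential map of SU(n) is onto (`exists_repHom_eq`, `equivariant_of_vertDer_eq_zero`). This is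
the theorem in degree zero.

In higher degrees every form is a combination of words a₀ da₁ ⋯ daₚ, and `FormPair` relates such a
combination over 𝔄 to the one with each a replaced by ι(a). Values of words depend only on the
values of the derivations on the letters. At each frame the derivations of 𝔅 and those of 𝔄 take the
same values on ι(𝔄), so a combination vanishes on one side exactly when it vanishes on the other
(`formPair_zero_left`, `formPair_zero_right`). Hence the relation is the graph of an injective
homomorphism. Words in the ι(a) are horizontal and this class is stable under d, so they are basic.

That every basic form arises rests on two geometric facts. First, a derivation of 𝔅 that kills 𝔄 at
a frame equals there a complex combination of the Aᵛ + ad_A (`exists_vertical`). Second, there is a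
finite `DualBasis`: derivations Xᵢ of 𝔄 with extensions Yᵢ to 𝔅, and one-forms θᵢ over 𝔄, such that
every derivation δ of 𝔄 at a frame is ∑ θᵢ(δ) Xᵢ. For a horizontal β of degree q these give Euler's
identity ∑ θᵢ ∧ i_{Yᵢ} β = q β (`euler_eq_smul`). The contractions i_{Yᵢ} β are again basic, since
the bracket of Aᵛ + ad_A with Yᵢ kills 𝔄 and is therefore vertical at each frame. Induction on the
degree writes β as a word in ι(𝔄).

Over a chart with a unimodular orthonormal frame the dual basis consists of the coordinate fields,
lifted with constant frame matrix, and of the inner derivations by matrix units. Elements of Ω_Der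
are finite sums, so on a noncompact M finitely many such local families have to suffice. This is why
the cover by charts is sorted into finitely many colors (`exists_finite_coloring`) before a
partition of unity glues the families (`IsModel.nonempty_dualBasis`). -/

noncomputable section

namespace DerCalc

/-! ### Graded identities for arbitrary cochains, proved by contraction. -/

section CochainCalculus

variable {A : Type*} [Ring A] [Algebra ℂ A]

/-! ### Interior products and the exterior product -/

lemma der_leibniz (X : Der A) (a b : A) :
    (X : Module.End ℂ A) (a * b) = (X : Module.End ℂ A) a * b + a * (X : Module.End ℂ A) b :=
  X.2 a b

lemma der_map_one (X : Der A) : (X : Module.End ℂ A) 1 = 0 := by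
  have h := der_leibniz X 1 1
  simpa using h

lemma der_bracket_apply (X Y : Der A) (a : A) :
    ((⁅X, Y⁆ : Der A) : Module.End ℂ A) a =
      (X : Module.End ℂ A) ((Y : Module.End ℂ A) a) -
        (Y : Module.End ℂ A) ((X : Module.End ℂ A) a) := rfl

/-- The first argument of a cochain of positive degree can be split off as a contraction. All
identities of this part are proved by this recursion on the degree. -/
lemma cochain_ext {α β : Cochain A} (h0 : ∀ X, α 0 X = β 0 X)
    (h : ∀ X, contr X α = contr X β) : α = β := by
  funext p X
  cases p with
  | zero => exact h0 X
  | succ p =>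
    have := congrFun (congrFun (h (X 0)) p) (Fin.tail X)
    simpa [contr, Fin.cons_self_tail] using this

/-- A subset of `Fin (p + 1)` either contains 0 or does not. For the exterior product this decides
which factor receives the first derivation. -/
lemma sum_finset_fin_succ {R : Type*} [AddCommMonoid R] {p : ℕ} (f : Finset (Fin (p + 1)) → R) :
    ∑ S, f S = (∑ T : Finset (Fin p), f (insert 0 (T.map (Fin.succEmb p)))) +
      ∑ T : Finset (Fin p), f (T.map (Fin.succEmb p)) := by
  classical
  have h1 : (Finset.univ : Finset (Finset (Fin (p + 1)))) =
      (insert (0 : Fin (p + 1)) (Finset.univ.map (Fin.succEmb p))).powerset := by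
    rw [← Finset.powerset_univ]
    congr 1
    ext i
    refine Fin.cases ?_ (fun j => ?_) i <;> simp
  have h0 : (0 : Fin (p + 1)) ∉ (Finset.univ : Finset (Fin p)).map (Fin.succEmb p) := by simp
  have h2 : ((Finset.univ : Finset (Fin p)).map (Fin.succEmb p)).powerset =
      (Finset.univ : Finset (Finset (Fin p))).image (fun T => T.map (Fin.succEmb p)) := by
    ext S
    simp only [Finset.mem_powerset, Finset.mem_image, Finset.mem_univ, true_and,
      Finset.subset_map_iff]
    constructor
    · rintro ⟨T, _, rfl⟩; exact ⟨T, rfl⟩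
    · rintro ⟨T, rfl⟩; exact ⟨T, Finset.subset_univ _, rfl⟩
  rw [h1, Finset.sum_powerset_insert h0, h2, Finset.sum_image, Finset.sum_image, add_comm]
  · intro a _ b _ hab; exact Finset.map_injective _ hab
  · intro a _ b _ hab; exact Finset.map_injective _ hab

lemma compl_map_succ {p : ℕ} (T : Finset (Fin p)) :
    (T.map (Fin.succEmb p))ᶜ = insert 0 (Tᶜ.map (Fin.succEmb p)) := by
  ext i
  refine Fin.cases ?_ (fun j => ?_) i <;> simp

lemma compl_insert_map_succ {p : ℕ} (T : Finset (Fin p)) :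
    (insert 0 (T.map (Fin.succEmb p)))ᶜ = Tᶜ.map (Fin.succEmb p) := by
  ext i
  refine Fin.cases ?_ (fun j => ?_) i <;> simp

lemma shuffle_count {p : ℕ} (S : Finset (Fin p)) :
    ((S ×ˢ Sᶜ).filter fun ij => ij.2 < ij.1).card =
      ∑ i ∈ S, ∑ j ∈ Sᶜ, if j < i then 1 else 0 := by
  rw [Finset.card_filter, Finset.sum_product]

lemma shuffleSign_insert {p : ℕ} (T : Finset (Fin p)) :
    shuffleSign (insert 0 (T.map (Fin.succEmb p))) = shuffleSign T := by
  rw [shuffleSign, shuffleSign, shuffle_count, shuffle_count, compl_insert_map_succ,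
    Finset.sum_insert (by simp)]
  simp only [Finset.sum_map]
  simp

/-- The index 0 now lies in the complement and is smaller than every element of the shifted set,
which adds `T.card` inversions. -/
lemma shuffleSign_map {p : ℕ} (T : Finset (Fin p)) :
    shuffleSign (T.map (Fin.succEmb p)) = (-1) ^ T.card * shuffleSign T := by
  rw [shuffleSign, shuffleSign, shuffle_count, shuffle_count, compl_map_succ, ← pow_add]
  congr 1
  simp only [Finset.sum_map]
  simp [Finset.sum_add_distrib]

/-- The number of arguments of α is `S.card`, a dependent index. Any increasing enumeration may
replace the canonical one, so the sets can be changed without casts. -/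
lemma eval_orderEmb (α : Cochain A) {p q : ℕ} (X : Fin p → Der A) (S : Finset (Fin p))
    (f : Fin q → Fin p) (hS : S.card = q) (hf : ∀ k, f k ∈ S) (hm : StrictMono f) :
    α S.card (fun k => X (S.orderEmbOfFin rfl k)) = α q (fun k => X (f k)) := by
  subst hS
  rw [Finset.orderEmbOfFin_unique rfl hf hm]

lemma eval_congr_finset (α : Cochain A) {p : ℕ} (X : Fin p → Der A) {S S' : Finset (Fin p)}
    (h : S = S') : α S.card (fun k => X (S.orderEmbOfFin rfl k)) =
      α S'.card (fun k => X (S'.orderEmbOfFin rfl k)) := by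
  subst h; rfl

lemma eval_map_succ (α : Cochain A) {p : ℕ} (X : Der A) (Y : Fin p → Der A)
    (T : Finset (Fin p)) :
    α (T.map (Fin.succEmb p)).card (fun k => (Fin.cons X Y : Fin (p + 1) → Der A)
      ((T.map (Fin.succEmb p)).orderEmbOfFin rfl k)) =
    α T.card (fun k => Y (T.orderEmbOfFin rfl k)) := by
  rw [eval_orderEmb α (Fin.cons X Y) (T.map (Fin.succEmb p))
    (fun k => (T.orderEmbOfFin rfl k).succ) (Finset.card_map _)]
  · simp only [Fin.cons_succ]
  · intro k
    simp
  · intro k l hkl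
    simpa using hkl

lemma eval_insert_succ (α : Cochain A) {p : ℕ} (X : Der A) (Y : Fin p → Der A)
    (T : Finset (Fin p)) :
    α (insert 0 (T.map (Fin.succEmb p))).card (fun k => (Fin.cons X Y : Fin (p + 1) → Der A)
      ((insert 0 (T.map (Fin.succEmb p))).orderEmbOfFin rfl k)) =
    contr X α T.card (fun k => Y (T.orderEmbOfFin rfl k)) := by
  rw [eval_orderEmb α (Fin.cons X Y) (insert 0 (T.map (Fin.succEmb p)))
    (Fin.cons 0 fun k => (T.orderEmbOfFin rfl k).succ)
    (by rw [Finset.card_insert_of_notMem (by simp), Finset.card_map])]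
  · rw [contr]
    congr 1
    funext k
    refine Fin.cases ?_ (fun j => ?_) k <;> simp
  · intro k
    refine Fin.cases ?_ (fun j => ?_) k <;> simp
  · intro k l
    refine Fin.cases ?_ (fun j => ?_) k <;> refine Fin.cases ?_ (fun i => ?_) l <;> simp

/-- Split the shuffles by the factor that receives X; in the second case the sign of passing X over
T is that of `parity`. No alternation or linearity of α and β is involved. -/
lemma contr_wedge (X : Der A) (α β : Cochain A) :
    contr X (wedge α β) = wedge (contr X α) β + wedge (parity α) (contr X β) := by
  funext p Y
  rw [Pi.add_apply, Pi.add_apply]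
  rw [contr, wedge, sum_finset_fin_succ]
  congr 1
  · refine Finset.sum_congr rfl fun T _ => ?_
    rw [shuffleSign_insert, eval_insert_succ α X Y T]
    congr 2
    rw [← eval_map_succ β X Y Tᶜ, eval_congr_finset β _ (compl_insert_map_succ T)]
  · refine Finset.sum_congr rfl fun T _ => ?_
    rw [shuffleSign_map, eval_map_succ α X Y T, ← eval_insert_succ β X Y Tᶜ,
      eval_congr_finset β _ (compl_map_succ T), parity, smul_mul_assoc, smul_smul, mul_comm]

lemma wedge_zero_apply (α β : Cochain A) (X : Fin 0 → Der A) :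
    wedge α β 0 X = α 0 X * β 0 X := by
  rw [wedge, Fintype.sum_eq_single ∅ (fun S hS => absurd (Subsingleton.elim _ _) hS)]
  have : shuffleSign (∅ : Finset (Fin 0)) = 1 := by simp [shuffleSign]
  rw [this, one_smul]
  congr 1
  · exact congrArg (α 0) (Subsingleton.elim _ _)
  · exact congrArg (β 0) (Subsingleton.elim _ _)

lemma contr_add (X : Der A) (α β : Cochain A) : contr X (α + β) = contr X α + contr X β := rfl
lemma contr_sub (X : Der A) (α β : Cochain A) : contr X (α - β) = contr X α - contr X β := rfl
lemma contr_smul (X : Der A) (c : ℂ) (α : Cochain A) : contr X (c • α) = c • contr X α := rfl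
lemma contr_zero (X : Der A) : contr X (0 : Cochain A) = 0 := rfl

lemma contr_sum {ι : Type*} (s : Finset ι) (X : Der A) (f : ι → Cochain A) :
    contr X (∑ i ∈ s, f i) = ∑ i ∈ s, contr X (f i) := by
  classical
  induction s using Finset.induction_on with
  | empty => simp [contr_zero]
  | insert i s hi ih => rw [Finset.sum_insert hi, Finset.sum_insert hi, contr_add, ih]

lemma contr_ofAlg (X : Der A) (a : A) : contr X (ofAlg a : Cochain A) = 0 := rfl

lemma contr_parity (X : Der A) (α : Cochain A) :
    contr X (parity α) = -parity (contr X α) := by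
  funext p Y
  simp [contr, parity, pow_succ]

lemma parity_add (α β : Cochain A) : parity (α + β) = parity α + parity β := by
  funext p Y; simp [parity]
lemma parity_neg (α : Cochain A) : parity (-α) = -parity α := by
  funext p Y; simp [parity]
lemma parity_parity (α : Cochain A) : parity (parity α) = α := by
  funext p Y
  rw [parity, parity, smul_smul, ← mul_pow]
  simp
lemma parity_ofAlg (a : A) : parity (ofAlg a : Cochain A) = ofAlg a := by
  funext p Y; cases p <;> simp [parity, ofAlg]
lemma parity_zero_apply (α : Cochain A) (X : Fin 0 → Der A) : parity α 0 X = α 0 X := by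
  simp [parity]

lemma wedge_add_left (α α' β : Cochain A) :
    wedge (α + α') β = wedge α β + wedge α' β := by
  funext p X
  simp [wedge, add_mul, Finset.sum_add_distrib]
lemma wedge_add_right (α β β' : Cochain A) :
    wedge α (β + β') = wedge α β + wedge α β' := by
  funext p X
  simp [wedge, mul_add, Finset.sum_add_distrib]
lemma wedge_smul_left (c : ℂ) (α β : Cochain A) :
    wedge (c • α) β = c • wedge α β := by
  funext p X
  simp only [wedge, Pi.smul_apply, smul_mul_assoc, Finset.smul_sum]
  exact Finset.sum_congr rfl fun S _ => smul_comm _ _ _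
lemma wedge_smul_right (c : ℂ) (α β : Cochain A) :
    wedge α (c • β) = c • wedge α β := by
  funext p X
  simp only [wedge, Pi.smul_apply, mul_smul_comm, Finset.smul_sum]
  exact Finset.sum_congr rfl fun S _ => smul_comm _ _ _
lemma wedge_neg_left (α β : Cochain A) : wedge (-α) β = -wedge α β := by
  rw [← neg_one_smul ℂ, wedge_smul_left, neg_one_smul]
lemma wedge_neg_right (α β : Cochain A) : wedge α (-β) = -wedge α β := by
  rw [← neg_one_smul ℂ, wedge_smul_right, neg_one_smul]
lemma wedge_zero_left (β : Cochain A) : wedge 0 β = 0 := by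
  simpa only [zero_smul] using wedge_smul_left (0 : ℂ) 0 β
lemma wedge_zero_right (α : Cochain A) : wedge α 0 = 0 := by
  simpa only [zero_smul] using wedge_smul_right (0 : ℂ) α 0
lemma wedge_sub_left (α α' β : Cochain A) : wedge (α - α') β = wedge α β - wedge α' β := by
  rw [sub_eq_add_neg, wedge_add_left, wedge_neg_left, ← sub_eq_add_neg]
lemma wedge_sub_right (α β β' : Cochain A) : wedge α (β - β') = wedge α β - wedge α β' := by
  rw [sub_eq_add_neg, wedge_add_right, wedge_neg_right, ← sub_eq_add_neg]

/-- To prove an identity `F x = G x` of cochains depending on a parameter, it is enough to check it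
in degree zero and to express the contractions of `F x - G x` by similar differences. -/
lemma contr_induction {ι : Type*} (F : ι → Cochain A) (h0 : ∀ i X, F i 0 X = 0)
    (h : ∀ i X, contr X (F i) ∈ Submodule.span ℂ (Set.range F)) (i : ι) : F i = 0 := by
  have key : ∀ p, ∀ α ∈ Submodule.span ℂ (Set.range F), α p = 0 := by
    intro p
    induction p with
    | zero =>
      intro α hα
      induction hα using Submodule.span_induction with
      | mem x hx => obtain ⟨i, rfl⟩ := hx; funext X; exact h0 i X
      | zero => rfl
      | add x y _ _ hx hy => rw [Pi.add_apply, hx, hy, add_zero]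
      | smul c x _ hx => rw [Pi.smul_apply, hx, smul_zero]
    | succ p ih =>
      have hc : ∀ X : Der A, ∀ α ∈ Submodule.span ℂ (Set.range F),
          contr X α ∈ Submodule.span ℂ (Set.range F) := by
        intro X α hα
        induction hα using Submodule.span_induction with
        | mem x hx => obtain ⟨i, rfl⟩ := hx; exact h i X
        | zero => exact Submodule.zero_mem _
        | add x y _ _ hx hy => rw [contr_add]; exact Submodule.add_mem _ hx hy
        | smul c x _ hx => rw [contr_smul]; exact Submodule.smul_mem _ _ hx
      intro α hα
      funext X
      have := congrFun (ih _ (hc (X 0) α hα)) (Fin.tail X)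
      simpa [contr, Fin.cons_self_tail] using this
  funext p
  exact key p _ (Submodule.subset_span ⟨i, rfl⟩)

lemma parity_wedge (α β : Cochain A) : parity (wedge α β) = wedge (parity α) (parity β) := by
  have := contr_induction (ι := Cochain A × Cochain A)
    (fun x => parity (wedge x.1 x.2) - wedge (parity x.1) (parity x.2))
    (fun x X => by
      simp [parity_zero_apply, wedge_zero_apply])
    (fun x X => by
      have : contr X (parity (wedge x.1 x.2) - wedge (parity x.1) (parity x.2)) =
        -(parity (wedge (contr X x.1) x.2) - wedge (parity (contr X x.1)) (parity x.2))
        - (parity (wedge (parity x.1) (contr X x.2)) -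
          wedge (parity (parity x.1)) (parity (contr X x.2))) := by
        rw [contr_sub, contr_parity, contr_wedge, contr_wedge, contr_parity, contr_parity,
          parity_add, wedge_neg_left, wedge_neg_right]
        abel
      rw [this]
      exact Submodule.sub_mem _
        (Submodule.neg_mem _ (Submodule.subset_span ⟨(contr X x.1, x.2), rfl⟩))
        (Submodule.subset_span ⟨(parity x.1, contr X x.2), rfl⟩)) (α, β)
  exact sub_eq_zero.1 this

lemma wedge_assoc (α β γ : Cochain A) : wedge (wedge α β) γ = wedge α (wedge β γ) := by
  have := contr_induction (ι := Cochain A × Cochain A × Cochain A)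
    (fun x => wedge (wedge x.1 x.2.1) x.2.2 - wedge x.1 (wedge x.2.1 x.2.2))
    (fun x X => by
      simp [wedge_zero_apply, mul_assoc])
    (fun x X => by
      obtain ⟨α, β, γ⟩ := x
      have : contr X (wedge (wedge α β) γ - wedge α (wedge β γ)) =
        (wedge (wedge (contr X α) β) γ - wedge (contr X α) (wedge β γ)) +
        (wedge (wedge (parity α) (contr X β)) γ - wedge (parity α) (wedge (contr X β) γ)) +
        (wedge (wedge (parity α) (parity β)) (contr X γ) -
          wedge (parity α) (wedge (parity β) (contr X γ))) := by
        rw [contr_sub, contr_wedge, contr_wedge, contr_wedge, contr_wedge, parity_wedge,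
          wedge_add_left, wedge_add_right]
        abel
      rw [this]
      exact Submodule.add_mem _ (Submodule.add_mem _
        (Submodule.subset_span ⟨(contr X α, β, γ), rfl⟩)
        (Submodule.subset_span ⟨(parity α, contr X β, γ), rfl⟩))
        (Submodule.subset_span ⟨(parity α, parity β, contr X γ), rfl⟩)) (α, β, γ)
  exact sub_eq_zero.1 this

lemma ofAlg_wedge (a : A) (α : Cochain A) (p : ℕ) (X : Fin p → Der A) :
    wedge (ofAlg a) α p X = a * α p X := by
  have := contr_induction (ι := Cochain A)
    (fun α => wedge (ofAlg a) α - fun p X => a * α p X)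
    (fun α X => by simp [wedge_zero_apply, ofAlg])
    (fun α X => by
      have : contr X (wedge (ofAlg a) α - fun p X => a * α p X) =
        wedge (ofAlg a) (contr X α) - fun p Y => a * contr X α p Y := by
        rw [contr_sub, contr_wedge, contr_ofAlg, wedge_zero_left, zero_add, parity_ofAlg]
        rfl
      rw [this]
      exact Submodule.subset_span ⟨contr X α, rfl⟩) α
  exact congrFun (congrFun (sub_eq_zero.1 this) p) X

lemma ofAlg_mul (a b : A) : (ofAlg (a * b) : Cochain A) = wedge (ofAlg a) (ofAlg b) := by
  funext p X
  rw [ofAlg_wedge]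
  cases p <;> simp [ofAlg]

lemma ofAlg_add (a b : A) : (ofAlg (a + b) : Cochain A) = ofAlg a + ofAlg b := by
  funext p X
  cases p <;> simp [ofAlg]

lemma ofAlg_smul (c : ℂ) (a : A) : (ofAlg (c • a) : Cochain A) = c • ofAlg a := by
  funext p X
  cases p <;> simp [ofAlg]

lemma ofAlg_zero : (ofAlg (0 : A) : Cochain A) = 0 := by
  funext p X
  cases p <;> simp [ofAlg]

/-! ### The Koszul differential -/

lemma dDer_zero_apply (α : Cochain A) (X : Fin 0 → Der A) : dDer α 0 X = 0 := rfl

lemma dDer_add (α β : Cochain A) : dDer (α + β) = dDer α + dDer β := by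
  funext p X
  cases p with
  | zero => simp [dDer]
  | succ p =>
    simp only [dDer, Pi.add_apply, map_add, Finset.sum_add_distrib]
    rw [← Finset.sum_add_distrib]
    refine Finset.sum_congr rfl fun i _ => ?_
    rw [← smul_add]
    congr 1
    abel

lemma dDer_smul (c : ℂ) (α : Cochain A) : dDer (c • α) = c • dDer α := by
  funext p X
  cases p with
  | zero => simp [dDer]
  | succ p =>
    simp only [dDer, Pi.smul_apply, map_smul, Finset.smul_sum]
    refine Finset.sum_congr rfl fun i _ => ?_
    rw [smul_comm, ← Finset.smul_sum, ← smul_sub]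

lemma dDer_neg (α : Cochain A) : dDer (-α) = -dDer α := by
  rw [← neg_one_smul ℂ, dDer_smul, neg_one_smul]

lemma dDer_zero : dDer (0 : Cochain A) = 0 := by
  simpa only [zero_smul] using dDer_smul (0 : ℂ) (0 : Cochain A)

/-- The Lie derivative of a cochain. -/
def lieDer (X : Der A) (α : Cochain A) : Cochain A := fun p Y =>
  (X : Module.End ℂ A) (α p Y) - ∑ j, α p (Function.update Y j ⁅X, Y j⁆)

lemma removeNth_succ_cons {p : ℕ} (X : Der A) (Y : Fin (p + 1) → Der A) (i : Fin (p + 1)) :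
    Fin.removeNth i.succ (Fin.cons X Y : Fin (p + 1 + 1) → Der A) =
      Fin.cons X (i.removeNth Y) := by
  funext k
  refine Fin.cases ?_ (fun j => ?_) k
  · simp [Fin.removeNth]
  · simp [Fin.removeNth]

/-- The terms of the Koszul formula with i = 0 form the Lie derivative, and the others form the
differential of the contraction with opposite sign. Since brackets stand in the place of the later
argument, this holds for cochains that are not alternating. -/
lemma contr_dDer (X : Der A) (α : Cochain A) :
    contr X (dDer α) = lieDer X α - dDer (contr X α) := by
  funext p Y
  rw [Pi.sub_apply, Pi.sub_apply, contr, dDer, Fin.sum_univ_succ, lieDer]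
  simp only [Fin.val_zero, pow_zero, one_smul, Fin.cons_zero]
  rw [sub_eq_add_neg _ (dDer (contr X α) p Y)]
  congr 1
  · congr 1
    rw [show Finset.Ioi (0 : Fin (p + 1)) = Finset.univ.map (Fin.succEmb p) from ?_]
    · rw [Finset.sum_map]
      refine Finset.sum_congr rfl fun j _ => ?_
      congr 1
      funext k
      simp only [Fin.removeNth, Fin.zero_succAbove, Fin.coe_succEmb]
      by_cases h : k = j
      · subst h; simp
      · rw [Function.update_of_ne (by simpa using h), Function.update_of_ne h, Fin.cons_succ]
    · ext k
      refine Fin.cases ?_ (fun j => ?_) k <;> simp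
  · cases p with
    | zero => simp [dDer]
    | succ p =>
      rw [dDer, ← Finset.sum_neg_distrib]
      refine Finset.sum_congr rfl fun i _ => ?_
      rw [← neg_smul]
      have hs : (-1 : ℤ) ^ ((i.succ : Fin (p + 1 + 1)) : ℕ) = -(-1) ^ (i : ℕ) := by
        rw [Fin.val_succ, pow_succ]; ring
      rw [hs, removeNth_succ_cons, Fin.cons_succ]
      congr 2
      rw [show Finset.Ioi (i.succ) = (Finset.Ioi i).map (Fin.succEmb (p + 1)) from ?_]
      · rw [Finset.sum_map]
        refine Finset.sum_congr rfl fun j _ => ?_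
        rw [contr]
        congr 1
        have : Function.update (Fin.cons X Y : Fin (p + 1 + 1) → Der A) (Fin.succEmb _ j)
            ⁅Y i, (Fin.cons X Y : Fin (p + 1 + 1) → Der A) (Fin.succEmb _ j)⁆ =
            Fin.cons X (Function.update Y j ⁅Y i, Y j⁆) := by
          rw [Fin.coe_succEmb, Fin.cons_succ, Fin.cons_update]
        rw [this, removeNth_succ_cons]
      · ext k
        refine Fin.cases ?_ (fun j => ?_) k <;> simp

lemma lieD_contr (X : Der A) (α : Cochain A) : lieD (contr X) α = lieDer X α := by
  rw [lieD, contr_dDer, sub_add_cancel]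

lemma lieDer_zero_apply (X : Der A) (α : Cochain A) (Y : Fin 0 → Der A) :
    lieDer X α 0 Y = (X : Module.End ℂ A) (α 0 Y) := by
  simp [lieDer]

lemma contr_lieDer (X Y : Der A) (α : Cochain A) :
    contr Y (lieDer X α) = lieDer X (contr Y α) - contr ⁅X, Y⁆ α := by
  funext p Z
  simp only [contr, lieDer, Pi.sub_apply, Fin.sum_univ_succ, Fin.cons_zero, Fin.cons_succ,
    Fin.update_cons_zero, Fin.cons_update]
  abel

lemma lieDer_add (X : Der A) (α β : Cochain A) :
    lieDer X (α + β) = lieDer X α + lieDer X β := by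
  rw [← lieD_contr, ← lieD_contr, ← lieD_contr, lieD, lieD, lieD, contr_add, dDer_add, dDer_add,
    contr_add]
  abel

lemma lieDer_parity (X : Der A) (α : Cochain A) :
    lieDer X (parity α) = parity (lieDer X α) := by
  funext p Y
  simp only [lieDer, parity, map_zsmul, smul_sub, Finset.smul_sum]

/-- The defect of the Leibniz rule contracts to sums of such defects: the extra terms with the
bracket of X and Y cancel by `contr_wedge`. In degree zero it is the Leibniz rule of X. -/
lemma lieDer_wedge (X : Der A) (α β : Cochain A) :
    lieDer X (wedge α β) = wedge (lieDer X α) β + wedge α (lieDer X β) := by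
  let F : Cochain A × Cochain A → Cochain A := fun x =>
    lieDer X (wedge x.1 x.2) - wedge (lieDer X x.1) x.2 - wedge x.1 (lieDer X x.2)
  have := contr_induction F
    (fun x Y => by
      simp only [F, Pi.sub_apply, lieDer_zero_apply, wedge_zero_apply, der_leibniz]
      abel)
    (fun x Y => by
      obtain ⟨α, β⟩ := x
      have : contr Y (F (α, β)) = F (contr Y α, β) + F (parity α, contr Y β) := by
        simp only [F, contr_sub, contr_lieDer, contr_wedge, lieDer_add, wedge_sub_left,
          wedge_sub_right, lieDer_parity]
        abel
      rw [this]
      exact Submodule.add_mem _ (Submodule.subset_span ⟨_, rfl⟩)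
        (Submodule.subset_span ⟨_, rfl⟩)) (α, β)
  have h2 := sub_eq_zero.1 this
  rw [← h2]; abel

lemma parity_dDer (α : Cochain A) : parity (dDer α) = -dDer (parity α) := by
  let F : Cochain A → Cochain A := fun α => parity (dDer α) + dDer (parity α)
  have := contr_induction F
    (fun x Y => by simp [F, dDer_zero_apply, parity])
    (fun α Y => by
      have : contr Y (F α) = -F (-contr Y α) := by
        simp only [F, contr_add, contr_parity, contr_dDer, lieDer_parity, parity_neg, dDer_neg,
          sub_eq_add_neg, parity_add]
        abel
      rw [this]
      exact Submodule.neg_mem _ (Submodule.subset_span ⟨_, rfl⟩)) α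
  exact eq_neg_of_add_eq_zero_left this

lemma dDer_wedge (α β : Cochain A) :
    dDer (wedge α β) = wedge (dDer α) β + wedge (parity α) (dDer β) := by
  let F : Cochain A × Cochain A → Cochain A := fun x =>
    dDer (wedge x.1 x.2) - wedge (dDer x.1) x.2 - wedge (parity x.1) (dDer x.2)
  have := contr_induction F
    (fun x Y => by simp [F, dDer_zero_apply, wedge_zero_apply])
    (fun x Y => by
      obtain ⟨α, β⟩ := x
      have : contr Y (F (α, β)) = -F (contr Y α, β) - F (parity α, contr Y β) := by
        simp only [F, contr_sub, contr_dDer, contr_wedge, dDer_add, lieDer_wedge, wedge_sub_left,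
          wedge_sub_right, contr_parity, parity_parity, parity_dDer, wedge_neg_left]
        abel
      rw [this]
      exact Submodule.sub_mem _ (Submodule.neg_mem _ (Submodule.subset_span ⟨_, rfl⟩))
        (Submodule.subset_span ⟨_, rfl⟩)) (α, β)
  have h2 := sub_eq_zero.1 this
  rw [← h2]; abel

lemma contr_dDer_ofAlg (X : Der A) (a : A) :
    contr X (dDer (ofAlg a)) = ofAlg ((X : Module.End ℂ A) a) := by
  rw [contr_dDer, contr_ofAlg, dDer_zero, sub_zero]
  funext p Y
  cases p <;> simp [lieDer, ofAlg]

/-- Contracting with X and then Y leaves X(Ya) - [X,Y]a - Y(Xa), which is zero. This case of d² = 0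
is all that the normal form needs. -/
lemma dDer_dDer_ofAlg (a : A) : dDer (dDer (ofAlg a : Cochain A)) = 0 := by
  refine cochain_ext (fun X => rfl) fun X => ?_
  refine cochain_ext (fun Y => ?_) fun Y => ?_
  · simp [contr, dDer]
  · rw [contr_dDer, contr_dDer_ofAlg, contr_sub, contr_lieDer, contr_dDer_ofAlg,
      contr_dDer_ofAlg, contr_dDer_ofAlg, contr_zero, contr_zero]
    funext p Z
    cases p with
    | zero => simp [lieDer, ofAlg]
    | succ p => simp [lieDer, ofAlg]

end CochainCalculus

end DerCalc

end

noncomputable section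

namespace DerCalc

/-! ### Words a₀ da₁ ⋯ daₚ, Cartan operations and homogeneous components. -/

section NormalForm

variable {A : Type*} [Ring A] [Algebra ℂ A] {B : Type*} [Ring B] [Algebra ℂ B]

lemma wedge_one (γ : Cochain A) : wedge γ (ofAlg 1) = γ := by
  have := contr_induction (fun γ : Cochain A => wedge γ (ofAlg 1) - γ)
    (fun γ X => by simp [wedge_zero_apply, ofAlg])
    (fun γ X => by
      have : contr X (wedge γ (ofAlg 1) - γ) = wedge (contr X γ) (ofAlg 1) - contr X γ := by
        rw [contr_sub, contr_wedge, contr_ofAlg, wedge_zero_right, add_zero]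
      rw [this]
      exact Submodule.subset_span ⟨_, rfl⟩) γ
  exact sub_eq_zero.1 this

/-- The pairs of corresponding linear combinations of products `a₀ da₁ ⋯ daₚ` and
`ι(a₀) dι(a₁) ⋯ dι(aₚ)`. -/
inductive FormPair (ι : A →ₐ[ℂ] B) : Cochain A → Cochain B → Prop
  | of (a : A) : FormPair ι (ofAlg a) (ofAlg (ι a))
  | add {α α' β β'} : FormPair ι α β → FormPair ι α' β' → FormPair ι (α + α') (β + β')
  | smul (c : ℂ) {α β} : FormPair ι α β → FormPair ι (c • α) (c • β)
  | mulLeft (a : A) {α β} : FormPair ι α β →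
      FormPair ι (wedge (ofAlg a) α) (wedge (ofAlg (ι a)) β)
  | dLeft (a : A) {α β} : FormPair ι α β →
      FormPair ι (wedge (dDer (ofAlg a)) α) (wedge (dDer (ofAlg (ι a))) β)

namespace FormPair

variable {ι : A →ₐ[ℂ] B} {α α' : Cochain A} {β β' : Cochain B}

lemma zero : FormPair ι (0 : Cochain A) (0 : Cochain B) := by
  simpa only [zero_smul] using FormPair.smul (ι := ι) 0 (FormPair.of 0)

lemma neg (h : FormPair ι α β) : FormPair ι (-α) (-β) := by
  simpa only [neg_one_smul] using FormPair.smul (-1) h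

lemma sub (h : FormPair ι α β) (h' : FormPair ι α' β') : FormPair ι (α - α') (β - β') := by
  simpa only [sub_eq_add_neg] using h.add h'.neg

lemma sum {κ : Type*} (s : Finset κ) {f : κ → Cochain A} {g : κ → Cochain B}
    (h : ∀ i ∈ s, FormPair ι (f i) (g i)) : FormPair ι (∑ i ∈ s, f i) (∑ i ∈ s, g i) := by
  classical
  induction s using Finset.induction_on with
  | empty => simpa using FormPair.zero
  | insert i s hi ih =>
    rw [Finset.sum_insert hi, Finset.sum_insert hi]
    exact (h i (Finset.mem_insert_self _ _)).add
      (ih fun j hj => h j (Finset.mem_insert_of_mem hj))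

lemma mem_left (h : FormPair ι α β) : α ∈ OmegaDer A := by
  induction h with
  | of a => exact (OmegaDer.of a).2
  | add _ _ h h' => exact Submodule.add_mem _ h h'
  | smul c _ h => exact Submodule.smul_mem _ c h
  | mulLeft a _ h => exact (OmegaDer.mul (OmegaDer.of a) ⟨_, h⟩).2
  | dLeft a _ h => exact (OmegaDer.mul (OmegaDer.d (OmegaDer.of a)) ⟨_, h⟩).2

lemma mem_right (h : FormPair ι α β) : β ∈ OmegaDer B := by
  induction h with
  | of a => exact (OmegaDer.of (ι a)).2
  | add _ _ h h' => exact Submodule.add_mem _ h h'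
  | smul c _ h => exact Submodule.smul_mem _ c h
  | mulLeft a _ h => exact (OmegaDer.mul (OmegaDer.of (ι a)) ⟨_, h⟩).2
  | dLeft a _ h => exact (OmegaDer.mul (OmegaDer.d (OmegaDer.of (ι a))) ⟨_, h⟩).2

/-- The graded Leibniz rule moves d past the leftmost letter, and d(da) = 0 removes the term that
would not be a word. -/
lemma d (h : FormPair ι α β) : FormPair ι (dDer α) (dDer β) := by
  induction h with
  | of a =>
    -- A single da is the word da ∧ 1.
    have h1 := FormPair.dLeft a (FormPair.of (ι := ι) 1)
    rwa [map_one, wedge_one, wedge_one] at h1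
  | add _ _ h h' => rw [dDer_add, dDer_add]; exact h.add h'
  | smul c _ h => rw [dDer_smul, dDer_smul]; exact h.smul c
  | mulLeft a h ih =>
    rw [dDer_wedge, dDer_wedge, parity_ofAlg, parity_ofAlg]
    exact (h.dLeft a).add (ih.mulLeft a)
  | dLeft a h ih =>
    rw [dDer_wedge, dDer_wedge, dDer_dDer_ofAlg, dDer_dDer_ofAlg, wedge_zero_left,
      wedge_zero_left, zero_add, zero_add, parity_dDer, parity_dDer, parity_ofAlg, parity_ofAlg,
      wedge_neg_left, wedge_neg_left]
    exact (ih.dLeft a).neg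

lemma mul (h : FormPair ι α β) (h' : FormPair ι α' β') :
    FormPair ι (wedge α α') (wedge β β') := by
  induction h with
  | of a => exact h'.mulLeft a
  | add _ _ h1 h2 => rw [wedge_add_left, wedge_add_left]; exact h1.add h2
  | smul c _ h => rw [wedge_smul_left, wedge_smul_left]; exact h.smul c
  | mulLeft a _ h => rw [wedge_assoc, wedge_assoc]; exact h.mulLeft a
  | dLeft a _ h => rw [wedge_assoc, wedge_assoc]; exact h.dLeft a

/-- The left members of pairs form a differential graded subalgebra containing A, so minimality of
Ω_Der(A) applies. Uniqueness of the right member is a different matter and is obtained only from a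
dual basis. -/
lemma exists_right (ι : A →ₐ[ℂ] B) {α : Cochain A} (h : α ∈ OmegaDer A) :
    ∃ β, FormPair ι α β := by
  let S : Submodule ℂ (Cochain A) :=
    { carrier := {α | ∃ β, FormPair ι α β}
      add_mem' := fun ⟨_, h⟩ ⟨_, h'⟩ => ⟨_, h.add h'⟩
      zero_mem' := ⟨_, FormPair.zero⟩
      smul_mem' := fun c _ ⟨_, h⟩ => ⟨_, h.smul c⟩ }
  exact Submodule.mem_sInf.1 h S ⟨fun a => ⟨_, FormPair.of a⟩,
    fun _ ⟨_, h⟩ _ ⟨_, h'⟩ => ⟨_, h.mul h'⟩, fun _ ⟨_, h⟩ => ⟨_, h.d⟩⟩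

end FormPair

lemma ofAlg_mem (a : A) : ofAlg a ∈ OmegaDer A := (OmegaDer.of a).2

lemma wedge_mem {α β : Cochain A} (hα : α ∈ OmegaDer A) (hβ : β ∈ OmegaDer A) :
    wedge α β ∈ OmegaDer A := (OmegaDer.mul ⟨α, hα⟩ ⟨β, hβ⟩).2

lemma dDer_mem {α : Cochain A} (hα : α ∈ OmegaDer A) : dDer α ∈ OmegaDer A :=
  (OmegaDer.d ⟨α, hα⟩).2

/-- Every element of `Ω_Der(A)` is a linear combination of products `a₀ da₁ ⋯ daₚ`. -/
lemma omega_induction {motive : ∀ α : Cochain A, α ∈ OmegaDer A → Prop}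
    (of : ∀ a, motive (ofAlg a) (ofAlg_mem a))
    (add : ∀ α β hα hβ, motive α hα → motive β hβ → motive (α + β) (Submodule.add_mem _ hα hβ))
    (smul : ∀ (c : ℂ) α hα, motive α hα → motive (c • α) (Submodule.smul_mem _ c hα))
    (mulLeft : ∀ a α hα, motive α hα →
      motive (wedge (ofAlg a) α) (wedge_mem (ofAlg_mem a) hα))
    (dLeft : ∀ a α hα, motive α hα →
      motive (wedge (dDer (ofAlg a)) α) (wedge_mem (dDer_mem (ofAlg_mem a)) hα))
    {α : Cochain A} (h : α ∈ OmegaDer A) : motive α h := by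
  -- Taking ι to be the identity turns the generation of pairs into an induction on words;
  -- membership is carried along because the motive depends on it.
  have key : ∀ {α β}, FormPair (AlgHom.id ℂ A) α β → ∃ h, motive α h := by
    intro α β hβ
    induction hβ with
    | of a => exact ⟨_, of a⟩
    | add _ _ h h' => exact ⟨_, add _ _ h.1 h'.1 h.2 h'.2⟩
    | smul c _ h => exact ⟨_, smul c _ h.1 h.2⟩
    | mulLeft a _ h => exact ⟨_, mulLeft a _ h.1 h.2⟩
    | dLeft a _ h => exact ⟨_, dLeft a _ h.1 h.2⟩
  obtain ⟨β, hβ⟩ := FormPair.exists_right (AlgHom.id ℂ A) h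
  exact (key hβ).2

lemma contr_ofAlg_wedge (X : Der A) (a : A) (α : Cochain A) :
    contr X (wedge (ofAlg a) α) = wedge (ofAlg a) (contr X α) := by
  rw [contr_wedge, contr_ofAlg, wedge_zero_left, zero_add, parity_ofAlg]

lemma contr_dDer_ofAlg_wedge (X : Der A) (a : A) (α : Cochain A) :
    contr X (wedge (dDer (ofAlg a)) α) =
      wedge (ofAlg ((X : Module.End ℂ A) a)) α - wedge (dDer (ofAlg a)) (contr X α) := by
  rw [contr_wedge, contr_dDer_ofAlg, parity_dDer, parity_ofAlg, wedge_neg_left, sub_eq_add_neg]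

lemma contr_mem (X : Der A) {α : Cochain A} (h : α ∈ OmegaDer A) : contr X α ∈ OmegaDer A := by
  induction h using omega_induction with
  | of a => exact Submodule.zero_mem _
  | add α β _ _ h h' => exact Submodule.add_mem _ h h'
  | smul c α _ h => exact Submodule.smul_mem _ c h
  | mulLeft a α _ h => rw [contr_ofAlg_wedge]; exact wedge_mem (ofAlg_mem a) h
  | dLeft a α hα h =>
    rw [contr_dDer_ofAlg_wedge]
    exact Submodule.sub_mem _ (wedge_mem (ofAlg_mem _) hα)
      (wedge_mem (dDer_mem (ofAlg_mem a)) h)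

/-- An arbitrary cochain need not be additive in its arguments. On words it is, because X enters
only through the values Xa. -/
lemma contr_add_left (X Y : Der A) {α : Cochain A} (h : α ∈ OmegaDer A) :
    contr (X + Y) α = contr X α + contr Y α := by
  induction h using omega_induction with
  | of a => simp [contr_ofAlg]
  | add α β _ _ h h' => rw [contr_add, contr_add, contr_add, h, h']; abel
  | smul c α _ h => rw [contr_smul, contr_smul, contr_smul, h, smul_add]
  | mulLeft a α _ h =>
    rw [contr_ofAlg_wedge, contr_ofAlg_wedge, contr_ofAlg_wedge, h, wedge_add_right]
  | dLeft a α hα h =>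
    rw [contr_dDer_ofAlg_wedge, contr_dDer_ofAlg_wedge, contr_dDer_ofAlg_wedge, h,
      wedge_add_right]
    have : (((X + Y : Der A) : Module.End ℂ A)) a =
      (X : Module.End ℂ A) a + (Y : Module.End ℂ A) a := rfl
    rw [this, ofAlg_add, wedge_add_left]
    abel

lemma contr_smul_left (c : ℂ) (X : Der A) {α : Cochain A} (h : α ∈ OmegaDer A) :
    contr (c • X) α = c • contr X α := by
  induction h using omega_induction with
  | of a => simp [contr_ofAlg]
  | add α β _ _ h h' => rw [contr_add, contr_add, h, h', smul_add]
  | smul c' α _ h => rw [contr_smul, contr_smul, h, smul_comm]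
  | mulLeft a α _ h =>
    rw [contr_ofAlg_wedge, contr_ofAlg_wedge, h, wedge_smul_right]
  | dLeft a α hα h =>
    rw [contr_dDer_ofAlg_wedge, contr_dDer_ofAlg_wedge, h, wedge_smul_right]
    have : (((c • X : Der A) : Module.End ℂ A)) a = c • (X : Module.End ℂ A) a := rfl
    rw [this, ofAlg_smul, wedge_smul_left, smul_sub]

lemma contr_zero_left {α : Cochain A} (h : α ∈ OmegaDer A) :
    contr (0 : Der A) α = 0 := by
  simpa using contr_smul_left 0 (0 : Der A) h

lemma contr_sum_left {κ : Type*} (s : Finset κ) (f : κ → Der A) {α : Cochain A}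
    (h : α ∈ OmegaDer A) : contr (∑ i ∈ s, f i) α = ∑ i ∈ s, contr (f i) α := by
  classical
  induction s using Finset.induction_on with
  | empty => simpa using contr_zero_left h
  | insert i s hi ih => rw [Finset.sum_insert hi, Finset.sum_insert hi, contr_add_left _ _ h, ih]

/-- This is the alternation of the elements of Ω_Der. For da ∧ α the mixed terms (Ya) i_X α and (Xa)
i_Y α occur twice with opposite signs. -/
lemma contr_anticomm (X Y : Der A) {α : Cochain A} (h : α ∈ OmegaDer A) :
    contr X (contr Y α) + contr Y (contr X α) = 0 := by
  induction h using omega_induction with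
  | of a => simp [contr_ofAlg, contr_zero]
  | add α β _ _ h h' =>
    simp only [contr_add]
    rw [add_add_add_comm, h, h', add_zero]
  | smul c α _ h => simp only [contr_smul]; rw [← smul_add, h, smul_zero]
  | mulLeft a α _ h =>
    simp only [contr_ofAlg_wedge]
    rw [← wedge_add_right, h, wedge_zero_right]
  | dLeft a α hα h =>
    simp only [contr_dDer_ofAlg_wedge, contr_sub, contr_ofAlg_wedge]
    have : wedge (dDer (ofAlg a)) (contr X (contr Y α)) +
      wedge (dDer (ofAlg a)) (contr Y (contr X α)) = 0 := by
      rw [← wedge_add_right, h, wedge_zero_right]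
    rw [← this]
    abel

lemma contr_anticomm' (X Y : Der A) {α : Cochain A} (h : α ∈ OmegaDer A) :
    contr X (contr Y α) = -contr Y (contr X α) :=
  eq_neg_of_add_eq_zero_left (contr_anticomm X Y h)

lemma lieDer_contr_comm (X Y : Der A) (α : Cochain A) :
    lieDer X (contr Y α) - contr Y (lieDer X α) = contr ⁅X, Y⁆ α := by
  rw [contr_lieDer]; abel

lemma isHomogeneous_contr (X : Der A) {p : ℕ} {α : Cochain A} (h : IsHomogeneous (p + 1) α) :
    IsHomogeneous p (contr X α) := by
  intro q hq
  funext Y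
  rw [contr, h (q + 1) (by omega)]
  rfl

lemma contr_eq_zero_of_isHomogeneous (X : Der A) {α : Cochain A} (h : IsHomogeneous 0 α) :
    contr X α = 0 := by
  funext q Y
  rw [contr, h (q + 1) (by omega)]
  rfl

/-- A linear family of derivations that is compatible with brackets defines a Cartan operation. -/
lemma isCartanOperation_contr {𝔤 : Type*} [LieRing 𝔤] [LieAlgebra ℝ 𝔤] (L : 𝔤 →ₗ[ℝ] Der A)
    (hL : ∀ x y : 𝔤, L ⁅x, y⁆ = ⁅L x, L y⁆) :
    IsCartanOperation A (fun x : 𝔤 => contr (L x)) where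
  mapsTo x _ h := contr_mem _ h
  map_add _ _ _ _ _ := rfl
  map_smul _ _ _ _ := rfl
  add_map x y α h := by
    rw [map_add, contr_add_left _ _ h]
  smul_map c x α h := by
    have : c • L x = (c : ℂ) • L x := (Complex.coe_smul c (L x)).symm
    rw [map_smul, this, contr_smul_left _ _ h]
  degree_zero x α _ h := contr_eq_zero_of_isHomogeneous _ h
  degree_succ x p α _ h := isHomogeneous_contr _ h
  antiderivation x α _ β _ := contr_wedge _ _ _
  anticomm x y α h := contr_anticomm _ _ h
  lie_contr x y α _ := by
    rw [lieD_contr, lieD_contr, lieDer_contr_comm, hL]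

/-! ### Homogeneous components -/

/-- The component of degree `p` of a cochain. -/
def component (p : ℕ) (α : Cochain A) : Cochain A := fun q X => if q = p then α q X else 0

lemma isHomogeneous_component (p : ℕ) (α : Cochain A) : IsHomogeneous p (component p α) := by
  intro q hq
  funext X
  simp [component, hq]

lemma component_of_isHomogeneous {p q : ℕ} {α : Cochain A} (h : IsHomogeneous p α) :
    component q α = if q = p then α else 0 := by
  funext r X
  by_cases hr : r = q
  · subst hr
    by_cases hp : r = p
    · simp [component, hp]
    · simp [component, hp, h r hp]
  · by_cases hp : q = p
    · subst hp
      simp [component, hr, h r hr]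
    · simp [component, hr, hp]

lemma IsHomogeneous.wedge {p q : ℕ} {α β : Cochain A} (hα : IsHomogeneous p α)
    (hβ : IsHomogeneous q β) : IsHomogeneous (p + q) (wedge α β) := by
  intro r hr
  funext X
  refine Finset.sum_eq_zero fun S _ => ?_
  by_cases h1 : S.card = p
  · by_cases h2 : Sᶜ.card = q
    · exact absurd (by rw [← h1, ← h2, Finset.card_add_card_compl, Fintype.card_fin]) hr
    · rw [hβ _ h2]; simp
  · rw [hα _ h1]; simp

lemma isHomogeneous_ofAlg (a : A) : IsHomogeneous 0 (ofAlg a : Cochain A) := by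
  intro q hq
  cases q with
  | zero => exact absurd rfl hq
  | succ q => rfl

lemma isHomogeneous_dDer_ofAlg (a : A) : IsHomogeneous 1 (dDer (ofAlg a) : Cochain A) := by
  intro q hq
  cases q with
  | zero => rfl
  | succ q =>
    funext X
    have := congrFun (congrFun (contr_dDer_ofAlg (X 0) a) q) (Fin.tail X)
    rw [contr, Fin.cons_self_tail] at this
    rw [this, isHomogeneous_ofAlg _ q (by omega)]
    rfl

/-- The letters a and da are homogeneous of degree 0 and 1, and degrees add under the product.
Consequently Ω_Der contains the components of its elements, which allows induction on the degree. -/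
lemma mem_span_homogeneous {α : Cochain A} (h : α ∈ OmegaDer A) :
    α ∈ Submodule.span ℂ {β : Cochain A | β ∈ OmegaDer A ∧ ∃ p, IsHomogeneous p β} := by
  have key : ∀ (a : Cochain A), a ∈ OmegaDer A → (∃ q, IsHomogeneous q a) → ∀ α ∈ Submodule.span ℂ
      {β : Cochain A | β ∈ OmegaDer A ∧ ∃ p, IsHomogeneous p β},
      wedge a α ∈ Submodule.span ℂ {β : Cochain A | β ∈ OmegaDer A ∧ ∃ p, IsHomogeneous p β} := by
    rintro a ha ⟨q, hq⟩ α hα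
    induction hα using Submodule.span_induction with
    | mem x hx =>
      obtain ⟨hx, p, hp⟩ := hx
      exact Submodule.subset_span ⟨wedge_mem ha hx, _, hq.wedge hp⟩
    | zero => rw [wedge_zero_right]; exact Submodule.zero_mem _
    | add x y _ _ hx hy => rw [wedge_add_right]; exact Submodule.add_mem _ hx hy
    | smul c x _ hx => rw [wedge_smul_right]; exact Submodule.smul_mem _ _ hx
  induction h using omega_induction with
  | of a => exact Submodule.subset_span ⟨ofAlg_mem a, 0, isHomogeneous_ofAlg a⟩
  | add α β _ _ h h' => exact Submodule.add_mem _ h h'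
  | smul c α _ h => exact Submodule.smul_mem _ _ h
  | mulLeft a α _ h => exact key _ (ofAlg_mem a) ⟨0, isHomogeneous_ofAlg a⟩ α h
  | dLeft a α _ h => exact key _ (dDer_mem (ofAlg_mem a)) ⟨1, isHomogeneous_dDer_ofAlg a⟩ α h

lemma component_add (p : ℕ) (α β : Cochain A) :
    component p (α + β) = component p α + component p β := by
  funext q X
  by_cases h : q = p <;> simp [component, h]

lemma component_smul (p : ℕ) (c : ℂ) (α : Cochain A) :
    component p (c • α) = c • component p α := by
  funext q X
  by_cases h : q = p <;> simp [component, h]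

lemma component_mem (p : ℕ) {α : Cochain A} (h : α ∈ OmegaDer A) :
    component p α ∈ OmegaDer A := by
  have h' := mem_span_homogeneous h
  clear h
  induction h' using Submodule.span_induction with
  | mem x hx =>
    obtain ⟨hx, q, hq⟩ := hx
    rw [component_of_isHomogeneous hq]
    split_ifs
    · exact hx
    · exact Submodule.zero_mem _
  | zero =>
    have : component p (0 : Cochain A) = 0 := by funext q X; simp [component]
    rw [this]; exact Submodule.zero_mem _
  | add x y _ _ hx hy => rw [component_add]; exact Submodule.add_mem _ hx hy
  | smul c x _ hx => rw [component_smul]; exact Submodule.smul_mem _ _ hx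

lemma exists_degree_bound {α : Cochain A} (h : α ∈ OmegaDer A) : ∃ N, ∀ q, N ≤ q → α q = 0 := by
  have h' := mem_span_homogeneous h
  clear h
  induction h' using Submodule.span_induction with
  | mem x hx =>
    obtain ⟨hx, q, hq⟩ := hx
    exact ⟨q + 1, fun r hr => hq r (by omega)⟩
  | zero => exact ⟨0, fun _ _ => rfl⟩
  | add x y _ _ hx hy =>
    obtain ⟨N, hN⟩ := hx
    obtain ⟨N', hN'⟩ := hy
    exact ⟨max N N', fun q hq => by
      rw [Pi.add_apply, hN q (le_trans (le_max_left _ _) hq),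
        hN' q (le_trans (le_max_right _ _) hq), add_zero]⟩
  | smul c x _ hx =>
    obtain ⟨N, hN⟩ := hx
    exact ⟨N, fun q hq => by rw [Pi.smul_apply, hN q hq, smul_zero]⟩

lemma exists_eq_sum_component {α : Cochain A} (h : α ∈ OmegaDer A) :
    ∃ N, α = ∑ p ∈ Finset.range N, component p α := by
  obtain ⟨N, hN⟩ := exists_degree_bound h
  refine ⟨N, ?_⟩
  funext q X
  rw [Finset.sum_apply, Finset.sum_apply]
  simp only [component]
  rw [Finset.sum_ite_eq]
  split_ifs with hq
  · rfl
  · rw [hN q (by simpa using hq)]; rfl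

lemma contr_component (X : Der A) (p : ℕ) (α : Cochain A) :
    contr X (component (p + 1) α) = component p (contr X α) := by
  funext q Y
  by_cases h : q = p <;> simp [contr, component, h]

lemma lieDer_component (X : Der A) (p : ℕ) (α : Cochain A) :
    lieDer X (component p α) = component p (lieDer X α) := by
  funext q Y
  by_cases h : q = p <;> simp [lieDer, component, h]

end NormalForm

end DerCalc

end

noncomputable section

namespace DerCalc

/-! ### Finite colorings of open covers of a manifold. -/

section Coloring

open Topology Set

variable {M : Type*} [TopologicalSpace M] {L : Type*}

/-- The set `K` is covered by open sets `O j` on which there are locally constant choices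
of members of the family `U`, the index `j` running over the given type. -/
def IsColored (J : Type*) (U : L → Set M) (K : Set M) : Prop :=
  ∃ (O : J → Set M) (l : J → M → L), (∀ j, IsOpen (O j)) ∧ (∀ x ∈ K, ∃ j, x ∈ O j) ∧
    ∀ j, ∀ x ∈ O j, x ∈ U (l j x) ∧ ∀ᶠ y in 𝓝 x, l j y = l j x

lemma IsColored.mono {J : Type*} {U : L → Set M} {K K' : Set M} (h : IsColored J U K)
    (hK : K' ⊆ K) : IsColored J U K' := by
  obtain ⟨O, l, hO, hc, hl⟩ := h
  exact ⟨O, l, hO, fun x hx => hc x (hK hx), hl⟩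

lemma exists_open_shrinking [T2Space M] [LocallyCompactSpace M] {J : Type*} [Finite J]
    {K : Set M} (hK : IsCompact K) {O : J → Set M} (hO : ∀ j, IsOpen (O j))
    (h : ∀ x ∈ K, ∃ j, x ∈ O j) :
    ∃ A : J → Set M, (∀ j, IsOpen (A j)) ∧ (∀ j, closure (A j) ⊆ O j) ∧ ∀ x ∈ K, ∃ j, x ∈ A j := by
  cases nonempty_fintype J
  obtain ⟨C, hC, hCO, hKC⟩ := hK.finite_compact_cover Finset.univ O (fun j _ => hO j)
    (fun x hx => by simpa using h x hx)
  choose A hA hCA hAO _ using fun j =>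
    exists_open_between_and_isCompact_closure (hC j) (hO j) (hCO j)
  refine ⟨A, hA, hAO, fun x hx => ?_⟩
  rw [hKC] at hx
  obtain ⟨j, hj⟩ := by simpa using hx
  exact ⟨j, hCA j hj⟩

/-- The centres of two overlapping cubes differ by less than 2 in each coordinate, so integer
centres of equal parities agree. Parity thus colors a grid of overlapping cubes with 2ᵐ colors,
disjointly within each color. -/
lemma eq_of_mem_cubes {m : ℕ} {z w : Fin m → ℤ} {y : Fin m → ℝ}
    (hz : ∀ i, |y i - z i| < 3 / 4) (hw : ∀ i, |y i - w i| < 3 / 4)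
    (h : ∀ i, decide (Even (z i)) = decide (Even (w i))) : z = w := by
  funext i
  have h1 := abs_lt.1 (hz i)
  have h2 := abs_lt.1 (hw i)
  have h3 : ((z i - w i : ℤ) : ℝ) < 2 := by push_cast; linarith
  have h4 : (-2 : ℝ) < ((z i - w i : ℤ) : ℝ) := by push_cast; linarith
  have h3' : z i - w i < 2 := by exact_mod_cast h3
  have h4' : -2 < z i - w i := by exact_mod_cast h4
  have h5 : Even (z i - w i) := by
    rw [Int.even_sub]
    simpa using h i
  obtain ⟨k, hk⟩ := h5
  omega

/-- The compact set C is covered by small cubes colored by parity, and the number of colors does not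
grow. A cube of color j that meets the old region of color j takes over the old label; the other
cubes form new pieces, labelled l₀, that are separated from that region. -/
lemma IsColored.union [T2Space M] [LocallyCompactSpace M] {m : ℕ} {U : L → Set M}
    (hU : ∀ l, IsOpen (U l)) {K C : Set M} (hK : IsCompact K) (hC : IsCompact C)
    (h : IsColored (Fin m → Bool) U K) (φ : OpenPartialHomeomorph M (Fin m → ℝ)) (l₀ : L)
    (hCφ : C ⊆ φ.source ∩ U l₀) : IsColored (Fin m → Bool) U (K ∪ C) := by
  classical
  obtain ⟨O, l, hO, hcov, hl⟩ := h
  obtain ⟨A, hA, hAO, hKA⟩ := exists_open_shrinking hK hO hcov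
  -- On S c each color is decided: either one stays inside `O j`, or one stays away from the closure
  -- of the shrunken set `A j`.
  let S : M → Set M := fun c => (φ.source ∩ U l₀) ∩
    ⋂ j, if c ∈ O j then O j else (closure (A j))ᶜ
  have hS : ∀ c, IsOpen (S c) := fun c => by
    refine (φ.open_source.inter (hU l₀)).inter (isOpen_iInter_of_finite fun j => ?_)
    split_ifs
    · exact hO j
    · exact isClosed_closure.isOpen_compl
  have hcS : ∀ c ∈ C, c ∈ S c := fun c hc => by
    refine ⟨hCφ hc, mem_iInter.2 fun j => ?_⟩
    split_ifs with hcj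
    · exact hcj
    · exact fun h => hcj (hAO j h)
  obtain ⟨δ, hδ, hball⟩ := lebesgue_number_lemma_of_metric (s := φ '' C) (ι := C)
    (c := fun c => φ.target ∩ φ.symm ⁻¹' S c)
    (hC.image_of_continuousOn (φ.continuousOn.mono fun c hc => (hCφ hc).1))
    (fun c => φ.isOpen_inter_preimage_symm (hS c)) (by
      rintro _ ⟨c, hc, rfl⟩
      refine mem_iUnion.2 ⟨⟨c, hc⟩, φ.map_source (hCφ hc).1, ?_⟩
      rw [mem_preimage, φ.left_inv (hCφ hc).1]
      exact hcS c hc)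
  -- The mesh is δ/2 and the half-width 3/4 of it, so two points of a cube differ by less than 3δ/4
  -- in each coordinate, within the Lebesgue number δ. Rounding shows that the cubes cover.
  let Q : (Fin m → ℤ) → Set M := fun z =>
    φ.source ∩ φ ⁻¹' {y | ∀ i, |y i / (δ / 2) - z i| < 3 / 4}
  have hQ : ∀ z, IsOpen (Q z) := fun z => by
    refine φ.isOpen_inter_preimage ?_
    rw [ofPred_forall]
    refine isOpen_iInter_of_finite fun i => isOpen_lt ?_ continuous_const
    fun_prop
  have hQS : ∀ z, (Q z ∩ C).Nonempty → ∃ c, Q z ⊆ S c := by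
    rintro z ⟨x, hx, hxC⟩
    obtain ⟨c, hc⟩ := hball (φ x) ⟨x, hxC, rfl⟩
    refine ⟨c, fun q hq => ?_⟩
    have : φ q ∈ Metric.ball (φ x) δ := by
      rw [Metric.mem_ball, dist_pi_lt_iff hδ]
      intro i
      have h1 := abs_lt.1 (hx.2 i)
      have h2 := abs_lt.1 (hq.2 i)
      have h3 : |φ q i / (δ / 2) - φ x i / (δ / 2)| < 3 / 2 := by
        rw [abs_lt]; constructor <;> linarith
      rw [← sub_div, abs_div, div_lt_iff₀ (by positivity), abs_of_pos (half_pos hδ)] at h3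
      rw [Real.dist_eq]
      linarith
    have := (hc this).2
    rwa [mem_preimage, φ.left_inv hq.1] at this
  let act : (Fin m → Bool) → Set (Fin m → ℤ) := fun j =>
    {z | (Q z ∩ C).Nonempty ∧ ∀ i, decide (Even (z i)) = j i}
  have hdisj : ∀ j, ∀ z ∈ act j, ∀ w ∈ act j, (Q z ∩ Q w).Nonempty → z = w := by
    rintro j z hz w hw ⟨x, hx, hx'⟩
    exact eq_of_mem_cubes hx.2 hx'.2 fun i => (hz.2 i).trans (hw.2 i).symm
  -- T j is the region where the old labels are kept. A cube in it meets `A j` and lies in some `S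
  -- c`, which excludes the second alternative for j, so it lies in `O j`.
  let T : (Fin m → Bool) → Set M := fun j =>
    A j ∪ ⋃ z ∈ {z | z ∈ act j ∧ (Q z ∩ A j).Nonempty}, Q z
  have hT : ∀ j, IsOpen (T j) := fun j =>
    (hA j).union (isOpen_biUnion fun z _ => hQ z)
  have hTO : ∀ j, T j ⊆ O j := by
    rintro j x (hx | hx)
    · exact hAO j (subset_closure hx)
    · obtain ⟨z, ⟨hz, a, haQ, haA⟩, hxz⟩ := by simpa only [mem_iUnion, exists_prop] using hx
      obtain ⟨c, hc⟩ := hQS z hz.1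
      have h1 := mem_iInter.1 (hc haQ).2 j
      have h2 := mem_iInter.1 (hc hxz).2 j
      split_ifs at h1 h2
      · exact h2
      · exact absurd (subset_closure haA) h1
  refine ⟨fun j => A j ∪ ⋃ z ∈ act j, Q z, fun j x => if x ∈ T j then l j x else l₀,
    fun j => (hA j).union (isOpen_biUnion fun z _ => hQ z), ?_, ?_⟩
  · rintro x (hx | hx)
    · obtain ⟨j, hj⟩ := hKA x hx
      exact ⟨j, Or.inl hj⟩
    · let z : Fin m → ℤ := fun i => round (φ x i / (δ / 2))
      have hxz : x ∈ Q z := by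
        refine ⟨(hCφ hx).1, fun i => ?_⟩
        exact (abs_sub_round _).trans_lt (by norm_num)
      refine ⟨fun i => decide (Even (z i)), Or.inr ?_⟩
      simp only [mem_iUnion, exists_prop]
      exact ⟨z, ⟨⟨x, hxz, hx⟩, fun i => rfl⟩, hxz⟩
  · intro j x hx
    by_cases hxT : x ∈ T j
    · have h1 := hl j x (hTO j hxT)
      have h2 : ∀ᶠ y in 𝓝 x, y ∈ T j := (hT j).mem_nhds hxT
      simp only [hxT, if_true]
      refine ⟨h1.1, ?_⟩
      filter_upwards [h1.2, h2] with y hy hy'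
      rw [if_pos hy', hy]
    · simp only [hxT, if_false]
      rcases hx with hx | hx
      · exact absurd (Or.inl hx) hxT
      obtain ⟨z, hz, hxz⟩ := by simpa only [mem_iUnion, exists_prop] using hx
      obtain ⟨c, hc⟩ := hQS z hz.1
      refine ⟨(hc hxz).1.2, ?_⟩
      filter_upwards [(hQ z).mem_nhds hxz] with y hy
      rw [if_neg]
      have hzA : ¬ (Q z ∩ A j).Nonempty := by
        intro hne
        refine hxT (Or.inr ?_)
        simp only [mem_iUnion, exists_prop]
        exact ⟨z, ⟨hz, hne⟩, hxz⟩
      rintro (hyA | hyT)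
      · exact hzA ⟨y, hy, hyA⟩
      · obtain ⟨w, ⟨hw, hwA⟩, hyw⟩ := by simpa only [mem_iUnion, exists_prop] using hyT
        obtain rfl := hdisj j z hz w hw ⟨y, hy, hyw⟩
        exact hzA hwA

/-- Finitely many compact pieces, each inside a chart and inside one member of the cover, are added
one at a time with the same 2ᵐ colors. -/
lemma isColored_of_isCompact [T2Space M] [LocallyCompactSpace M] {m : ℕ}
    [ChartedSpace (EuclideanSpace ℝ (Fin m)) M] [Nonempty L] {U : L → Set M}
    (hU : ∀ l, IsOpen (U l)) (hcov : ∀ x, ∃ l, x ∈ U l) {K : Set M} (hK : IsCompact K) :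
    IsColored (Fin m → Bool) U K := by
  classical
  choose lam hlam using hcov
  let φ : M → OpenPartialHomeomorph M (Fin m → ℝ) := fun x =>
    (chartAt (EuclideanSpace ℝ (Fin m)) x).trans
      (EuclideanSpace.equiv (Fin m) ℝ).toHomeomorph.toOpenPartialHomeomorph
  have hφ : ∀ x, x ∈ (φ x).source := fun x => by simp [φ]
  choose C hC hxC hCU using fun x => exists_compact_subset
    ((φ x).open_source.inter (hU (lam x))) ⟨hφ x, hlam x⟩
  obtain ⟨t, ht0, ht⟩ := hK.elim_nhds_subcover C fun x _ => mem_interior_iff_mem_nhds.1 (hxC x)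
  refine IsColored.mono ?_ ht
  clear ht ht0
  induction t using Finset.induction_on with
  | empty =>
    exact ⟨fun _ => ∅, fun _ _ => Classical.arbitrary L, fun _ => isOpen_empty,
      fun x hx => by simp at hx, fun j x hx => absurd hx (notMem_empty x)⟩
  | insert x t hx ih =>
    rw [Finset.set_biUnion_insert, union_comm]
    exact ih.union hU (t.finite_toSet.isCompact_biUnion fun x _ => hC x) (hC x) (φ x) (lam x)
      (hCU x)

/-- Any open cover of a second countable Hausdorff manifold admits a locally constant choice of
members of the cover along each of finitely many open sets that cover the manifold. -/
theorem exists_finite_coloring [T2Space M] [SecondCountableTopology M] (m : ℕ)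
    [ChartedSpace (EuclideanSpace ℝ (Fin m)) M] [Nonempty L] {U : L → Set M}
    (hU : ∀ l, IsOpen (U l)) (hcov : ∀ x, ∃ l, x ∈ U l) :
    IsColored ((Fin m → Bool) × Fin 3) U (univ : Set M) := by
  classical
  have : LocallyCompactSpace M := ChartedSpace.locallyCompactSpace (EuclideanSpace ℝ (Fin m)) M
  -- The shift makes `K 0` empty, so that every point lies in some `K (n + 1) \ K n`.
  let K : CompactExhaustion M := (default : CompactExhaustion M).shiftr
  have hK0 : K 0 = ∅ := rfl
  choose O l hO hOc hl using fun i : ℕ => isColored_of_isCompact (m := m) hU hcov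
    ((K.isCompact (i + 1)).diff (isOpen_interior (s := K i)))
  -- W i is an open set around the shell `K (i + 1) \ interior (K i)`. Two of them are disjoint when
  -- their indices differ by 3 or more, so three copies of the colors serve all shells. For i = 0
  -- the truncated `i - 1` is 0, and `K 0` is empty.
  let W : ℕ → Set M := fun i => interior (K (i + 2)) \ K (i - 1)
  have hW : ∀ i, IsOpen (W i) := fun i =>
    isOpen_interior.sdiff (K.isCompact _).isClosed
  have hWd : ∀ i k x, i % 3 = k % 3 → x ∈ W i → x ∈ W k → i = k := by
    have key : ∀ i k x, i + 3 ≤ k → x ∈ W i → x ∈ W k → False := by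
      intro i k x hik hi hk
      exact hk.2 (K.subset (by omega) (interior_subset hi.1))
    intro i k x hik hi hk
    by_contra hne
    rcases lt_or_gt_of_ne hne with h | h
    · exact key i k x (by omega) hi hk
    · exact key k i x (by omega) hk hi
  let lam : (Fin m → Bool) × Fin 3 → M → L := fun jr x =>
    if h : ∃ i, i % 3 = (jr.2 : ℕ) ∧ x ∈ W i then l h.choose jr.1 x else Classical.arbitrary L
  have hlam : ∀ jr i x, i % 3 = (jr.2 : ℕ) → x ∈ W i → lam jr x = l i jr.1 x := by
    intro jr i x hi hx
    have h : ∃ i, i % 3 = (jr.2 : ℕ) ∧ x ∈ W i := ⟨i, hi, hx⟩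
    have : h.choose = i :=
      hWd _ _ x (h.choose_spec.1.trans hi.symm) h.choose_spec.2 hx
    simp only [lam, dif_pos h, this]
  refine ⟨fun jr => ⋃ i ∈ {i : ℕ | i % 3 = (jr.2 : ℕ)}, O i jr.1 ∩ W i, lam, ?_, ?_, ?_⟩
  · exact fun jr => isOpen_biUnion fun i _ => (hO i jr.1).inter (hW i)
  · intro x _
    obtain ⟨n, hn⟩ : ∃ n, K.find x = n + 1 := by
      refine Nat.exists_eq_succ_of_ne_zero fun h0 => ?_
      have := K.mem_find x
      rw [h0, hK0] at this
      exact this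
    have hx1 : x ∈ K (n + 1) := hn ▸ K.mem_find x
    have hx2 : x ∉ K n := fun hx => by
      have := K.mem_iff_find_le.1 hx
      omega
    obtain ⟨j, hj⟩ := hOc n x ⟨hx1, fun h => hx2 (interior_subset h)⟩
    refine ⟨(j, ⟨n % 3, Nat.mod_lt _ (by norm_num)⟩), ?_⟩
    simp only [mem_iUnion, exists_prop]
    exact ⟨n, rfl, hj, K.subset_interior_succ _ hx1, fun h => hx2 (K.subset (by omega) h)⟩
  · intro jr x hx
    simp only [mem_iUnion, exists_prop] at hx
    obtain ⟨i, hi, hxO, hxW⟩ := hx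
    rw [hlam jr i x hi hxW]
    refine ⟨(hl i jr.1 x hxO).1, ?_⟩
    filter_upwards [(hl i jr.1 x hxO).2, (hW i).mem_nhds hxW] with y hy hyW
    rw [hlam jr i y hi hyW, hy]

end Coloring

end DerCalc

end

noncomputable section

namespace DerCalc

/-! ### Hadamard's lemma and point derivations of smooth functions -/

section Hadamard

open MeasureTheory

variable {V : Type} [NormedAddCommGroup V] [NormedSpace ℝ V] [FiniteDimensional ℝ V]

lemma hasFDerivAt_integral_param {F : Type} [NormedAddCommGroup F] [NormedSpace ℝ F]
    [CompleteSpace F] {G : V × ℝ → F} (hG : ContDiff ℝ 1 G) (z : V) :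
    HasFDerivAt (𝕜 := ℝ) (fun z => ∫ t in (0 : ℝ)..1, G (z, t))
      (∫ t in (0 : ℝ)..1, (fderiv ℝ G (z, t)).comp (ContinuousLinearMap.inl ℝ V ℝ)) z := by
  have hc : Continuous fun p : V × ℝ =>
      (fderiv ℝ G p).comp (ContinuousLinearMap.inl ℝ V ℝ) :=
    (hG.continuous_fderiv one_ne_zero).clm_comp continuous_const
  have hK : IsCompact (Metric.closedBall (z : V) 1 ×ˢ Set.Icc (0 : ℝ) 1) :=
    (isCompact_closedBall z 1).prod isCompact_Icc
  obtain ⟨C, hC⟩ := hK.exists_bound_of_continuousOn hc.continuousOn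
  refine intervalIntegral.hasFDerivAt_integral_of_dominated_of_fderiv_le (𝕜 := ℝ)
    (F := fun z t => G (z, t))
    (F' := fun z t => (fderiv ℝ G (z, t)).comp (ContinuousLinearMap.inl ℝ V ℝ))
    (bound := fun _ => C)
    (Metric.closedBall_mem_nhds z one_pos) ?_ ?_ ?_ ?_ ?_ ?_
  · refine Filter.Eventually.of_forall fun x => Continuous.aestronglyMeasurable ?_
    exact hG.continuous.comp (by fun_prop)
  · exact (hG.continuous.comp (by fun_prop : Continuous fun t : ℝ => (z, t))).intervalIntegrable _ _
  · exact (hc.comp (by fun_prop : Continuous fun t : ℝ => (z, t))).aestronglyMeasurable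
  · refine Filter.Eventually.of_forall fun t ht x hx => hC (x, t) ⟨hx, ?_⟩
    rw [Set.uIoc_of_le zero_le_one] at ht
    exact ⟨ht.1.le, ht.2⟩
  · exact intervalIntegrable_const
  · refine Filter.Eventually.of_forall fun t _ x _ => ?_
    have h1 : HasFDerivAt G (fderiv ℝ G (x, t)) (x, t) :=
      (hG.differentiable one_ne_zero (x, t)).hasFDerivAt
    exact h1.comp x ((hasFDerivAt_id x).prodMk (hasFDerivAt_const t x))

/-- The derivative of the integral is an integral of the same kind with values in a space of linear
maps. The induction therefore quantifies over the target F. -/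
lemma contDiff_integral_param_nat (k : ℕ) : ∀ {F : Type} [NormedAddCommGroup F] [NormedSpace ℝ F]
    [CompleteSpace F] {G : V × ℝ → F}, ContDiff ℝ ∞ G →
    ContDiff ℝ k (fun z => ∫ t in (0 : ℝ)..1, G (z, t)) := by
  induction k with
  | zero =>
    intro F _ _ _ G hG
    exact contDiff_zero.2 (continuous_iff_continuousAt.2 fun z =>
      (hasFDerivAt_integral_param (hG.of_le (by exact_mod_cast le_top)) z).continuousAt)
  | succ k ih =>
    intro F _ _ _ G hG
    have h1 := hasFDerivAt_integral_param (hG.of_le (by exact_mod_cast le_top) : ContDiff ℝ 1 G)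
    push_cast
    rw [contDiff_succ_iff_fderiv]
    refine ⟨fun z => (h1 z).differentiableAt, fun h => absurd h (by simp), ?_⟩
    have : fderiv ℝ (fun z => ∫ t in (0 : ℝ)..1, G (z, t)) = fun z =>
        ∫ t in (0 : ℝ)..1, (fun p : V × ℝ =>
          (fderiv ℝ G p).comp (ContinuousLinearMap.inl ℝ V ℝ)) (z, t) :=
      funext fun z => (h1 z).fderiv
    rw [this]
    exact ih ((hG.fderiv_right (m := ∞) (by simp)).clm_comp contDiff_const)

lemma contDiff_integral_param {F : Type} [NormedAddCommGroup F] [NormedSpace ℝ F]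
    [CompleteSpace F] {G : V × ℝ → F} (hG : ContDiff ℝ ∞ G) :
    ContDiff ℝ ∞ (fun z => ∫ t in (0 : ℝ)..1, G (z, t)) :=
  contDiff_infty.2 fun k => contDiff_integral_param_nat k hG

variable (V) in
/-- The algebra of smooth complex functions on a real vector space. -/
def SmoothSub : Subalgebra ℂ (V → ℂ) where
  carrier := {f | ContDiff ℝ ∞ f}
  mul_mem' {f g} hf hg := by
    have hf' : ContDiff ℝ ∞ f := hf
    have hg' : ContDiff ℝ ∞ g := hg
    exact hf'.mul hg'
  add_mem' {f g} hf hg := by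
    have hf' : ContDiff ℝ ∞ f := hf
    have hg' : ContDiff ℝ ∞ g := hg
    exact hf'.add hg'
  algebraMap_mem' c := (contDiff_const : ContDiff ℝ ∞ fun _ : V => c)

/-- A real linear function, as a smooth complex function. -/
def linSmooth (l : V →L[ℝ] ℝ) : SmoothSub V :=
  ⟨fun z => (l z : ℂ), (Complex.ofRealCLM.contDiff.comp l.contDiff : ContDiff ℝ ∞ _)⟩

/-- H(z) - H(z₀) is the integral of dH(z₀ + t(z - z₀))(z - z₀) over [0,1]; expanding the argument z
- z₀ in the basis gives the factors. -/
lemma hadamard (H : SmoothSub V) (z₀ : V) {ι : Type} [Fintype ι] (b : Module.Basis ι ℝ V) :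
    ∃ B : ι → SmoothSub V, H = algebraMap ℂ (SmoothSub V) (H.1 z₀) +
      ∑ k, (linSmooth (LinearMap.toContinuousLinearMap (b.coord k)) -
        algebraMap ℂ (SmoothSub V) (b.coord k z₀ : ℝ)) * B k := by
  have hH : ContDiff ℝ ∞ H.1 := H.2
  have hd : Differentiable ℝ H.1 := hH.differentiable (by simp)
  have hG : ∀ v : V, ContDiff ℝ ∞ fun p : V × ℝ => fderiv ℝ H.1 (z₀ + p.2 • (p.1 - z₀)) v := by
    intro v
    have h1 : ContDiff ℝ ∞ (fderiv ℝ H.1) := hH.fderiv_right (by simp)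
    exact (h1.comp (by fun_prop :
      ContDiff ℝ ∞ fun p : V × ℝ => z₀ + p.2 • (p.1 - z₀))).clm_apply contDiff_const
  refine ⟨fun k => ⟨fun z => ∫ t in (0 : ℝ)..1, fderiv ℝ H.1 (z₀ + t • (z - z₀)) (b k),
    contDiff_integral_param (hG (b k))⟩, ?_⟩
  ext z
  have h1 : ∀ t : ℝ, HasDerivAt (fun t : ℝ => H.1 (z₀ + t • (z - z₀)))
      (fderiv ℝ H.1 (z₀ + t • (z - z₀)) (z - z₀)) t := by
    intro t
    refine (hd _).hasFDerivAt.comp_hasDerivAt t ?_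
    simpa using (((hasDerivAt_id t).smul_const (z - z₀)).const_add z₀)
  have hcont : ∀ v, Continuous fun t : ℝ => fderiv ℝ H.1 (z₀ + t • (z - z₀)) v := fun v =>
    (hG v).continuous.comp (by fun_prop : Continuous fun t : ℝ => (z, t))
  have h2 := intervalIntegral.integral_eq_sub_of_hasDerivAt (a := 0) (b := 1)
    (fun t _ => h1 t) ((hcont _).intervalIntegrable _ _)
  simp only [one_smul, zero_smul, add_zero, add_sub_cancel] at h2
  have h3 : ∀ t : ℝ, fderiv ℝ H.1 (z₀ + t • (z - z₀)) (z - z₀) =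
      ∑ k, ((b.coord k z - b.coord k z₀ : ℝ) : ℂ) *
        fderiv ℝ H.1 (z₀ + t • (z - z₀)) (b k) := by
    intro t
    have h4 : fderiv ℝ H.1 (z₀ + t • (z - z₀)) (z - z₀) =
        fderiv ℝ H.1 (z₀ + t • (z - z₀)) (∑ k, b.repr (z - z₀) k • b k) := by
      rw [b.sum_repr]
    rw [h4, map_sum]
    refine Finset.sum_congr rfl fun k _ => ?_
    rw [map_smul, ← Module.Basis.coord_apply, map_sub, Complex.real_smul]
  simp_rw [h3] at h2
  rw [intervalIntegral.integral_finsetSum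
    (fun k _ => ((hcont (b k)).const_mul _).intervalIntegrable _ _)] at h2
  simp_rw [intervalIntegral.integral_const_mul] at h2
  simp only [Subalgebra.coe_add, Subalgebra.coe_algebraMap, Pi.add_apply, Pi.algebraMap_apply,
    Algebra.algebraMap_self, RingHom.id_apply, AddSubmonoidClass.coe_finsetSum,
    Finset.sum_apply, Subalgebra.coe_mul, Subalgebra.coe_sub, Pi.mul_apply, Pi.sub_apply, linSmooth,
    LinearMap.coe_toContinuousLinearMap']
  rw [← sub_eq_iff_eq_add', ← h2]
  refine Finset.sum_congr rfl fun k _ => ?_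
  push_cast
  rfl

/-- A point derivation of the algebra of smooth functions is determined by its values on
linear functions. -/
lemma pointDerivation_eq_zero {W : Type*} [AddCommGroup W] [Module ℂ W] (z₀ : V)
    (δ : SmoothSub V →ₗ[ℂ] W)
    (hδ : ∀ f g : SmoothSub V, δ (f * g) = f.1 z₀ • δ g + g.1 z₀ • δ f)
    (hl : ∀ l : V →L[ℝ] ℝ, δ (linSmooth l) = 0) (H : SmoothSub V) : δ H = 0 := by
  have h1 : δ 1 = 0 := by
    have h := hδ 1 1
    have h' : ((1 : SmoothSub V) : V → ℂ) z₀ = 1 := rfl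
    rw [one_mul, h', one_smul] at h
    simpa using h
  have hc : ∀ c : ℂ, δ (algebraMap ℂ (SmoothSub V) c) = 0 := fun c => by
    rw [Algebra.algebraMap_eq_smul_one, map_smul, h1, smul_zero]
  obtain ⟨B, hB⟩ := hadamard H z₀ (Module.finBasis ℝ V)
  rw [hB, map_add, hc, map_sum, zero_add]
  refine Finset.sum_eq_zero fun k _ => ?_
  rw [hδ, map_sub, hl, hc, sub_zero, smul_zero, add_zero]
  have : ((linSmooth (LinearMap.toContinuousLinearMap ((Module.finBasis ℝ V).coord k)) -
      algebraMap ℂ (SmoothSub V) ((Module.finBasis ℝ V).coord k z₀ : ℝ) : SmoothSub V) : V → ℂ) z₀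
      = 0 := by
    simp [linSmooth]
  rw [this, zero_smul]

end Hadamard

/-! ### Matrices -/

section Matrices

variable {n : ℕ}

/-- The derivations of the algebra of matrices are inner. -/
lemma matrix_derivation_inner [NeZero n]
    (D : Matrix (Fin n) (Fin n) ℂ →ₗ[ℂ] Matrix (Fin n) (Fin n) ℂ)
    (hD : ∀ a b, D (a * b) = D a * b + a * D b) (C : Matrix (Fin n) (Fin n) ℂ) :
    D C = (∑ k, D (Matrix.single k 0 1) * Matrix.single 0 k 1) * C -
      C * ∑ k, D (Matrix.single k 0 1) * Matrix.single 0 k 1 := by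
  have h1 : ∀ k, Matrix.single 0 k (1 : ℂ) * C = ∑ l, C k l • Matrix.single (0 : Fin n) l (1 : ℂ) := by
    intro k
    ext i j
    rw [Matrix.sum_apply]
    by_cases hi : i = 0
    · subst hi
      simp [Matrix.single_apply]
    · rw [Matrix.single_mul_apply_of_ne _ _ _ _ _ hi]
      simp [Ne.symm hi]
  have h2 : ∀ l, C * Matrix.single l 0 (1 : ℂ) = ∑ k, C k l • Matrix.single k (0 : Fin n) (1 : ℂ) := by
    intro l
    ext i j
    rw [Matrix.sum_apply]
    by_cases hj : j = 0
    · subst hj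
      simp [Matrix.single_apply]
    · rw [Matrix.mul_single_apply_of_ne _ _ _ _ _ hj]
      simp [Ne.symm hj]
  have h3 : ∑ k : Fin n, Matrix.single k (0 : Fin n) (1 : ℂ) * Matrix.single 0 k 1 = 1 := by
    ext i j
    rw [Matrix.sum_apply]
    simp [Matrix.single_apply, Matrix.one_apply, ite_and]
  -- Both e₀ₖ C and C eₗ₀ expand with the entries of C, so right multiplication by C becomes left
  -- multiplication inside D. The Leibniz rule then splits off D C, as the eₗ₀ e₀ₗ add up to 1.
  have h4 : (∑ k, D (Matrix.single k 0 1) * Matrix.single 0 k 1) * C =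
      ∑ l, D (C * Matrix.single l 0 1) * Matrix.single 0 l 1 := by
    rw [Finset.sum_mul]
    simp_rw [mul_assoc, h1, h2, map_sum, map_smul, Finset.sum_mul, Finset.mul_sum, mul_smul_comm,
      smul_mul_assoc]
    rw [Finset.sum_comm]
  rw [h4]
  simp_rw [hD, add_mul, Finset.sum_add_distrib, mul_assoc]
  rw [← Finset.mul_sum, ← Finset.mul_sum, h3, mul_one, add_sub_cancel_right]

lemma eq_smul_one_of_commute [NeZero n] {γ : Matrix (Fin n) (Fin n) ℂ}
    (h : ∀ C : Matrix (Fin n) (Fin n) ℂ, γ * C = C * γ) : γ = γ 0 0 • 1 := by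
  ext i j
  have h1 := congrFun (congrFun (h (Matrix.single j 0 1)) i) 0
  rw [Matrix.mul_single_apply_same, mul_one] at h1
  rw [h1, Matrix.smul_apply, Matrix.one_apply]
  by_cases hij : i = j
  · subst hij; simp
  · rw [Matrix.single_mul_apply_of_ne _ _ _ _ _ hij]; simp [hij]

lemma expSU_coe (A : su n) (t : ℝ) : ((expSU A t : Matrix.specialUnitaryGroup (Fin n) ℂ) :
    Matrix (Fin n) (Fin n) ℂ) = NormedSpace.exp (t • (A : Matrix (Fin n) (Fin n) ℂ)) := rfl

lemma expSU_zero (A : su n) : expSU A 0 = 1 := by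
  ext1
  rw [expSU_coe, zero_smul, NormedSpace.exp_zero]
  rfl

lemma expSU_add (A : su n) (s t : ℝ) : expSU A (s + t) = expSU A s * expSU A t := by
  ext1
  rw [expSU_coe, add_smul, Matrix.exp_add_of_commute _ _
    (((Commute.refl (A : Matrix (Fin n) (Fin n) ℂ)).smul_left s).smul_right t)]
  rfl

open scoped Matrix.Norms.Operator in
lemma hasDerivAt_expSU (A : su n) (t : ℝ) (i j : Fin n) :
    HasDerivAt (fun t : ℝ => (expSU A t : Matrix (Fin n) (Fin n) ℂ) i j)
      (((expSU A t : Matrix (Fin n) (Fin n) ℂ) * (A : Matrix (Fin n) (Fin n) ℂ)) i j) t := by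
  have h := hasDerivAt_exp_smul_const (𝕂 := ℝ) (A : Matrix (Fin n) (Fin n) ℂ) t
  let e : Matrix (Fin n) (Fin n) ℂ →L[ℝ] ℂ := LinearMap.toContinuousLinearMap
    { toFun := fun B => B i j, map_add' := fun _ _ => rfl, map_smul' := fun _ _ => rfl }
  exact e.hasFDerivAt.comp_hasDerivAt t h

open scoped Matrix.Norms.L2Operator in
-- H is the principal argument of U in the functional calculus. The spectrum is finite, so the
-- discontinuity of the argument does no harm, and it lies on the unit circle, where i arg z is a
-- logarithm.
lemma exists_exp_of_unitary (U : Matrix (Fin n) (Fin n) ℂ)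
    (hU : U ∈ unitary (Matrix (Fin n) (Fin n) ℂ)) :
    ∃ H : Matrix (Fin n) (Fin n) ℂ, H.IsHermitian ∧ NormedSpace.exp (Complex.I • H) = U := by
  have hn : IsStarNormal U := ⟨by
    rw [Commute, SemiconjBy, Unitary.star_mul_self_of_mem hU, Unitary.mul_star_self_of_mem hU]⟩
  have hfin : (spectrum ℂ U).Finite := Matrix.finite_spectrum U
  refine ⟨cfc (fun z : ℂ => (z.arg : ℂ)) U, IsSelfAdjoint.cfc_arg U, ?_⟩
  rw [← CFC.exp_eq_normedSpace_exp (𝕜 := ℂ), ← cfc_smul (hf := hfin.continuousOn _),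
    ← cfc_comp' (hg := (hfin.image _).continuousOn _) (hf := hfin.continuousOn _)]
  conv_rhs => rw [← cfc_id' ℂ U]
  refine cfc_congr fun y hy => ?_
  have hy₁ : ‖y‖ = 1 := spectrum.norm_eq_one_of_unitary hU hy
  have h0 : y ≠ 0 := fun h => by simp [h] at hy₁
  have : Complex.I * y.arg = Complex.log y :=
    Complex.ext (by simp [Complex.log_re, hy₁]) (by simp [Complex.log_im])
  simpa [← Complex.exp_eq_exp_ℂ, this] using Complex.exp_log h0

/-- The exponential map of `SU(n)` is surjective. -/
lemma exists_expSU_eq [NeZero n] (g : Matrix.specialUnitaryGroup (Fin n) ℂ) :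
    ∃ A : su n, expSU A 1 = g := by
  obtain ⟨hg, hdet⟩ := Matrix.mem_specialUnitaryGroup_iff.1 g.2
  obtain ⟨H, hH, hexp⟩ := exists_exp_of_unitary _ hg
  set U := hH.eigenvectorUnitary
  have hU : (U : Matrix (Fin n) (Fin n) ℂ) * star (U : Matrix (Fin n) (Fin n) ℂ) = 1 :=
    Unitary.coe_mul_star_self U
  have hU' : star (U : Matrix (Fin n) (Fin n) ℂ) * (U : Matrix (Fin n) (Fin n) ℂ) = 1 :=
    Unitary.coe_star_mul_self U
  let V : (Matrix (Fin n) (Fin n) ℂ)ˣ := ⟨U, star (U : Matrix (Fin n) (Fin n) ℂ), hU, hU'⟩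
  have key := hH.spectral_theorem
  rw [Unitary.conjStarAlgAut_apply] at key
  have hconj : ∀ d : Fin n → ℂ, NormedSpace.exp ((V : Matrix (Fin n) (Fin n) ℂ) *
      Matrix.diagonal d * ((V⁻¹ : _ˣ) : Matrix (Fin n) (Fin n) ℂ)) =
      (V : Matrix (Fin n) (Fin n) ℂ) * Matrix.diagonal (fun i => Complex.exp (d i)) *
      ((V⁻¹ : _ˣ) : Matrix (Fin n) (Fin n) ℂ) := by
    intro d
    rw [Matrix.exp_units_conj, Matrix.exp_diagonal]
    congr 3
    funext i
    rw [Pi.coe_exp, Complex.exp_eq_exp_ℂ]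
  have hg1 : (g : Matrix (Fin n) (Fin n) ℂ) = (V : Matrix (Fin n) (Fin n) ℂ) *
      Matrix.diagonal (fun i => Complex.exp (Complex.I * hH.eigenvalues i)) *
      ((V⁻¹ : _ˣ) : Matrix (Fin n) (Fin n) ℂ) := by
    rw [← hconj, ← hexp]
    congr 1
    have h2 : Matrix.diagonal (fun i => Complex.I * (hH.eigenvalues i : ℂ)) =
        Complex.I • Matrix.diagonal (RCLike.ofReal ∘ hH.eigenvalues : Fin n → ℂ) := by
      rw [← Matrix.diagonal_smul]; rfl
    rw [h2, Matrix.mul_smul, Matrix.smul_mul]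
    conv_lhs => rw [key]
    rfl
  have hprod : Complex.exp (Complex.I * ∑ i, (hH.eigenvalues i : ℂ)) = 1 := by
    rw [hg1, Matrix.det_units_conj, Matrix.det_diagonal, ← Complex.exp_sum] at hdet
    rw [Finset.mul_sum, hdet]
  obtain ⟨k, hk⟩ := Complex.exp_eq_one_iff.1 hprod
  have hk' : ∑ i, (hH.eigenvalues i : ℂ) = k * (2 * Real.pi) := by
    have : Complex.I * ∑ i, (hH.eigenvalues i : ℂ) = Complex.I * (k * (2 * Real.pi)) := by
      rw [hk]; ring
    exact mul_left_cancel₀ Complex.I_ne_zero this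
  -- Determinant one only gives 2πk as the sum of the eigenvalues. Subtracting 2πk from a single one
  -- makes the trace zero and leaves the exponential unchanged.
  let e : Fin n → ℝ := fun i => hH.eigenvalues i - if i = 0 then k * (2 * Real.pi) else 0
  let d : Fin n → ℂ := fun i => Complex.I * (e i : ℂ)
  have hAmem : (V : Matrix (Fin n) (Fin n) ℂ) * Matrix.diagonal d *
      ((V⁻¹ : _ˣ) : Matrix (Fin n) (Fin n) ℂ) ∈ su n := by
    constructor
    · have hV : ((V⁻¹ : _ˣ) : Matrix (Fin n) (Fin n) ℂ) = (V : Matrix (Fin n) (Fin n) ℂ)ᴴ := rfl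
      rw [hV, Matrix.conjTranspose_mul, Matrix.conjTranspose_mul, Matrix.conjTranspose_conjTranspose,
        Matrix.diagonal_conjTranspose]
      have : star d = -d := by
        funext i
        simp [d]
      have h3 : Matrix.diagonal (-d) = -Matrix.diagonal d := (Matrix.diagonal_neg d).symm
      rw [this, h3, Matrix.mul_assoc, Matrix.neg_mul, Matrix.mul_neg]
    · rw [Matrix.trace_units_conj, Matrix.trace_diagonal]
      simp only [d, e]
      rw [← Finset.mul_sum]
      push_cast
      rw [Finset.sum_sub_distrib, hk']
      simp [apply_ite (Complex.ofReal)]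
  refine ⟨⟨_, hAmem⟩, ?_⟩
  ext1
  rw [expSU_coe, one_smul, hg1, hconj]
  congr 3
  funext i
  simp only [d, e]
  by_cases hi : i = 0
  · simp only [hi, if_true]
    push_cast
    rw [mul_sub, Complex.exp_sub]
    have : Complex.exp (Complex.I * (k * (2 * Real.pi))) = 1 :=
      Complex.exp_eq_one_iff.2 ⟨k, by ring⟩
    rw [this, div_one]
  · simp [hi]

/-- The skew part and i times a skew part: su(n) spans the traceless matrices over ℂ. This is needed
because derivations of complex valued functions at a point have complex coefficients. -/
lemma exists_su_add_I_smul (Γ : Matrix (Fin n) (Fin n) ℂ) (h : Γ.trace = 0) :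
    ∃ A B : su n, Γ = (A : Matrix (Fin n) (Fin n) ℂ) +
      Complex.I • (B : Matrix (Fin n) (Fin n) ℂ) := by
  refine ⟨⟨(1 / 2 : ℂ) • (Γ - Γᴴ), ?_, ?_⟩, ⟨(-Complex.I / 2) • (Γ + Γᴴ), ?_, ?_⟩, ?_⟩
  · simp [Matrix.conjTranspose_smul, ← smul_neg]
  · simp [Matrix.trace_conjTranspose, h]
  · rw [Matrix.conjTranspose_smul, ← neg_smul]
    congr 1
    · simp [neg_div]
    · simp [add_comm]
  · simp [Matrix.trace_conjTranspose, h]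
  · change Γ = (1 / 2 : ℂ) • (Γ - Γᴴ) + Complex.I • ((-Complex.I / 2) • (Γ + Γᴴ))
    rw [smul_smul]
    have : Complex.I * (-Complex.I / 2) = 1 / 2 := by
      rw [mul_div_assoc', mul_neg, Complex.I_mul_I]; norm_num
    rw [this, ← smul_add]
    ext i j
    simp
    ring

end Matrices

end DerCalc

end

noncomputable section

namespace DerCalc

/-! ### Smooth local sections of E and local unimodular orthonormal frames. -/

section SmoothTools

variable {m : ℕ} {M : Type*} [TopologicalSpace M] [ChartedSpace (EuclideanSpace ℝ (Fin m)) M]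
  {U : Set M} {f g : M → ℂ}

lemma cmOn_mul (hf : ContMDiffOn (𝓡 m) 𝓘(ℝ, ℂ) ∞ f U) (hg : ContMDiffOn (𝓡 m) 𝓘(ℝ, ℂ) ∞ g U) :
    ContMDiffOn (𝓡 m) 𝓘(ℝ, ℂ) ∞ (fun x => f x * g x) U :=
  (contDiff_mul (𝕜 := ℝ) (𝔸 := ℂ)).contMDiff.comp_contMDiffOn (hf.prodMk_space hg)

lemma cmOn_conj (hf : ContMDiffOn (𝓡 m) 𝓘(ℝ, ℂ) ∞ f U) :
    ContMDiffOn (𝓡 m) 𝓘(ℝ, ℂ) ∞ (fun x => (starRingEnd ℂ) (f x)) U :=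
  (Complex.conjCLE.contDiff (n := ∞)).contMDiff.comp_contMDiffOn hf

lemma cmOn_inv (hf : ContMDiffOn (𝓡 m) 𝓘(ℝ, ℂ) ∞ f U) (h0 : ∀ x ∈ U, f x ≠ 0) :
    ContMDiffOn (𝓡 m) 𝓘(ℝ, ℂ) ∞ (fun x => (f x)⁻¹) U := by
  intro x hx
  exact ((contDiffAt_inv ℝ (h0 x hx)).contMDiffAt).comp_contMDiffWithinAt x (hf x hx)

lemma cmOn_sum {ι : Type*} (s : Finset ι) {F : Type*} [NormedAddCommGroup F] [NormedSpace ℝ F]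
    {f : ι → M → F}
    (hf : ∀ i ∈ s, ContMDiffOn (𝓡 m) 𝓘(ℝ, F) ∞ (f i) U) :
    ContMDiffOn (𝓡 m) 𝓘(ℝ, F) ∞ (fun x => ∑ i ∈ s, f i x) U := by
  classical
  induction s using Finset.induction_on with
  | empty => simpa using contMDiffOn_const
  | insert i s hi ih =>
    simp only [Finset.sum_insert hi]
    exact (contDiff_add (𝕜 := ℝ)).contMDiff.comp_contMDiffOn
      ((hf i (Finset.mem_insert_self _ _)).prodMk_space
        (ih fun j hj => hf j (Finset.mem_insert_of_mem hj)))

lemma cmOn_prod {ι : Type*} (s : Finset ι) {f : ι → M → ℂ}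
    (hf : ∀ i ∈ s, ContMDiffOn (𝓡 m) 𝓘(ℝ, ℂ) ∞ (f i) U) :
    ContMDiffOn (𝓡 m) 𝓘(ℝ, ℂ) ∞ (fun x => ∏ i ∈ s, f i x) U := by
  classical
  induction s using Finset.induction_on with
  | empty => simpa using contMDiffOn_const
  | insert i s hi ih =>
    simp only [Finset.prod_insert hi]
    exact cmOn_mul (hf i (Finset.mem_insert_self _ _))
      (ih fun j hj => hf j (Finset.mem_insert_of_mem hj))

lemma cmOn_smul {F : Type*} [NormedAddCommGroup F] [NormedSpace ℝ F] [NormedSpace ℂ F]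
    [IsScalarTower ℝ ℂ F] {v : M → F}
    (hf : ContMDiffOn (𝓡 m) 𝓘(ℝ, ℂ) ∞ f U) (hv : ContMDiffOn (𝓡 m) 𝓘(ℝ, F) ∞ v U) :
    ContMDiffOn (𝓡 m) 𝓘(ℝ, F) ∞ (fun x => f x • v x) U :=
  (contDiff_smul (𝕜 := ℝ) (𝕜' := ℂ)).contMDiff.comp_contMDiffOn (hf.prodMk_space hv)

lemma cmOn_coord {n : ℕ} {v : M → EuclideanSpace ℂ (Fin n)}
    (hv : ContMDiffOn (𝓡 m) 𝓘(ℝ, EuclideanSpace ℂ (Fin n)) ∞ v U) (k : Fin n) :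
    ContMDiffOn (𝓡 m) 𝓘(ℝ, ℂ) ∞ (fun x => v x k) U :=
  ((EuclideanSpace.proj (𝕜 := ℂ) k).restrictScalars ℝ).contDiff.contMDiff.comp_contMDiffOn hv

end SmoothTools

section LocalFrames

variable {m n : ℕ} {M : Type*} [TopologicalSpace M]
  [ChartedSpace (EuclideanSpace ℝ (Fin m)) M]
  {E : M → Type*} [TopologicalSpace (Bundle.TotalSpace (EuclideanSpace ℂ (Fin n)) E)]
  [∀ x, NormedAddCommGroup (E x)] [∀ x, InnerProductSpace ℂ (E x)]
  [FiberBundle (EuclideanSpace ℂ (Fin n)) E] [VectorBundle ℂ (EuclideanSpace ℂ (Fin n)) E]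

/-- The section `σ` of `E` is smooth over `U` in the local trivialization `e`. -/
def SmoothSec (m : ℕ) [ChartedSpace (EuclideanSpace ℝ (Fin m)) M]
    (e : Bundle.Trivialization (EuclideanSpace ℂ (Fin n))
      (Bundle.TotalSpace.proj : Bundle.TotalSpace (EuclideanSpace ℂ (Fin n)) E → M))
    [MemTrivializationAtlas e] (U : Set M) (σ : ∀ x, E x) : Prop :=
  ContMDiffOn (𝓡 m) 𝓘(ℝ, EuclideanSpace ℂ (Fin n)) ∞
    (fun x => e.continuousLinearMapAt ℂ x (σ x)) U

/-- The local frame of `E` given by a trivialization. -/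
def trivFrame (e : Bundle.Trivialization (EuclideanSpace ℂ (Fin n))
      (Bundle.TotalSpace.proj : Bundle.TotalSpace (EuclideanSpace ℂ (Fin n)) E → M))
    [MemTrivializationAtlas e] (x : M) (k : Fin n) : E x :=
  e.symm x (EuclideanSpace.single k 1)

variable (e : Bundle.Trivialization (EuclideanSpace ℂ (Fin n))
      (Bundle.TotalSpace.proj : Bundle.TotalSpace (EuclideanSpace ℂ (Fin n)) E → M))
    [MemTrivializationAtlas e]

omit [ChartedSpace (EuclideanSpace ℝ (Fin m)) M] in
lemma symm_eq_sum {x : M} (hx : x ∈ e.baseSet) (v : EuclideanSpace ℂ (Fin n)) :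
    e.symm x v = ∑ k, v k • trivFrame e x k := by
  have h : v = ∑ k, v k • EuclideanSpace.single k (1 : ℂ) := by
    ext i
    simp [Pi.single_apply]
  conv_lhs => rw [h]
  rw [← e.symmL_apply (R := ℂ) hx, map_sum]
  refine Finset.sum_congr rfl fun k _ => ?_
  rw [map_smul, e.symmL_apply (R := ℂ) hx, trivFrame]

omit [ChartedSpace (EuclideanSpace ℝ (Fin m)) M] in
lemma eq_sum_trivFrame {x : M} (hx : x ∈ e.baseSet) (v : E x) :
    v = ∑ k, (e.continuousLinearMapAt ℂ x v) k • trivFrame e x k := by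
  rw [← symm_eq_sum e hx, ← e.symmL_apply (R := ℂ) hx, e.symmL_continuousLinearMapAt hx]

omit [ChartedSpace (EuclideanSpace ℝ (Fin m)) M] in
lemma continuousLinearMapAt_trivFrame {x : M} (hx : x ∈ e.baseSet) (k : Fin n) :
    e.continuousLinearMapAt ℂ x (trivFrame e x k) = EuclideanSpace.single k 1 := by
  rw [trivFrame, ← e.symmL_apply (R := ℂ) hx, e.continuousLinearMapAt_symmL hx]

lemma smoothSec_trivFrame (k : Fin n) : SmoothSec m e e.baseSet (fun x => trivFrame e x k) :=
  contMDiffOn_const.congr fun x hx => continuousLinearMapAt_trivFrame e hx k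

variable {e} {U : Set M}

lemma SmoothSec.add {σ τ : ∀ x, E x} (hσ : SmoothSec m e U σ) (hτ : SmoothSec m e U τ) :
    SmoothSec m e U (fun x => σ x + τ x) := by
  refine ((contDiff_add (𝕜 := ℝ)).contMDiff.comp_contMDiffOn (hσ.prodMk_space hτ)).congr ?_
  intro x _
  simp

lemma SmoothSec.smul {f : M → ℂ} (hf : ContMDiffOn (𝓡 m) 𝓘(ℝ, ℂ) ∞ f U) {σ : ∀ x, E x}
    (hσ : SmoothSec m e U σ) : SmoothSec m e U (fun x => f x • σ x) := by
  refine (cmOn_smul hf hσ).congr ?_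
  intro x _
  simp

lemma SmoothSec.sum {ι : Type*} (s : Finset ι) {σ : ι → ∀ x, E x}
    (hσ : ∀ i ∈ s, SmoothSec m e U (σ i)) : SmoothSec m e U (fun x => ∑ i ∈ s, σ i x) := by
  refine (cmOn_sum s hσ).congr ?_
  intro x _
  simp

lemma SmoothSec.mono {σ : ∀ x, E x} (hσ : SmoothSec m e U σ) {U' : Set M} (h : U' ⊆ U) :
    SmoothSec m e U' σ := ContMDiffOn.mono hσ h

lemma SmoothSec.contMDiffOn_inner [IsSmoothHermitianBundle (m := m) n E] {σ τ : ∀ x, E x}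
    (hσ : SmoothSec m e U σ) (hτ : SmoothSec m e U τ) (hU : U ⊆ e.baseSet) :
    ContMDiffOn (𝓡 m) 𝓘(ℝ, ℂ) ∞ (fun x => inner ℂ (σ x) (τ x)) U := by
  have h : ContMDiffOn (𝓡 m) 𝓘(ℝ, ℂ) ∞ (fun x => ∑ k, ∑ l,
      ((starRingEnd ℂ) ((e.continuousLinearMapAt ℂ x (σ x)) k) *
        (e.continuousLinearMapAt ℂ x (τ x)) l) *
        inner ℂ (trivFrame e x k) (trivFrame e x l)) U :=
    cmOn_sum _ fun k _ => cmOn_sum _ fun l _ =>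
      cmOn_mul (cmOn_mul (cmOn_conj (cmOn_coord hσ k)) (cmOn_coord hτ l))
        ((IsSmoothHermitianBundle.smooth_inner (m := m) e _ _).mono hU)
  refine h.congr fun x hx => ?_
  conv_lhs => rw [eq_sum_trivFrame e (hU hx) (σ x), eq_sum_trivFrame e (hU hx) (τ x)]
  simp_rw [sum_inner, inner_sum, inner_smul_left, inner_smul_right]
  refine Finset.sum_congr rfl fun k _ => Finset.sum_congr rfl fun l _ => ?_
  ring

lemma SmoothSec.change [IsSmoothHermitianBundle (m := m) n E]
    {e' : Bundle.Trivialization (EuclideanSpace ℂ (Fin n))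
      (Bundle.TotalSpace.proj : Bundle.TotalSpace (EuclideanSpace ℂ (Fin n)) E → M)}
    [MemTrivializationAtlas e'] {σ : ∀ x, E x} (hσ : SmoothSec m e U σ) (hU : U ⊆ e.baseSet) :
    SmoothSec m e' (U ∩ e'.baseSet) σ := by
  have h1 := (IsSmoothHermitianBundle.smooth_coordChange (m := m) (n := n) e e').mono
    (Set.inter_subset_inter_left e'.baseSet hU)
  have hc : ContDiff ℝ ∞ (fun p : (EuclideanSpace ℂ (Fin n) →L[ℂ] EuclideanSpace ℂ (Fin n)) ×
      EuclideanSpace ℂ (Fin n) => p.1 p.2) :=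
    (ContDiff.restrict_scalars ℝ (𝕜' := ℂ) (isBoundedBilinearMap_apply (𝕜 := ℂ)).contDiff)
  refine (hc.contMDiff.comp_contMDiffOn
    (h1.prodMk_space (ContMDiffOn.mono hσ Set.inter_subset_left))).congr ?_
  rintro x ⟨hx, hx'⟩
  have h2 := e.coordChangeL_apply (R := ℂ) e' ⟨hU hx, hx'⟩ (e.continuousLinearMapAt ℂ x (σ x))
  have h3 : e.symm x (e.continuousLinearMapAt ℂ x (σ x)) = σ x := by
    rw [← e.symmL_apply (R := ℂ) (hU hx), e.symmL_continuousLinearMapAt (hU hx)]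
  simp only [Function.comp]
  erw [h2]
  rw [h3, e'.continuousLinearMapAt_apply ℂ, e'.coe_linearMapAt_of_mem hx']


omit [ChartedSpace (EuclideanSpace ℝ (Fin m)) M] in
lemma linearIndependent_trivFrame (e : Bundle.Trivialization (EuclideanSpace ℂ (Fin n))
      (Bundle.TotalSpace.proj : Bundle.TotalSpace (EuclideanSpace ℂ (Fin n)) E → M))
    [MemTrivializationAtlas e] {x : M} (hx : x ∈ e.baseSet) :
    LinearIndependent ℂ (trivFrame e x) := by
  refine LinearIndependent.of_comp (e.continuousLinearMapAt ℂ x).toLinearMap ?_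
  have h : ((e.continuousLinearMapAt ℂ x).toLinearMap ∘ trivFrame e x) =
      fun k => EuclideanSpace.single k (1 : ℂ) := by
    funext k
    exact continuousLinearMapAt_trivFrame e hx k
  rw [h]
  have := (EuclideanSpace.basisFun (Fin n) ℂ).toBasis.linearIndependent
  rwa [OrthonormalBasis.coe_toBasis, show ⇑(EuclideanSpace.basisFun (Fin n) ℂ) =
    fun k => EuclideanSpace.single k (1 : ℂ) from funext fun k => by simp] at this

open InnerProductSpace in
-- Each step subtracts quotients of inner products of smooth sections, and the denominators do not
-- vanish because the frame of a trivialization is independent.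
lemma smoothSec_gramSchmidt [IsSmoothHermitianBundle (m := m) n E] (k : Fin n) :
    SmoothSec m e e.baseSet (fun x => gramSchmidt ℂ (trivFrame e x) k) := by
  induction k using WellFoundedLT.induction with
  | ind k ih =>
  simp_rw [gramSchmidt_def ℂ (trivFrame e _) k, sub_eq_add_neg, ← Finset.sum_neg_distrib]
  refine (smoothSec_trivFrame (m := m) e k).add (SmoothSec.sum _ fun i hi => ?_)
  have hi' := ih i (Finset.mem_Iio.1 hi)
  have h1 : SmoothSec m e e.baseSet (fun x => (-1 * (inner ℂ (gramSchmidt ℂ (trivFrame e x) i)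
      (trivFrame e x k) * (inner ℂ (gramSchmidt ℂ (trivFrame e x) i)
      (gramSchmidt ℂ (trivFrame e x) i))⁻¹)) • gramSchmidt ℂ (trivFrame e x) i) := by
    refine SmoothSec.smul (cmOn_mul contMDiffOn_const (cmOn_mul
      (hi'.contMDiffOn_inner (smoothSec_trivFrame e k) subset_rfl)
      (cmOn_inv (hi'.contMDiffOn_inner hi' subset_rfl) fun x hx => ?_))) hi'
    exact inner_self_ne_zero.2 (gramSchmidt_ne_zero i (linearIndependent_trivFrame e hx))
  convert h1 using 2 with x
  rw [Submodule.starProjection_singleton, inner_self_eq_norm_sq_to_K, ← neg_smul]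
  simp [div_eq_mul_inv]

lemma contMDiffOn_vol (o : BundleOrientation (m := m) n E) {σ : Fin n → ∀ x, E x}
    (hσ : ∀ k, SmoothSec m e U (σ k)) (hU : U ⊆ e.baseSet) :
    ContMDiffOn (𝓡 m) 𝓘(ℝ, ℂ) ∞ (fun x => o.vol x (fun k => σ k x)) U := by
  have h : ContMDiffOn (𝓡 m) 𝓘(ℝ, ℂ) ∞ (fun x => ∑ r : Fin n → Fin n,
      (∏ k, (e.continuousLinearMapAt ℂ x (σ k x)) (r k)) *
        o.vol x (fun k => trivFrame e x (r k))) U :=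
    cmOn_sum _ fun r _ => cmOn_mul (cmOn_prod _ fun k _ => cmOn_coord (hσ k) (r k))
      ((o.smooth_vol e _).mono hU)
  refine h.congr fun x hx => ?_
  have h1 : (fun k => σ k x) =
      fun k => ∑ j, (e.continuousLinearMapAt ℂ x (σ k x)) j • trivFrame e x j :=
    funext fun k => eq_sum_trivFrame e (hU hx) (σ k x)
  rw [h1]
  rw [← AlternatingMap.coe_multilinearMap, MultilinearMap.map_sum]
  refine Finset.sum_congr rfl fun r _ => ?_
  rw [MultilinearMap.map_smul_univ]
  rfl

open InnerProductSpace in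
/-- The Gram-Schmidt frame of a trivialization, with its first vector rotated to volume one. -/
def unitFrame [NeZero n] (o : BundleOrientation (m := m) n E)
    (e : Bundle.Trivialization (EuclideanSpace ℂ (Fin n))
      (Bundle.TotalSpace.proj : Bundle.TotalSpace (EuclideanSpace ℂ (Fin n)) E → M))
    [MemTrivializationAtlas e] (x : M) (k : Fin n) : E x :=
  (if k = 0 then (starRingEnd ℂ) (o.vol x (gramSchmidtNormed ℂ (trivFrame e x))) else 1) •
    gramSchmidtNormed ℂ (trivFrame e x) k

open InnerProductSpace in
lemma smoothSec_gramSchmidtNormed [IsSmoothHermitianBundle (m := m) n E] (k : Fin n) :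
    SmoothSec m e e.baseSet (fun x => gramSchmidtNormed ℂ (trivFrame e x) k) := by
  have h := smoothSec_gramSchmidt (m := m) (e := e) k
  refine SmoothSec.smul ?_ h
  have hre : ∀ (x : M) (v : E x), (inner ℂ v v : ℂ).re = ‖v‖ ^ 2 :=
    fun x v => inner_self_eq_norm_sq (𝕜 := ℂ) v
  have h1 := h.contMDiffOn_inner h subset_rfl
  intro x hx
  have h0 := gramSchmidt_ne_zero k (linearIndependent_trivFrame e hx)
  have h2 : 0 < (inner ℂ (gramSchmidt ℂ (trivFrame e x) k)
      (gramSchmidt ℂ (trivFrame e x) k)).re := by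
    rw [hre]
    exact pow_pos (norm_pos_iff.2 h0) 2
  -- The inverse norm is a function of the inner product of the vector with itself, smooth where
  -- that number has positive real part.
  have h3 : ContDiffAt ℝ ∞ (fun z : ℂ => (((Real.sqrt z.re)⁻¹ : ℝ) : ℂ))
      (inner ℂ (gramSchmidt ℂ (trivFrame e x) k) (gramSchmidt ℂ (trivFrame e x) k)) := by
    refine Complex.ofRealCLM.contDiff.contDiffAt.comp _ ?_
    refine ContDiffAt.inv ?_ (Real.sqrt_pos.2 h2).ne'
    exact (Complex.reCLM.contDiff.contDiffAt).sqrt h2.ne'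
  refine (h3.contMDiffAt.comp_contMDiffWithinAt x (h1 x hx)).congr ?_ ?_
  · intro y _
    simp only [Function.comp]
    rw [hre, Real.sqrt_sq (norm_nonneg _)]
    simp
  · simp only [Function.comp]
    rw [hre, Real.sqrt_sq (norm_nonneg _)]
    simp

lemma smoothSec_unitFrame [NeZero n] [IsSmoothHermitianBundle (m := m) n E]
    (o : BundleOrientation (m := m) n E) (k : Fin n) :
    SmoothSec m e e.baseSet (fun x => unitFrame o e x k) := by
  refine SmoothSec.smul ?_ (smoothSec_gramSchmidtNormed k)
  by_cases hk : k = 0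
  · simp only [hk, if_true]
    exact cmOn_conj (contMDiffOn_vol o (fun k => smoothSec_gramSchmidtNormed k) subset_rfl)
  · simp only [hk, if_false]
    exact contMDiffOn_const

lemma norm_sq_vol {o : BundleOrientation (m := m) n E} {x : M} {u : Fin n → E x}
    (hu : Orthonormal ℂ u) : (starRingEnd ℂ) (o.vol x u) * o.vol x u = 1 := by
  rw [Complex.conj_mul', o.norm_vol x u hu]
  simp

open InnerProductSpace in
lemma orthonormal_unitFrame [NeZero n] (o : BundleOrientation (m := m) n E) {x : M}
    (hx : x ∈ e.baseSet) : Orthonormal ℂ (unitFrame o e x) := by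
  have h := gramSchmidtNormed_orthonormal (linearIndependent_trivFrame e hx)
  have hv := norm_sq_vol (o := o) h
  rw [orthonormal_iff_ite] at h ⊢
  intro i j
  rw [unitFrame, unitFrame, inner_smul_left, inner_smul_right, h i j]
  by_cases hij : i = j
  · subst hij
    by_cases hi : i = 0
    · simp [hi]
      rw [mul_comm, ← hv]
    · simp [hi]
  · simp [hij]

open InnerProductSpace in
lemma vol_unitFrame [NeZero n] (o : BundleOrientation (m := m) n E) {x : M}
    (hx : x ∈ e.baseSet) : o.vol x (unitFrame o e x) = 1 := by
  have h := gramSchmidtNormed_orthonormal (linearIndependent_trivFrame e hx)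
  have hv := norm_sq_vol (o := o) h
  have h1 := (o.vol x).toMultilinearMap.map_smul_univ
    (fun k : Fin n => if k = 0 then
      (starRingEnd ℂ) (o.vol x (gramSchmidtNormed ℂ (trivFrame e x))) else 1)
    (gramSchmidtNormed ℂ (trivFrame e x))
  rw [Finset.prod_ite_eq' Finset.univ (0 : Fin n)] at h1
  simp only [Finset.mem_univ, if_true, smul_eq_mul, AlternatingMap.coe_multilinearMap] at h1
  exact h1.trans hv

/-- A chart of `M` together with a smooth section of the frame bundle over its source. -/
structure LFrame (o : BundleOrientation (m := m) n E) where
  φ : OpenPartialHomeomorph M (EuclideanSpace ℝ (Fin m))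
  mem : φ ∈ IsManifold.maximalAtlas (𝓡 m) ∞ M
  s : ∀ x, Fin n → E x
  orthonormal : ∀ x ∈ φ.source, Orthonormal ℂ (s x)
  vol_eq_one : ∀ x ∈ φ.source, o.vol x (s x) = 1
  smooth : ∀ (e : Bundle.Trivialization (EuclideanSpace ℂ (Fin n))
      (Bundle.TotalSpace.proj : Bundle.TotalSpace (EuclideanSpace ℂ (Fin n)) E → M))
    [MemTrivializationAtlas e] (k : Fin n),
    SmoothSec m e (φ.source ∩ e.baseSet) (fun x => s x k)

lemma LFrame.exists_mem [NeZero n] [IsManifold (𝓡 m) ∞ M] [IsSmoothHermitianBundle (m := m) n E]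
    (o : BundleOrientation (m := m) n E) (x₀ : M) : ∃ Λ : LFrame o, x₀ ∈ Λ.φ.source := by
  let e := trivializationAt (EuclideanSpace ℂ (Fin n)) E x₀
  have hs : ((chartAt (EuclideanSpace ℝ (Fin m)) x₀).restr e.baseSet).source =
      (chartAt (EuclideanSpace ℝ (Fin m)) x₀).source ∩ e.baseSet := by
    rw [OpenPartialHomeomorph.restr_source, e.open_baseSet.interior_eq]
  refine ⟨⟨(chartAt (EuclideanSpace ℝ (Fin m)) x₀).restr e.baseSet, ?_, unitFrame o e, ?_, ?_, ?_⟩,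
    ?_⟩
  · exact restr_mem_maximalAtlas _ (IsManifold.chart_mem_maximalAtlas x₀) e.open_baseSet
  · intro x hx
    rw [hs] at hx
    exact orthonormal_unitFrame o hx.2
  · intro x hx
    rw [hs] at hx
    exact vol_unitFrame o hx.2
  · intro e' _ k
    rw [hs]
    exact ((smoothSec_unitFrame o k).change subset_rfl).mono
      (Set.inter_subset_inter_left _ Set.inter_subset_right)
  · rw [hs]
    exact ⟨mem_chart_source _ _, mem_baseSet_trivializationAt _ _ _⟩

end LocalFrames

end DerCalc

end

noncomputable section

namespace DerCalc

/-- The model space of the frame bundle: coordinates of the base point, and the matrix of a frame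
with respect to a local frame. -/
abbrev CoordSp (m n : ℕ) : Type := EuclideanSpace ℝ (Fin m) × (Fin n → Fin n → ℂ)

/-! ### The action of SU(n) on frames, and coordinates on the frame bundle. -/

section FrameCoordinates

open Filter Topology

variable {m n : ℕ} {M : Type*} [TopologicalSpace M]
  [ChartedSpace (EuclideanSpace ℝ (Fin m)) M]
  {E : M → Type*} [TopologicalSpace (Bundle.TotalSpace (EuclideanSpace ℂ (Fin n)) E)]
  [∀ x, NormedAddCommGroup (E x)] [∀ x, InnerProductSpace ℂ (E x)]
  [FiberBundle (EuclideanSpace ℂ (Fin n)) E] [VectorBundle ℂ (EuclideanSpace ℂ (Fin n)) E]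

omit [ChartedSpace (EuclideanSpace ℝ (Fin m)) M] in
variable (n) in
lemma exists_onb {x : M} {u : Fin n → E x} (hu : Orthonormal ℂ u) :
    ∃ b : OrthonormalBasis (Fin n) ℂ (E x), ⇑b = u := by
  let e := trivializationAt (EuclideanSpace ℂ (Fin n)) E x
  let L : E x ≃L[ℂ] EuclideanSpace ℂ (Fin n) :=
    e.continuousLinearEquivAt ℂ x (mem_baseSet_trivializationAt _ _ _)
  have hf : Module.finrank ℂ (E x) = n := by
    rw [L.toLinearEquiv.finrank_eq, finrank_euclideanSpace, Fintype.card_fin]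
  have : FiniteDimensional ℂ (E x) := L.symm.toLinearEquiv.finiteDimensional
  refine ⟨OrthonormalBasis.mk hu ?_, OrthonormalBasis.coe_mk hu _⟩
  have := hu.linearIndependent.span_eq_top_of_card_eq_finrank' (by simp [hf])
  rw [this]

omit [ChartedSpace (EuclideanSpace ℝ (Fin m)) M] in
lemma eq_sum_inner {x : M} {u : Fin n → E x} (hu : Orthonormal ℂ u) (v : E x) :
    v = ∑ i, (inner ℂ (u i) v) • u i := by
  obtain ⟨b, rfl⟩ := exists_onb n hu
  exact (b.sum_repr' v).symm

omit [ChartedSpace (EuclideanSpace ℝ (Fin m)) M] in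
lemma inner_eq_sum {x : M} {u : Fin n → E x} (hu : Orthonormal ℂ u) (v w : E x) :
    inner ℂ v w = ∑ i, inner ℂ v (u i) * inner ℂ (u i) w := by
  obtain ⟨b, rfl⟩ := exists_onb n hu
  exact (b.sum_inner_mul_inner v w).symm

variable {o : BundleOrientation (m := m) n E}

lemma vol_comb (x : M) (u : Fin n → E x) (G : Matrix (Fin n) (Fin n) ℂ) :
    o.vol x (fun j => ∑ i, G i j • u i) = G.det * o.vol x u := by
  have h := AlternatingMap.eq_smul_basis_det (Pi.basisFun ℂ (Fin n))
    ((o.vol x).compLinearMap (Fintype.linearCombination ℂ u))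
  have h' := congrArg (fun f => f (fun j i => G i j)) h
  have h1 : (Matrix.of fun j i => G i j).det = G.det := Matrix.det_transpose _
  simpa [-Pi.basisFun_det, Fintype.linearCombination_apply, Pi.basisFun_det_apply,
    Pi.single_apply, ite_smul, Function.comp_def, h1, mul_comm] using h'

namespace FrameBundle

/-- The matrix of the frame `u'` in the frame `u` of the same fiber. -/
lemma exists_su_matrix {x : M} {u u' : Fin n → E x} (hu : Orthonormal ℂ u) (hv : o.vol x u = 1)
    (hu' : Orthonormal ℂ u') (hv' : o.vol x u' = 1) :
    ∃ g : Matrix.specialUnitaryGroup (Fin n) ℂ,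
      ∀ i j, (g : Matrix (Fin n) (Fin n) ℂ) i j = inner ℂ (u i) (u' j) := by
  let G : Matrix (Fin n) (Fin n) ℂ := Matrix.of fun i j => inner ℂ (u i) (u' j)
  have h1 : star G * G = 1 := by
    ext j l
    rw [Matrix.mul_apply, Matrix.one_apply, ← orthonormal_iff_ite.1 hu' j l, inner_eq_sum hu]
    refine Finset.sum_congr rfl fun i _ => ?_
    rw [Matrix.star_apply]
    change star (inner ℂ (u i) (u' j)) * inner ℂ (u i) (u' l) = _
    rw [← inner_conj_symm (u' j) (u i)]
    rfl
  have h2 : G.det = 1 := by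
    have h := vol_comb (o := o) x u G
    rw [hv, mul_one] at h
    rw [← h, ← hv']
    congr 1
    funext j
    exact (eq_sum_inner hu (u' j)).symm
  exact ⟨⟨G, Matrix.mem_specialUnitaryGroup_iff.2 ⟨Matrix.mem_unitaryGroup_iff'.2 h1, h2⟩⟩,
    fun i j => rfl⟩

lemma ext_vec {x : M} {u u' : Fin n → E x} {h1 h2 h1' h2'} (h : u = u') :
    (⟨x, u, h1, h2⟩ : FrameBundle o) = ⟨x, u', h1', h2'⟩ := by
  subst h; rfl

lemma exists_act_eq {q q' : FrameBundle o} (h : q'.base = q.base) :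
    ∃ g, q' = q.act g := by
  obtain ⟨x, u, hu, hv⟩ := q
  obtain ⟨x', u', hu', hv'⟩ := q'
  dsimp only at h
  subst h
  obtain ⟨g, hg⟩ := exists_su_matrix hu hv hu' hv'
  refine ⟨g, ext_vec (funext fun j => ?_)⟩
  simp only [hg]
  exact eq_sum_inner hu (u' j)

lemma act_one (q : FrameBundle o) : q.act 1 = q := by
  obtain ⟨x, u, hu, hv⟩ := q
  refine ext_vec (funext fun j => ?_)
  simp [Matrix.one_apply]

lemma act_act (q : FrameBundle o) (g h : Matrix.specialUnitaryGroup (Fin n) ℂ) :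
    (q.act g).act h = q.act (g * h) := by
  obtain ⟨x, u, hu, hv⟩ := q
  have key : ∀ (G H : Matrix (Fin n) (Fin n) ℂ) (j : Fin n),
      ∑ i, H i j • ∑ k, G k i • u k = ∑ k, (G * H) k j • u k := by
    intro G H j
    simp only [Finset.smul_sum, smul_smul, Matrix.mul_apply, Finset.sum_smul]
    rw [Finset.sum_comm]
    simp only [mul_comm]
  exact ext_vec (funext fun j => key g h j)

end FrameBundle

namespace LFrame

variable (Λ : LFrame o)

/-- The local coordinates of a frame. -/
def κ (q : FrameBundle o) : CoordSp m n :=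
  (Λ.φ q.base, fun i j => inner ℂ (Λ.s q.base i) (q.vec j))

/-- The value of the local frame, as a point of the frame bundle. -/
def frame (x : M) (hx : x ∈ Λ.φ.source) : FrameBundle o :=
  ⟨x, Λ.s x, Λ.orthonormal x hx, Λ.vol_eq_one x hx⟩

variable {Λ}

lemma vec_eq {q : FrameBundle o} (hq : q.base ∈ Λ.φ.source) (j : Fin n) :
    q.vec j = ∑ i, (Λ.κ q).2 i j • Λ.s q.base i :=
  eq_sum_inner (Λ.orthonormal _ hq) _

lemma κ_act (q : FrameBundle o) (g : Matrix.specialUnitaryGroup (Fin n) ℂ) :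
    Λ.κ (q.act g) = ((Λ.κ q).1, fun i j =>
      ∑ k, (Λ.κ q).2 i k * (g : Matrix (Fin n) (Fin n) ℂ) k j) := by
  refine Prod.ext rfl ?_
  funext i j
  change inner ℂ (Λ.s q.base i) (∑ k, (g : Matrix (Fin n) (Fin n) ℂ) k j • q.vec k) = _
  rw [inner_sum]
  refine Finset.sum_congr rfl fun k _ => ?_
  rw [inner_smul_right, mul_comm]
  rfl

lemma κ_frame {x : M} (hx : x ∈ Λ.φ.source) :
    Λ.κ (Λ.frame x hx) = (Λ.φ x, fun i j => if i = j then 1 else 0) := by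
  refine Prod.ext rfl ?_
  funext i j
  exact orthonormal_iff_ite.1 (Λ.orthonormal x hx) i j

lemma κ_frame_act {x : M} (hx : x ∈ Λ.φ.source) (g : Matrix.specialUnitaryGroup (Fin n) ℂ) :
    Λ.κ ((Λ.frame x hx).act g) = (Λ.φ x, (g : Matrix (Fin n) (Fin n) ℂ)) := by
  rw [κ_act, κ_frame hx]
  refine Prod.ext rfl ?_
  funext i j
  simp

lemma exists_frame_act {q : FrameBundle o} (hq : q.base ∈ Λ.φ.source) :
    ∃ g, q = (Λ.frame q.base hq).act g :=
  FrameBundle.exists_act_eq rfl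

variable (Λ) in
/-- The neighbourhoods of a frame in the local coordinates. -/
def nhd (p : FrameBundle o) : Filter (FrameBundle o) :=
  (𝓝 (Λ.κ p)).comap Λ.κ ⊓ 𝓟 {q | q.base ∈ Λ.φ.source}

/-- P carries no declared topology. Neighbourhoods are described in the ambient space of all
matrices, where a point z is allowed to be the coordinate of no frame. -/
lemma eventually_nhd {p : FrameBundle o} {P : FrameBundle o → Prop} :
    (∀ᶠ q in Λ.nhd p, P q) ↔
      ∀ᶠ z in 𝓝 (Λ.κ p), ∀ q, Λ.κ q = z → q.base ∈ Λ.φ.source → P q := by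
  rw [nhd, eventually_inf_principal, eventually_comap]
  rfl

lemma eventually_mem_source (p : FrameBundle o) : ∀ᶠ q in Λ.nhd p, q.base ∈ Λ.φ.source :=
  eventually_nhd.2 (Eventually.of_forall fun _ _ _ h => h)

lemma eventually_eventually_nhd {p : FrameBundle o} {P : FrameBundle o → Prop}
    (h : ∀ᶠ q in Λ.nhd p, P q) : ∀ᶠ q in Λ.nhd p, ∀ᶠ q' in Λ.nhd q, P q' := by
  rw [eventually_nhd] at h ⊢
  filter_upwards [h.eventually_nhds] with z hz q hq _
  rw [eventually_nhd, hq]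
  exact hz

lemma eventually_self {p : FrameBundle o} (hp : p.base ∈ Λ.φ.source) {P : FrameBundle o → Prop}
    (h : ∀ᶠ q in Λ.nhd p, P q) : P p :=
  (eventually_nhd.1 h).self_of_nhds p rfl hp

lemma tendsto_κ (p : FrameBundle o) : Tendsto Λ.κ (Λ.nhd p) (𝓝 (Λ.κ p)) :=
  tendsto_comap.mono_left inf_le_left

lemma tendsto_base {p : FrameBundle o} (hp : p.base ∈ Λ.φ.source) :
    Tendsto FrameBundle.base (Λ.nhd p) (𝓝 p.base) := by
  have h1 : Tendsto (fun q => Λ.φ.symm (Λ.κ q).1) (Λ.nhd p) (𝓝 (Λ.φ.symm (Λ.φ p.base))) :=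
    ((Λ.φ.continuousAt_symm (Λ.φ.map_source hp)).tendsto.comp
      (continuous_fst.tendsto (Λ.κ p))).comp (tendsto_κ p)
  rw [Λ.φ.left_inv hp] at h1
  refine h1.congr' ?_
  filter_upwards [eventually_mem_source p] with q hq
  exact Λ.φ.left_inv hq

lemma tendsto_nhd {α : Type*} {l : Filter α} {c : α → FrameBundle o} {p : FrameBundle o}
    (h1 : Tendsto (fun t => Λ.κ (c t)) l (𝓝 (Λ.κ p))) (h2 : ∀ᶠ t in l, (c t).base ∈ Λ.φ.source) :
    Tendsto c l (Λ.nhd p) :=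
  tendsto_inf.2 ⟨tendsto_comap_iff.2 h1, tendsto_principal.2 h2⟩

end LFrame

end FrameCoordinates

end DerCalc

end

noncomputable section

namespace DerCalc

open Filter Topology

/-! ### Smooth functions on the frame bundle as germs of functions of the coordinates. -/

section SmoothNear

variable {V W F : Type*} [NormedAddCommGroup V] [NormedSpace ℝ V] [NormedAddCommGroup W]
  [NormedSpace ℝ W] [NormedAddCommGroup F] [NormedSpace ℝ F]

/-- `H` is smooth in a neighbourhood of `z`. -/
def SmoothNear (H : V → F) (z : V) : Prop := ∀ᶠ y in 𝓝 z, ContDiffAt ℝ ∞ H y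

lemma ContDiff.smoothNear {H : V → F} (h : ContDiff ℝ ∞ H) (z : V) : SmoothNear H z :=
  Eventually.of_forall fun _ => h.contDiffAt

lemma SmoothNear.comp_right {H : V → F} {K : W → V} {z : W} (hH : SmoothNear H (K z))
    (hK : SmoothNear K z) : SmoothNear (fun y => H (K y)) z := by
  filter_upwards [hK, (hK.self_of_nhds.continuousAt).eventually hH] with y h1 h2
  exact h2.comp y h1

lemma SmoothNear.comp_left {G : F → W} {H : V → F} {z : V} (hG : ContDiff ℝ ∞ G)
    (hH : SmoothNear H z) : SmoothNear (fun y => G (H y)) z := by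
  filter_upwards [hH] with y h
  exact hG.contDiffAt.comp y h

lemma SmoothNear.prodMk {H : V → F} {K : V → W} {z : V} (hH : SmoothNear H z)
    (hK : SmoothNear K z) : SmoothNear (fun y => (H y, K y)) z := by
  filter_upwards [hH, hK] with y h1 h2
  exact h1.prodMk h2

lemma SmoothNear.mul {H K : V → ℂ} {z : V} (hH : SmoothNear H z) (hK : SmoothNear K z) :
    SmoothNear (fun y => H y * K y) z :=
  (hH.prodMk hK).comp_left (contDiff_mul (𝕜 := ℝ) (𝔸 := ℂ))

lemma SmoothNear.sum {ι : Type*} {s : Finset ι} {H : ι → V → F} {z : V}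
    (h : ∀ i ∈ s, SmoothNear (H i) z) : SmoothNear (fun y => ∑ i ∈ s, H i y) z := by
  have := (Filter.eventually_all_finset s).2 h
  filter_upwards [this] with y hy
  exact ContDiffAt.sum fun i hi => hy i hi

/-- Multiply by a bump function supported within half the radius of the ball where H is smooth.
Globally defined representatives are what Hadamard's lemma takes. -/
lemma SmoothNear.exists_contDiff [FiniteDimensional ℝ V] {H : V → F} {z : V}
    (h : SmoothNear H z) : ∃ G : V → F, ContDiff ℝ ∞ G ∧ G =ᶠ[𝓝 z] H := by
  obtain ⟨ε, hε, hH⟩ := Metric.eventually_nhds_iff_ball.1 h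
  let b : ContDiffBump z := ⟨ε / 4, ε / 2, by positivity, by linarith⟩
  refine ⟨fun y => b y • H y, ?_, ?_⟩
  · rw [contDiff_iff_contDiffAt]
    intro y
    by_cases hy : dist y z < ε
    · exact (b.contDiff.contDiffAt).smul (hH y hy)
    · have h1 : y ∉ tsupport b := by
        rw [b.tsupport_eq, Metric.mem_closedBall]
        change ¬ dist y z ≤ ε / 2
        linarith
      have h2 : (fun y => b y • H y) =ᶠ[𝓝 y] fun _ => 0 := by
        filter_upwards [notMem_tsupport_iff_eventuallyEq.1 h1] with w hw
        rw [hw]; simp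
      exact contDiffAt_const.congr_of_eventuallyEq h2
  · filter_upwards [b.eventuallyEq_one] with w hw
    rw [hw]; simp

end SmoothNear

section SmoothFunctions

variable {m n : ℕ} {M : Type*} [TopologicalSpace M]
  [ChartedSpace (EuclideanSpace ℝ (Fin m)) M] [IsManifold (𝓡 m) ∞ M]
  {E : M → Type*} [TopologicalSpace (Bundle.TotalSpace (EuclideanSpace ℂ (Fin n)) E)]
  [∀ x, NormedAddCommGroup (E x)] [∀ x, InnerProductSpace ℂ (E x)]
  [FiberBundle (EuclideanSpace ℂ (Fin n)) E] [VectorBundle ℂ (EuclideanSpace ℂ (Fin n)) E]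
  {o : BundleOrientation (m := m) n E}
  {F : Type*} [NormedAddCommGroup F] [NormedSpace ℝ F]

lemma LFrame.contMDiffOn_comp_symm (Λ : LFrame o) {U : Set M} {h : M → F}
    (hh : ContMDiffOn (𝓡 m) 𝓘(ℝ, F) ∞ h U) :
    ContMDiffOn (𝓡 m) 𝓘(ℝ, F) ∞ (fun y => h (Λ.φ.symm y)) (Λ.φ.target ∩ Λ.φ.symm ⁻¹' U) :=
  hh.comp ((contMDiffOn_symm_of_mem_maximalAtlas Λ.mem).mono Set.inter_subset_left)
    Set.inter_subset_right

lemma LFrame.smoothNear_comp_symm (Λ : LFrame o) {x : M} {U : Set M} (hU : IsOpen U)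
    (hx : x ∈ Λ.φ.source) (hxU : x ∈ U) {h : M → F}
    (hh : ContMDiffOn (𝓡 m) 𝓘(ℝ, F) ∞ h U) :
    SmoothNear (fun y => h (Λ.φ.symm y)) (Λ.φ x) := by
  have h1 := Λ.contMDiffOn_comp_symm hh
  have h2 : IsOpen (Λ.φ.target ∩ Λ.φ.symm ⁻¹' U) := Λ.φ.isOpen_inter_preimage_symm hU
  have h3 : Λ.φ x ∈ Λ.φ.target ∩ Λ.φ.symm ⁻¹' U :=
    ⟨Λ.φ.map_source hx, by rwa [Set.mem_preimage, Λ.φ.left_inv hx]⟩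
  filter_upwards [h2.mem_nhds h3] with y hy
  exact (contMDiffOn_iff_contDiffOn.1 h1).contDiffAt (h2.mem_nhds hy)

lemma LFrame.smoothNear_base (Λ : LFrame o) {p : FrameBundle o} {U : Set M} (hU : IsOpen U)
    (hp : p.base ∈ Λ.φ.source) (hpU : p.base ∈ U) {h : M → F}
    (hh : ContMDiffOn (𝓡 m) 𝓘(ℝ, F) ∞ h U) :
    SmoothNear (fun z : CoordSp m n => h (Λ.φ.symm z.1)) (Λ.κ p) :=
  SmoothNear.comp_right (H := fun y => h (Λ.φ.symm y)) (K := fun z : CoordSp m n => z.1)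
    (z := Λ.κ p) (Λ.smoothNear_comp_symm hU hp hpU hh)
    (ContDiff.smoothNear contDiff_fst _)

omit [IsManifold (𝓡 m) ∞ M] in
lemma FrameBundle.coord_snd {e : Bundle.Trivialization (EuclideanSpace ℂ (Fin n))
      (Bundle.TotalSpace.proj : Bundle.TotalSpace (EuclideanSpace ℂ (Fin n)) E → M)}
    [MemTrivializationAtlas e] {q : FrameBundle o} (hq : q.base ∈ e.baseSet) (k : Fin n) :
    (q.coord e).2 k = e.continuousLinearMapAt ℂ q.base (q.vec k) := by
  rw [e.continuousLinearMapAt_apply ℂ, e.coe_linearMapAt_of_mem hq]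
  rfl

/-- Smoothness is defined through all trivializations, but a single local frame at each point
suffices to test it, since the change of coordinates is smooth on an open set of the ambient space.
-/
lemma mem_smoothFun_of_germ {f : FrameBundle o → ℂ} [IsSmoothHermitianBundle (m := m) n E]
    (hf : ∀ p : FrameBundle o, ∃ Λ : LFrame o, p.base ∈ Λ.φ.source ∧
      ∃ H : CoordSp m n → ℂ, SmoothNear H (Λ.κ p) ∧ ∀ᶠ q in Λ.nhd p, f q = H (Λ.κ q)) :
    f ∈ SmoothFun o := by
  intro e _ p hp
  obtain ⟨Λ, hpΛ, H, hH, hfH⟩ := hf p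
  obtain ⟨D, hD, hDo, hpD⟩ := eventually_nhds_iff.1 (hH.and (LFrame.eventually_nhd.1 hfH))
  -- K computes the coordinates of a frame from its components in e. It is linear in the vectors and
  -- so makes sense for tuples that are not frames.
  let K : M × (Fin n → EuclideanSpace ℂ (Fin n)) → CoordSp m n := fun z =>
    (Λ.φ z.1, fun i j => ∑ l, (z.2 j) l * inner ℂ (Λ.s z.1 i) (trivFrame e z.1 l))
  let S : Set (M × (Fin n → EuclideanSpace ℂ (Fin n))) :=
    Prod.fst ⁻¹' (Λ.φ.source ∩ e.baseSet)
  have hS : IsOpen S := (Λ.φ.open_source.inter e.open_baseSet).preimage continuous_fst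
  have hK : ContMDiffOn ((𝓡 m).prod 𝓘(ℝ, Fin n → EuclideanSpace ℂ (Fin n)))
      𝓘(ℝ, CoordSp m n) ∞ K S := by
    refine ContMDiffOn.prodMk_space ?_ ?_
    · exact ((contMDiffOn_of_mem_maximalAtlas Λ.mem).mono Set.inter_subset_left).comp
        contMDiffOn_fst subset_rfl
    · refine contMDiffOn_pi_space.2 fun i => contMDiffOn_pi_space.2 fun j => ?_
      refine contMDiffOn_finsetSum fun l _ => ?_
      have h1 : ContMDiffOn (𝓡 m) 𝓘(ℝ, ℂ) ∞ (fun x => inner ℂ (Λ.s x i) (trivFrame e x l))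
          (Λ.φ.source ∩ e.baseSet) :=
        (Λ.smooth e i).contMDiffOn_inner
          ((smoothSec_trivFrame e l).mono Set.inter_subset_right) Set.inter_subset_right
      have h2 : ContMDiffOn ((𝓡 m).prod 𝓘(ℝ, Fin n → EuclideanSpace ℂ (Fin n))) 𝓘(ℝ, ℂ) ∞
          (fun z : M × (Fin n → EuclideanSpace ℂ (Fin n)) =>
            inner ℂ (Λ.s z.1 i) (trivFrame e z.1 l)) S := h1.comp contMDiffOn_fst subset_rfl
      have h3 : ContMDiffOn ((𝓡 m).prod 𝓘(ℝ, Fin n → EuclideanSpace ℂ (Fin n))) 𝓘(ℝ, ℂ) ∞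
          (fun z : M × (Fin n → EuclideanSpace ℂ (Fin n)) => (z.2 j) l) S := by
        have h4 : ContDiff ℝ ∞ (fun v : Fin n → EuclideanSpace ℂ (Fin n) => (v j) l) :=
          ((EuclideanSpace.proj (𝕜 := ℂ) l).restrictScalars ℝ).contDiff.comp
            (contDiff_apply ℝ (EuclideanSpace ℂ (Fin n)) j)
        exact h4.contMDiff.comp_contMDiffOn contMDiffOn_snd
      exact (contDiff_mul (𝕜 := ℝ) (𝔸 := ℂ)).contMDiff.comp_contMDiffOn (h3.prodMk_space h2)
  have hKq : ∀ q : FrameBundle o, q.base ∈ e.baseSet → K (q.coord e) = Λ.κ q := by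
    intro q hq
    refine Prod.ext rfl ?_
    funext i j
    change ∑ l, ((q.coord e).2 j) l * inner ℂ (Λ.s q.base i) (trivFrame e q.base l) =
      inner ℂ (Λ.s q.base i) (q.vec j)
    conv_rhs => rw [eq_sum_trivFrame e hq (q.vec j)]
    rw [inner_sum]
    refine Finset.sum_congr rfl fun l _ => ?_
    rw [inner_smul_right, FrameBundle.coord_snd hq]
  refine ⟨S ∩ K ⁻¹' D, H ∘ K, hK.continuousOn.isOpen_inter_preimage hS hDo,
    ⟨⟨hpΛ, hp⟩, ?_⟩, ?_, ?_⟩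
  · rw [Set.mem_preimage, hKq p hp]
    exact hpD
  · intro z hz
    exact ((hD _ hz.2).1.contMDiffAt).comp_contMDiffWithinAt z
      ((hK z hz.1).mono Set.inter_subset_left)
  · intro q hq hqW
    have h1 := hKq q hq
    have h2 : Λ.κ q ∈ D := by rw [← h1]; exact hqW.2
    rw [Function.comp, h1]
    exact (hD _ h2).2 q rfl hqW.1.1

/-- The passage opposite to `mem_smoothFun_of_germ`: the map G from matrix coordinates to components
in a trivialization is smooth for all matrices, unitary or not. The extension H off the unitary ones
is not canonical. -/
lemma exists_germ (f : SmoothFun o) {Λ : LFrame o} {p : FrameBundle o}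
    (hp : p.base ∈ Λ.φ.source) :
    ∃ H : CoordSp m n → ℂ, ContDiff ℝ ∞ H ∧ ∀ᶠ q in Λ.nhd p, f.1 q = H (Λ.κ q) := by
  let e := trivializationAt (EuclideanSpace ℂ (Fin n)) E p.base
  have hpe : p.base ∈ e.baseSet := mem_baseSet_trivializationAt _ _ _
  obtain ⟨W, h, hW, hpW, hh, hfh⟩ := f.2 e p hpe
  let D₀ : Set (EuclideanSpace ℝ (Fin m)) :=
    Λ.φ.target ∩ Λ.φ.symm ⁻¹' (Λ.φ.source ∩ e.baseSet)
  have hD₀ : IsOpen D₀ := Λ.φ.isOpen_inter_preimage_symm (Λ.φ.open_source.inter e.open_baseSet)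
  let S : Set (CoordSp m n) := Prod.fst ⁻¹' D₀
  have hS : IsOpen S := hD₀.preimage continuous_fst
  let G : CoordSp m n → M × (Fin n → EuclideanSpace ℂ (Fin n)) := fun z =>
    (Λ.φ.symm z.1, fun j => ∑ i, z.2 i j •
      e.continuousLinearMapAt ℂ (Λ.φ.symm z.1) (Λ.s (Λ.φ.symm z.1) i))
  have hfst : ContMDiffOn 𝓘(ℝ, CoordSp m n) (𝓡 m) ∞ (Prod.fst : CoordSp m n → _) S :=
    contDiff_fst.contMDiff.contMDiffOn
  have hG : ContMDiffOn 𝓘(ℝ, CoordSp m n)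
      ((𝓡 m).prod 𝓘(ℝ, Fin n → EuclideanSpace ℂ (Fin n))) ∞ G S := by
    refine ContMDiffOn.prodMk ?_ ?_
    · exact ((contMDiffOn_symm_of_mem_maximalAtlas Λ.mem).mono Set.inter_subset_left).comp
        hfst subset_rfl
    · refine contMDiffOn_pi_space.2 fun j => contMDiffOn_finsetSum fun i _ => ?_
      have h1 : ContMDiffOn 𝓘(ℝ, CoordSp m n) 𝓘(ℝ, EuclideanSpace ℂ (Fin n)) ∞
          (fun z : CoordSp m n =>
            e.continuousLinearMapAt ℂ (Λ.φ.symm z.1) (Λ.s (Λ.φ.symm z.1) i)) S :=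
        (Λ.contMDiffOn_comp_symm (Λ.smooth e i)).comp hfst subset_rfl
      have h2 : ContMDiffOn 𝓘(ℝ, CoordSp m n) 𝓘(ℝ, ℂ) ∞ (fun z : CoordSp m n => z.2 i j) S :=
        ((contDiff_apply_apply ℝ ℂ i j).comp contDiff_snd).contMDiff.contMDiffOn
      exact (contDiff_smul (𝕜 := ℝ) (𝕜' := ℂ)).contMDiff.comp_contMDiffOn (h2.prodMk_space h1)
  have hGq : ∀ q : FrameBundle o, q.base ∈ Λ.φ.source → q.base ∈ e.baseSet →
      G (Λ.κ q) = q.coord e := by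
    intro q hq hqe
    have h0 : Λ.φ.symm (Λ.κ q).1 = q.base := Λ.φ.left_inv hq
    refine Prod.ext h0 ?_
    funext j
    change ∑ i, (Λ.κ q).2 i j • e.continuousLinearMapAt ℂ (Λ.φ.symm (Λ.κ q).1)
      (Λ.s (Λ.φ.symm (Λ.κ q).1) i) = _
    rw [h0, FrameBundle.coord_snd hqe, LFrame.vec_eq hq j, map_sum]
    simp only [map_smul]
  have hp0 : Λ.κ p ∈ S ∩ G ⁻¹' W := by
    refine ⟨⟨Λ.φ.map_source hp, ?_⟩, ?_⟩
    · change Λ.φ.symm (Λ.φ p.base) ∈ Λ.φ.source ∩ e.baseSet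
      rw [Λ.φ.left_inv hp]
      exact ⟨hp, hpe⟩
    · rw [Set.mem_preimage, hGq p hp hpe]
      exact hpW
  have hopen : IsOpen (S ∩ G ⁻¹' W) := hG.continuousOn.isOpen_inter_preimage hS hW
  have hsm : SmoothNear (h ∘ G) (Λ.κ p) := by
    filter_upwards [hopen.mem_nhds hp0] with z hz
    have h1 : ContMDiffOn 𝓘(ℝ, CoordSp m n) 𝓘(ℝ, ℂ) ∞ (h ∘ G) (S ∩ G ⁻¹' W) :=
      hh.comp (hG.mono Set.inter_subset_left) Set.inter_subset_right
    exact (contMDiffOn_iff_contDiffOn.1 h1).contDiffAt (hopen.mem_nhds hz)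
  obtain ⟨H, hH, hHG⟩ := hsm.exists_contDiff
  refine ⟨H, hH, ?_⟩
  filter_upwards [LFrame.eventually_mem_source p, (LFrame.tendsto_κ p).eventually hHG,
    (LFrame.tendsto_κ p).eventually (hopen.mem_nhds hp0),
    (LFrame.tendsto_base hp).eventually (e.open_baseSet.mem_nhds hpe)] with q h1 h2 h3 h4
  rw [h2, Function.comp, hGq q h1 h4]
  refine hfh q h4 ?_
  rw [← hGq q h1 h4]
  exact h3.2

end SmoothFunctions

end DerCalc

end

noncomputable section

namespace DerCalc

open Filter Topology

/-! ### Cutoff functions, and sections of End(E) as equivariant functions. -/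

section Cutoff

variable {m : ℕ} {M : Type*} [TopologicalSpace M] [T2Space M] [SecondCountableTopology M]
  [ChartedSpace (EuclideanSpace ℝ (Fin m)) M] [IsManifold (𝓡 m) ∞ M]

lemma exists_cutoff {K O : Set M} (hK : IsClosed K) (hO : IsOpen O) (h : K ⊆ O) :
    ∃ χ : M → ℝ, ContMDiff (𝓡 m) 𝓘(ℝ, ℝ) ∞ χ ∧ (∀ x ∈ K, ∀ᶠ y in 𝓝 x, χ y = 1) ∧
      tsupport χ ⊆ O := by
  have h1 : LocallyCompactSpace M := ChartedSpace.locallyCompactSpace (EuclideanSpace ℝ (Fin m)) M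
  have h2 : SigmaCompactSpace M := inferInstance
  have h3 : NormalSpace M := inferInstance
  -- An intermediate open set keeps the closed support inside O, and not only the set where χ is
  -- nonzero.
  obtain ⟨u, hu, hKu, huO⟩ := normal_exists_closure_subset hK hO h
  obtain ⟨f, hf1, hf0, -⟩ := exists_contMDiffMap_one_nhds_of_subset_interior (n := ⊤) (𝓡 m) hK
    (hKu.trans (hu.subset_interior_iff.2 subset_rfl))
  refine ⟨f, f.contMDiff, fun x hx => ?_, ?_⟩
  · exact hf1.filter_mono (nhds_le_nhdsSet hx)
  · refine (closure_mono fun x hx => ?_).trans huO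
    by_contra hxu
    exact hx (hf0 x hxu)

end Cutoff

section Evaluation

variable {m n : ℕ} {M : Type*} [TopologicalSpace M]
  [ChartedSpace (EuclideanSpace ℝ (Fin m)) M]
  {E : M → Type*} [TopologicalSpace (Bundle.TotalSpace (EuclideanSpace ℂ (Fin n)) E)]
  [∀ x, NormedAddCommGroup (E x)] [∀ x, InnerProductSpace ℂ (E x)]
  [FiberBundle (EuclideanSpace ℂ (Fin n)) E] [VectorBundle ℂ (EuclideanSpace ℂ (Fin n)) E]
  {o : BundleOrientation (m := m) n E}

/-- Evaluation of smooth functions at a frame. -/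
def pointEval (p : FrameBundle o) : SmoothFun o →ₐ[ℂ] ℂ :=
  (Pi.evalAlgHom ℂ (fun _ : FrameBundle o => ℂ) p).comp (SmoothFun o).val

/-- Evaluation of matrix valued functions at a frame, as a homomorphism. -/
def evalHom (p : FrameBundle o) : MatAlg o →ₐ[ℂ] Matrix (Fin n) (Fin n) ℂ :=
  (pointEval p).mapMatrix

lemma evalHom_apply (p : FrameBundle o) (b : MatAlg o) : evalHom p b = evalAt b p := rfl

lemma evalHom_apply_apply (p : FrameBundle o) (b : MatAlg o) (i j : Fin n) :
    evalHom p b i j = (b i j).1 p := rfl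

lemma matAlg_ext {b b' : MatAlg o} (h : ∀ p, evalHom p b = evalHom p b') : b = b' := by
  ext i j p
  exact congrFun (congrFun (h p) i) j

/-- The matrix valued functions that represent sections of `End E`. -/
def Equivariant (b : MatAlg o) : Prop :=
  ∀ (p : FrameBundle o) (g : Matrix.specialUnitaryGroup (Fin n) ℂ), evalHom (p.act g) b = star (g : Matrix (Fin n) (Fin n) ℂ) * evalHom p b * g

omit [FiberBundle (EuclideanSpace ℂ (Fin n)) E] [VectorBundle ℂ (EuclideanSpace ℂ (Fin n)) E] in
lemma inner_comb {x : M} (T : E x →L[ℂ] E x) (u : Fin n → E x) (G : Matrix (Fin n) (Fin n) ℂ)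
    (i j : Fin n) :
    inner ℂ (∑ r, G r i • u r) (T (∑ s, G s j • u s)) =
      (star G * (Matrix.of fun r s => inner ℂ (u r) (T (u s))) * G) i j := by
  simp only [map_sum, map_smul, sum_inner, inner_sum, inner_smul_left, inner_smul_right,
    Matrix.mul_apply, Matrix.of_apply, Matrix.star_apply, Finset.sum_mul]
  refine Finset.sum_congr rfl fun s _ => ?_
  rw [Finset.mul_sum]
  refine Finset.sum_congr rfl fun r _ => ?_
  rw [Complex.star_def]
  ring

end Evaluation

section Representation

variable {m n : ℕ} {M : Type*} [TopologicalSpace M]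
  [ChartedSpace (EuclideanSpace ℝ (Fin m)) M] [IsManifold (𝓡 m) ∞ M]
  {E : M → Type*} [TopologicalSpace (Bundle.TotalSpace (EuclideanSpace ℂ (Fin n)) E)]
  [∀ x, NormedAddCommGroup (E x)] [∀ x, InnerProductSpace ℂ (E x)]
  [FiberBundle (EuclideanSpace ℂ (Fin n)) E] [VectorBundle ℂ (EuclideanSpace ℂ (Fin n)) E]
  [IsSmoothHermitianBundle (m := m) n E]
  {o : BundleOrientation (m := m) n E}

omit [IsManifold (𝓡 m) ∞ M] [IsSmoothHermitianBundle (m := m) n E] in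
lemma SmoothSec.endo {e : Bundle.Trivialization (EuclideanSpace ℂ (Fin n))
      (Bundle.TotalSpace.proj : Bundle.TotalSpace (EuclideanSpace ℂ (Fin n)) E → M)}
    [MemTrivializationAtlas e] {U : Set M} (hU : U ⊆ e.baseSet) (a : EndAlg (m := m) n E)
    {σ : ∀ x, E x} (hσ : SmoothSec m e U σ) : SmoothSec m e U (fun x => a.1 x (σ x)) := by
  have hc : ContDiff ℝ ∞ (fun p : (EuclideanSpace ℂ (Fin n) →L[ℂ] EuclideanSpace ℂ (Fin n)) ×
      EuclideanSpace ℂ (Fin n) => p.1 p.2) :=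
    (ContDiff.restrict_scalars ℝ (𝕜' := ℂ) (isBoundedBilinearMap_apply (𝕜 := ℂ)).contDiff)
  refine (hc.contMDiff.comp_contMDiffOn
    (((a.2 e).mono hU).prodMk_space hσ)).congr fun x hx => ?_
  exact congrArg (fun w => e.continuousLinearMapAt ℂ x (a.1 x w))
    (e.symmL_continuousLinearMapAt (R := ℂ) (hU hx) (σ x)).symm

lemma smoothNear_coord (i j : Fin n) (z : CoordSp m n) :
    SmoothNear (fun z : CoordSp m n => z.2 i j) z :=
  ContDiff.smoothNear ((contDiff_apply_apply ℝ ℂ i j).comp contDiff_snd) z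

lemma smoothNear_coord_conj (i j : Fin n) (z : CoordSp m n) :
    SmoothNear (fun z : CoordSp m n => (starRingEnd ℂ) (z.2 i j)) z :=
  (smoothNear_coord i j z).comp_left (Complex.conjCLE.contDiff (n := ∞))

lemma inner_endo_mem [NeZero n] (a : EndAlg (m := m) n E) (i j : Fin n) :
    (fun q : FrameBundle o => inner ℂ (q.vec i) (a.1 q.base (q.vec j))) ∈ SmoothFun o := by
  refine mem_smoothFun_of_germ fun p => ?_
  obtain ⟨Λ, hp⟩ := LFrame.exists_mem o p.base
  let e := trivializationAt (EuclideanSpace ℂ (Fin n)) E p.base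
  have hpe : p.base ∈ e.baseSet := mem_baseSet_trivializationAt _ _ _
  have hN : ∀ r s, ContMDiffOn (𝓡 m) 𝓘(ℝ, ℂ) ∞
      (fun x => inner ℂ (Λ.s x r) (a.1 x (Λ.s x s))) (Λ.φ.source ∩ e.baseSet) := fun r s =>
    (Λ.smooth e r).contMDiffOn_inner ((Λ.smooth e s).endo Set.inter_subset_right a)
      Set.inter_subset_right
  refine ⟨Λ, hp, fun z => ∑ s, ∑ r, (starRingEnd ℂ) (z.2 r i) *
    inner ℂ (Λ.s (Λ.φ.symm z.1) r) (a.1 (Λ.φ.symm z.1) (Λ.s (Λ.φ.symm z.1) s)) * z.2 s j, ?_, ?_⟩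
  · exact SmoothNear.sum fun s _ => SmoothNear.sum fun r _ =>
      ((smoothNear_coord_conj r i _).mul (Λ.smoothNear_base
        (Λ.φ.open_source.inter e.open_baseSet) hp ⟨hp, hpe⟩ (hN r s))).mul
        (smoothNear_coord s j _)
  · filter_upwards [LFrame.eventually_mem_source p] with q hq
    have h0 : Λ.φ.symm (Λ.κ q).1 = q.base := Λ.φ.left_inv hq
    rw [h0, LFrame.vec_eq hq i, LFrame.vec_eq hq j]
    refine (inner_comb (a.1 q.base) (Λ.s q.base) (Matrix.of (Λ.κ q).2) i j).trans ?_
    simp only [Matrix.mul_apply, Matrix.of_apply, Matrix.star_apply, Finset.sum_mul]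
    rfl

variable (o) in
/-- The homomorphism that assigns to a section of `End E` its matrices in all frames. -/
def repHom [NeZero n] : EndAlg (m := m) n E →ₐ[ℂ] MatAlg o :=
  AlgHom.ofLinearMap
    { toFun := fun a => Matrix.of fun i j => ⟨_, inner_endo_mem a i j⟩
      map_add' := by
        intro a b
        ext i j q
        exact inner_add_right _ _ _
      map_smul' := by
        intro c a
        ext i j q
        exact inner_smul_right _ _ _ }
    (by
      refine matAlg_ext fun p => Eq.trans ?_ (map_one (evalHom p)).symm
      ext i j
      rw [Matrix.one_apply]
      exact orthonormal_iff_ite.1 p.orthonormal i j)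
    (by
      intro a b
      refine matAlg_ext fun p => Eq.trans ?_ (map_mul (evalHom p) _ _).symm
      ext i j
      rw [Matrix.mul_apply]
      have h := eq_sum_inner p.orthonormal (b.1 p.base (p.vec j))
      change inner ℂ (p.vec i) (a.1 p.base (b.1 p.base (p.vec j))) =
        ∑ k, inner ℂ (p.vec i) (a.1 p.base (p.vec k)) * inner ℂ (p.vec k) (b.1 p.base (p.vec j))
      conv_lhs => rw [h]
      rw [map_sum, inner_sum]
      refine Finset.sum_congr rfl fun k _ => ?_
      rw [map_smul, inner_smul_right, mul_comm])

lemma evalHom_repHom [NeZero n] (a : EndAlg (m := m) n E) (p : FrameBundle o) (i j : Fin n) :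
    evalHom p (repHom o a) i j = inner ℂ (p.vec i) (a.1 p.base (p.vec j)) := rfl

lemma equivariant_repHom [NeZero n] (a : EndAlg (m := m) n E) : Equivariant (repHom o a) := by
  intro p g
  ext i j
  exact inner_comb (a.1 p.base) p.vec g i j

lemma endo_ext {x : M} {S T : E x →L[ℂ] E x} {u : Fin n → E x} (hu : Orthonormal ℂ u)
    (h : ∀ i j, inner ℂ (u i) (S (u j)) = inner ℂ (u i) (T (u j))) : S = T := by
  ext v
  rw [eq_sum_inner hu v, map_sum, map_sum]
  refine Finset.sum_congr rfl fun j _ => ?_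
  rw [map_smul, map_smul, eq_sum_inner hu (S (u j)), eq_sum_inner hu (T (u j))]
  simp only [h]

variable (o) in
lemma exists_base_eq [NeZero n] (x : M) : ∃ p : FrameBundle o, p.base = x := by
  obtain ⟨Λ, hx⟩ := LFrame.exists_mem o x
  exact ⟨Λ.frame x hx, rfl⟩

lemma repHom_injective [NeZero n] : Function.Injective (repHom (E := E) o) := by
  intro a b h
  refine Subtype.ext (funext fun x => ?_)
  obtain ⟨p, rfl⟩ := exists_base_eq o x
  refine endo_ext p.orthonormal fun i j => ?_
  rw [← evalHom_repHom, ← evalHom_repHom, h]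

omit [IsManifold (𝓡 m) ∞ M] [IsSmoothHermitianBundle (m := m) n E] in
lemma contMDiffAt_clm {T : M → EuclideanSpace ℂ (Fin n) →L[ℂ] EuclideanSpace ℂ (Fin n)} {x₀ : M}
    (h : ∀ k l, ContMDiffAt (𝓡 m) 𝓘(ℝ, ℂ) ∞ (fun x => T x (EuclideanSpace.single k 1) l) x₀) :
    ContMDiffAt (𝓡 m) 𝓘(ℝ, EuclideanSpace ℂ (Fin n) →L[ℂ] EuclideanSpace ℂ (Fin n)) ∞ T x₀ := by
  have h1 : T = fun x => ∑ k, ∑ l, T x (EuclideanSpace.single k 1) l •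
      (EuclideanSpace.proj (𝕜 := ℂ) k : EuclideanSpace ℂ (Fin n) →L[ℂ] ℂ).smulRight
        (EuclideanSpace.single l (1 : ℂ)) := by
    funext x
    ext v l
    have hv : v = ∑ k, v k • EuclideanSpace.single k (1 : ℂ) := by
      ext i
      simp [Pi.single_apply]
    conv_lhs => rw [hv]
    simp [Pi.single_apply, mul_comm]
  rw [h1]
  refine contMDiffAt_finsetSum fun k _ => contMDiffAt_finsetSum fun l _ => ?_
  exact (contDiff_smul (𝕜 := ℝ) (𝕜' := ℂ)).contMDiff.contMDiffAt.comp x₀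
    ((h k l).prodMk_space contMDiffAt_const)

/-- The endomorphism of a fiber with a given matrix in an orthonormal frame. -/
def endoOfMatrix {x : M} (u : Fin n → E x) (N : Matrix (Fin n) (Fin n) ℂ) : E x →L[ℂ] E x :=
  ∑ i, ∑ j, N i j • (innerSL ℂ (u j)).smulRight (u i)

omit [IsManifold (𝓡 m) ∞ M] [IsSmoothHermitianBundle (m := m) n E]
  [ChartedSpace (EuclideanSpace ℝ (Fin m)) M] in
lemma inner_endoOfMatrix {x : M} {u : Fin n → E x} (hu : Orthonormal ℂ u)
    (N : Matrix (Fin n) (Fin n) ℂ) (i j : Fin n) :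
    inner ℂ (u i) (endoOfMatrix u N (u j)) = N i j := by
  simp [endoOfMatrix, inner_sum, inner_smul_right, orthonormal_iff_ite.1 hu]

/-- Define the endomorphism of a fibre by the matrix of b at one chosen frame. Equivariance and
transitivity of SU(n) on the frames of the fibre make the choice irrelevant, and near x₀ a fixed
smooth local frame may be used instead. -/
lemma exists_repHom_eq [NeZero n] {b : MatAlg o} (hb : Equivariant b) :
    ∃ a : EndAlg (m := m) n E, repHom o a = b := by
  choose Λ hΛ using fun x => LFrame.exists_mem o x
  let a : ∀ x, E x →L[ℂ] E x := fun x =>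
    endoOfMatrix ((Λ x).s x) (evalHom ((Λ x).frame x (hΛ x)) b)
  have ha : ∀ (q : FrameBundle o) (i j : Fin n),
      inner ℂ (q.vec i) (a q.base (q.vec j)) = evalHom q b i j := by
    intro q i j
    obtain ⟨g, hg⟩ := LFrame.exists_frame_act (hΛ q.base)
    have h1 : ∀ k, q.vec k = ∑ r, (g : Matrix (Fin n) (Fin n) ℂ) r k • (Λ q.base).s q.base r := by
      intro k
      rw [LFrame.vec_eq (hΛ q.base) k]
      have h2 : (Λ q.base).κ q = (Λ q.base).κ (((Λ q.base).frame q.base (hΛ q.base)).act g) :=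
        congrArg _ hg
      rw [h2, LFrame.κ_frame_act]
    rw [h1 i, h1 j]
    refine (inner_comb (a q.base) ((Λ q.base).s q.base) g i j).trans ?_
    have h3 : (Matrix.of fun r s => inner ℂ ((Λ q.base).s q.base r)
        (a q.base ((Λ q.base).s q.base s))) = evalHom ((Λ q.base).frame q.base (hΛ q.base)) b := by
      ext r s
      exact inner_endoOfMatrix ((Λ q.base).orthonormal _ (hΛ q.base)) _ r s
    rw [h3, ← hb, ← hg]
  refine ⟨⟨a, ?_⟩, matAlg_ext fun q => Matrix.ext fun i j => ha q i j⟩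
  intro e _ x₀ hx₀
  refine ContMDiffAt.contMDiffWithinAt (contMDiffAt_clm fun k l => ?_)
  let Λ₀ := Λ x₀
  let p₀ := Λ₀.frame x₀ (hΛ x₀)
  choose H hH hbH using fun i j => exists_germ (b i j) (p := p₀) (hΛ x₀)
  -- Along the local frame itself the matrix coordinate is constantly 1, so the entries of b become
  -- smooth functions of the base point.
  have h1 : ∀ᶠ x in 𝓝 x₀, ∀ hx : x ∈ Λ₀.φ.source, ∀ i j,
      evalHom (Λ₀.frame x hx) b i j = H i j (Λ₀.φ x, fun i j => if i = j then 1 else 0) := by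
    have h2 : ∀ᶠ q in Λ₀.nhd p₀, ∀ i j, (b i j).1 q = H i j (Λ₀.κ q) :=
      eventually_all.2 fun i => eventually_all.2 fun j => hbH i j
    have h3 := LFrame.eventually_nhd.1 h2
    rw [LFrame.κ_frame (hΛ x₀)] at h3
    have h4 : Tendsto (fun x => ((Λ₀.φ x, fun i j => if i = j then 1 else 0) : CoordSp m n))
        (𝓝 x₀) (𝓝 (Λ₀.φ x₀, fun i j => if i = j then 1 else 0)) :=
      (Λ₀.φ.continuousAt (hΛ x₀)).tendsto.prodMk_nhds tendsto_const_nhds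
    filter_upwards [h4.eventually h3] with x hx hxs i j
    have h5 := hx (Λ₀.frame x hxs) (LFrame.κ_frame hxs) hxs i j
    rw [LFrame.κ_frame hxs] at h5
    exact h5
  have hU : IsOpen (Λ₀.φ.source ∩ e.baseSet) := Λ₀.φ.open_source.inter e.open_baseSet
  have hU₀ : Λ₀.φ.source ∩ e.baseSet ∈ 𝓝 x₀ := hU.mem_nhds ⟨hΛ x₀, hx₀⟩
  have h6 : ContMDiffAt (𝓡 m) 𝓘(ℝ, ℂ) ∞ (fun x => ∑ i, ∑ j,
      (H i j (Λ₀.φ x, fun i j => if i = j then 1 else 0) *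
        inner ℂ (Λ₀.s x j) (trivFrame e x k)) *
        (e.continuousLinearMapAt ℂ x (Λ₀.s x i)) l) x₀ := by
    refine ContMDiffOn.contMDiffAt (s := Λ₀.φ.source ∩ e.baseSet) ?_ hU₀
    refine cmOn_sum _ fun i _ => cmOn_sum _ fun j _ => cmOn_mul (cmOn_mul ?_ ?_) ?_
    · refine (hH i j).contMDiff.comp_contMDiffOn (ContMDiffOn.prodMk_space ?_ contMDiffOn_const)
      exact (contMDiffOn_of_mem_maximalAtlas Λ₀.mem).mono Set.inter_subset_left
    · exact (Λ₀.smooth e j).contMDiffOn_inner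
        ((smoothSec_trivFrame e k).mono Set.inter_subset_right) Set.inter_subset_right
    · exact cmOn_coord (Λ₀.smooth e i) l
  refine h6.congr_of_eventuallyEq ?_
  filter_upwards [h1, hU₀] with x hx hxU
  have h7 : a x = endoOfMatrix (Λ₀.s x) (evalHom (Λ₀.frame x hxU.1) b) := by
    refine endo_ext (Λ₀.orthonormal x hxU.1) fun i j => ?_
    rw [inner_endoOfMatrix (Λ₀.orthonormal x hxU.1)]
    exact ha (Λ₀.frame x hxU.1) i j
  have h8 : e.symmL ℂ x (EuclideanSpace.single k 1) = trivFrame e x k :=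
    e.symmL_apply (R := ℂ) hxU.2 _
  change (e.continuousLinearMapAt ℂ x (a x (e.symmL ℂ x (EuclideanSpace.single k 1)))) l = _
  rw [h7, h8, endoOfMatrix]
  simp only [hx hxU.1, sum_apply, smul_apply,
    ContinuousLinearMap.smulRight_apply, innerSL_apply_apply, map_sum, map_smul, smul_smul]
  simp

end Representation

end DerCalc

end

noncomputable section

namespace DerCalc

open Filter Topology

/-! ### Derivations along families of curves, and the derivations Aᵛ + ad_A. -/

section InnerDerivations

variable {A : Type*} [Ring A] [Algebra ℂ A]

/-- The inner derivation `[a, ·]`. -/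
def adDer (a : A) : Der A :=
  ⟨LinearMap.mulLeft ℂ a - LinearMap.mulRight ℂ a, by
    intro b c
    simp only [LinearMap.sub_apply, LinearMap.mulLeft_apply, LinearMap.mulRight_apply, sub_mul,
      mul_sub, mul_assoc]
    abel⟩

lemma adDer_apply (a b : A) : (adDer a : Module.End ℂ A) b = a * b - b * a := rfl

lemma der_ext {X Y : Der A} (h : ∀ a, (X : Module.End ℂ A) a = (Y : Module.End ℂ A) a) : X = Y :=
  Subtype.ext (LinearMap.ext h)

lemma smul_add_sub_aux (c : ℂ) (x a b : A) : c • (x + (a - b)) = c • x + (c • a - c • b) := by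
  rw [smul_add, smul_sub]

/-- The sum of two derivations. -/
def derAdd (X Y : Der A) : Der A := X + Y

lemma derAdd_apply (X Y : Der A) (a : A) : (derAdd X Y : Module.End ℂ A) a =
    (X : Module.End ℂ A) a + (Y : Module.End ℂ A) a := rfl

/-- A real linear map into the derivations, from its values on the algebra. -/
def derLift {V : Type*} [AddCommGroup V] [Module ℝ V] (T : V → Der A)
    (hadd : ∀ v w a, (T (v + w) : Module.End ℂ A) a =
      (T v : Module.End ℂ A) a + (T w : Module.End ℂ A) a)
    (hsmul : ∀ (c : ℝ) v a, (T (c • v) : Module.End ℂ A) a = (c : ℂ) • (T v : Module.End ℂ A) a) :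
    V →ₗ[ℝ] Der A where
  toFun := T
  map_add' v w := der_ext fun a => hadd v w a
  map_smul' c v := der_ext fun a => hsmul c v a

/-- A derivation of a commutative algebra, applied to the entries of matrices. -/
def mapDer {R : Type*} [CommRing R] [Algebra ℂ R] (n : ℕ) (X : Der R) :
    Der (Matrix (Fin n) (Fin n) R) :=
  ⟨(X : Module.End ℂ R).mapMatrix, by
    intro a b
    ext i j
    simp only [LinearMap.mapMatrix_apply, Matrix.map_apply, Matrix.mul_apply, Matrix.add_apply,
      map_sum, X.2 _ _, Finset.sum_add_distrib]⟩

lemma mapDer_apply {R : Type*} [CommRing R] [Algebra ℂ R] {n : ℕ} (X : Der R)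
    (b : Matrix (Fin n) (Fin n) R) (i j : Fin n) :
    (mapDer n X : Module.End ℂ _) b i j = (X : Module.End ℂ R) (b i j) := rfl

end InnerDerivations

section CurveFields

variable {m n : ℕ} {M : Type*} [TopologicalSpace M]
  [ChartedSpace (EuclideanSpace ℝ (Fin m)) M] [IsManifold (𝓡 m) ∞ M]
  {E : M → Type*} [TopologicalSpace (Bundle.TotalSpace (EuclideanSpace ℂ (Fin n)) E)]
  [∀ x, NormedAddCommGroup (E x)] [∀ x, InnerProductSpace ℂ (E x)]
  [FiberBundle (EuclideanSpace ℂ (Fin n)) E] [VectorBundle ℂ (EuclideanSpace ℂ (Fin n)) E]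
  {o : BundleOrientation (m := m) n E}

variable (o) in
/-- A family of curves in the frame bundle, whose initial velocities form a smooth vector field. -/
structure CurveField where
  c : FrameBundle o → ℝ → FrameBundle o
  zero : ∀ q, c q 0 = q
  vel : ∀ p : FrameBundle o, ∃ Λ : LFrame o, p.base ∈ Λ.φ.source ∧
    ∃ ξ : CoordSp m n → CoordSp m n, SmoothNear ξ (Λ.κ p) ∧ ∀ᶠ q in Λ.nhd p,
      (∀ᶠ t in 𝓝 (0 : ℝ), (c q t).base ∈ Λ.φ.source) ∧
      HasDerivAt (fun t => Λ.κ (c q t)) (ξ (Λ.κ q)) 0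

omit [IsManifold (𝓡 m) ∞ M] in
lemma hasDerivAt_comp_curve {f : FrameBundle o → ℂ} {Λ : LFrame o} {p : FrameBundle o}
    {H : CoordSp m n → ℂ} (hH : Differentiable ℝ H)
    (hfH : ∀ᶠ q in Λ.nhd p, f q = H (Λ.κ q)) {c : ℝ → FrameBundle o} (hc : c 0 = p)
    (hs : ∀ᶠ t in 𝓝 (0 : ℝ), (c t).base ∈ Λ.φ.source) {v : CoordSp m n}
    (hv : HasDerivAt (fun t => Λ.κ (c t)) v 0) :
    HasDerivAt (fun t => f (c t)) (fderiv ℝ H (Λ.κ p) v) 0 := by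
  subst hc
  have h1 := HasFDerivAt.comp_hasDerivAt (0 : ℝ) (hH (Λ.κ (c 0))).hasFDerivAt hv
  refine h1.congr_of_eventuallyEq ?_
  exact (LFrame.tendsto_nhd hv.continuousAt.tendsto hs).eventually hfH

namespace CurveField

variable (C : CurveField o)

/-- In coordinates the derivative of f along the curves is dH(ξ), a smooth function of the
coordinates again. This gives both the existence of the derivative and its smoothness on P. -/
lemma germ (f : SmoothFun o) (p : FrameBundle o) :
    ∃ Λ : LFrame o, p.base ∈ Λ.φ.source ∧ ∃ H : CoordSp m n → ℂ, SmoothNear H (Λ.κ p) ∧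
      ∀ᶠ q in Λ.nhd p, HasDerivAt (fun t => f.1 (C.c q t)) (H (Λ.κ q)) 0 := by
  obtain ⟨Λ, hp, ξ, hξ, hv⟩ := C.vel p
  obtain ⟨H, hH, hfH⟩ := exists_germ f hp
  refine ⟨Λ, hp, fun z => fderiv ℝ H z (ξ z), ?_, ?_⟩
  · have h1 : ContDiff ℝ ∞ (fderiv ℝ H) := hH.fderiv_right (by simp)
    filter_upwards [hξ] with z hz
    exact h1.contDiffAt.clm_apply hz
  · filter_upwards [hv, LFrame.eventually_eventually_nhd hfH] with q h1 h2
    exact hasDerivAt_comp_curve (hH.differentiable (by simp)) h2 (C.zero q) h1.1 h1.2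

lemma hasDerivAt_deriv (f : SmoothFun o) (p : FrameBundle o) :
    HasDerivAt (fun t => f.1 (C.c p t)) (deriv (fun t => f.1 (C.c p t)) 0) 0 := by
  obtain ⟨Λ, hp, H, -, hv⟩ := C.germ f p
  exact (LFrame.eventually_self hp hv).differentiableAt.hasDerivAt

variable [IsSmoothHermitianBundle (m := m) n E]

lemma deriv_mem (f : SmoothFun o) :
    (fun q => deriv (fun t => f.1 (C.c q t)) 0) ∈ SmoothFun o := by
  refine mem_smoothFun_of_germ fun p => ?_
  obtain ⟨Λ, hp, H, hH, hv⟩ := C.germ f p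
  refine ⟨Λ, hp, H, hH, ?_⟩
  filter_upwards [hv] with q hq
  exact hq.deriv

/-- The derivation of the smooth functions along a family of curves. -/
def der : Der (SmoothFun o) :=
  ⟨{ toFun := fun f => ⟨_, C.deriv_mem f⟩
     map_add' := by
       intro f g
       ext q
       exact ((C.hasDerivAt_deriv f q).add (C.hasDerivAt_deriv g q)).deriv
     map_smul' := by
       intro a f
       ext q
       exact ((C.hasDerivAt_deriv f q).const_mul a).deriv }, by
    intro f g
    ext q
    have h := ((C.hasDerivAt_deriv f q).mul (C.hasDerivAt_deriv g q)).deriv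
    simp only [C.zero] at h
    exact h⟩

lemma hasDerivAt_evalHom (b : MatAlg o) (q : FrameBundle o) (i j : Fin n) :
    HasDerivAt (fun t => evalHom (C.c q t) b i j)
      (evalHom q ((mapDer n C.der : Module.End ℂ _) b) i j) 0 :=
  C.hasDerivAt_deriv (b i j) q

end CurveField

/-- The linear vector field `(y, g) ↦ (0, g A)`. -/
def vertVec (A : Matrix (Fin n) (Fin n) ℂ) : CoordSp m n →L[ℝ] CoordSp m n :=
  LinearMap.toContinuousLinearMap
    { toFun := fun z => (0, fun i j => ∑ k, z.2 i k * A k j)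
      map_add' := by
        intro z w
        refine Prod.ext (by simp) ?_
        funext i j
        simp [add_mul, Finset.sum_add_distrib]
      map_smul' := by
        intro c z
        refine Prod.ext (by simp) ?_
        funext i j
        simp [Finset.mul_sum, mul_assoc] }

lemma vertVec_apply (A : Matrix (Fin n) (Fin n) ℂ) (z : CoordSp m n) :
    vertVec A z = (0, fun i j => ∑ k, z.2 i k * A k j) := rfl

lemma vertVec_add (A B : Matrix (Fin n) (Fin n) ℂ) (z : CoordSp m n) :
    vertVec (A + B) z = vertVec A z + vertVec B z := by
  refine Prod.ext (by simp [vertVec_apply]) ?_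
  funext i j
  simp [vertVec_apply, mul_add, Finset.sum_add_distrib]

lemma vertVec_smul (c : ℝ) (A : Matrix (Fin n) (Fin n) ℂ) (z : CoordSp m n) :
    vertVec (c • A) z = c • vertVec A z := by
  refine Prod.ext (by simp [vertVec_apply]) ?_
  funext i j
  simp only [vertVec_apply, Matrix.smul_apply, Prod.smul_snd, Pi.smul_apply, Finset.smul_sum,
    mul_smul_comm]

/-- Right multiplications compose in the reverse order. This sign is absorbed when the vector fields
act on functions, so A ↦ Aᵛ preserves brackets. -/
lemma vertVec_bracket (A B : Matrix (Fin n) (Fin n) ℂ) (z : CoordSp m n) :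
    vertVec ⁅A, B⁆ z = vertVec B (vertVec A z) - vertVec A (vertVec B z) := by
  have key : ∀ G : Matrix (Fin n) (Fin n) ℂ, G * ⁅A, B⁆ = G * A * B - G * B * A := by
    intro G
    rw [Ring.lie_def, mul_sub, mul_assoc, mul_assoc]
  refine Prod.ext (by simp [vertVec_apply]) ?_
  funext i j
  exact congrFun (congrFun (key (Matrix.of z.2)) i) j

omit [IsManifold (𝓡 m) ∞ M] in
lemma LFrame.hasDerivAt_κ_act (Λ : LFrame o) (q : FrameBundle o) (A : su n) :
    HasDerivAt (fun t => Λ.κ (q.act (expSU A t)))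
      (vertVec (A : Matrix (Fin n) (Fin n) ℂ) (Λ.κ q)) 0 := by
  simp only [LFrame.κ_act]
  refine (hasDerivAt_const _ _).prodMk ?_
  refine hasDerivAt_pi.2 fun i => hasDerivAt_pi.2 fun j => ?_
  refine HasDerivAt.fun_sum fun k _ => ?_
  have h := hasDerivAt_expSU A 0 k j
  rw [expSU_zero, Submonoid.coe_one, one_mul] at h
  exact h.const_mul _

variable [IsSmoothHermitianBundle (m := m) n E] [NeZero n]

variable (o) in
/-- The curves `q exp(t A)`. -/
def vertCurves (A : su n) : CurveField o where
  c q t := q.act (expSU A t)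
  zero q := by rw [expSU_zero, FrameBundle.act_one]
  vel p := by
    obtain ⟨Λ, hp⟩ := LFrame.exists_mem o p.base
    refine ⟨Λ, hp, vertVec A, ContDiff.smoothNear (vertVec _).contDiff _, ?_⟩
    filter_upwards [LFrame.eventually_mem_source p] with q hq
    exact ⟨Eventually.of_forall fun _ => hq, Λ.hasDerivAt_κ_act q A⟩

lemma vertCurves_der_apply {f : SmoothFun o} {Λ : LFrame o} {p : FrameBundle o}
    (hp : p.base ∈ Λ.φ.source) {H : CoordSp m n → ℂ} (hH : Differentiable ℝ H)
    (hfH : ∀ᶠ q in Λ.nhd p, f.1 q = H (Λ.κ q)) (A : su n) :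
    (((vertCurves o A).der : Module.End ℂ _) f).1 p =
      fderiv ℝ H (Λ.κ p) (vertVec (A : Matrix (Fin n) (Fin n) ℂ) (Λ.κ p)) :=
  (hasDerivAt_comp_curve hH hfH ((vertCurves o A).zero p)
    (Eventually.of_forall fun _ => hp) (Λ.hasDerivAt_κ_act p A)).deriv

lemma vertCurves_der_add (A B : su n) (f : SmoothFun o) :
    ((vertCurves o (A + B)).der : Module.End ℂ _) f =
      ((vertCurves o A).der : Module.End ℂ _) f + ((vertCurves o B).der : Module.End ℂ _) f := by
  refine Subtype.ext (funext fun p => ?_)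
  obtain ⟨Λ, hp⟩ := LFrame.exists_mem o p.base
  obtain ⟨H, hH, hfH⟩ := exists_germ f hp
  have hd := hH.differentiable (by simp)
  refine (vertCurves_der_apply hp hd hfH _).trans ?_
  have h : ((A + B : su n) : Matrix (Fin n) (Fin n) ℂ) = A + B := rfl
  rw [h, vertVec_add, map_add, ← vertCurves_der_apply hp hd hfH,
    ← vertCurves_der_apply hp hd hfH]
  rfl

lemma vertCurves_der_smul (c : ℝ) (A : su n) (f : SmoothFun o) :
    ((vertCurves o (c • A)).der : Module.End ℂ _) f =
      (c : ℂ) • ((vertCurves o A).der : Module.End ℂ _) f := by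
  refine Subtype.ext (funext fun p => ?_)
  obtain ⟨Λ, hp⟩ := LFrame.exists_mem o p.base
  obtain ⟨H, hH, hfH⟩ := exists_germ f hp
  have hd := hH.differentiable (by simp)
  refine (vertCurves_der_apply hp hd hfH _).trans ?_
  have h : ((c • A : su n) : Matrix (Fin n) (Fin n) ℂ) = c • A := rfl
  rw [h, vertVec_smul, map_smul, ← vertCurves_der_apply hp hd hfH]
  exact Complex.real_smul

/-- Applying two linear vector fields in turn to H gives a second derivative, symmetric in the two
fields, and a first-order term. The commutator keeps only the latter, and `vertVec_bracket`
identifies it. -/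
lemma vertCurves_der_bracket (A B : su n) :
    (vertCurves o ⁅A, B⁆).der = ⁅(vertCurves o A).der, (vertCurves o B).der⁆ := by
  refine der_ext fun f => Subtype.ext (funext fun p => ?_)
  obtain ⟨Λ, hp⟩ := LFrame.exists_mem o p.base
  obtain ⟨H, hH, hfH⟩ := exists_germ f hp
  have hd := hH.differentiable (by simp)
  have hH1 : ContDiff ℝ ∞ (fderiv ℝ H) := hH.fderiv_right (by simp)
  have hd1 := hH1.differentiable (by simp)
  have h1 : ∀ C : su n, ∀ᶠ q in Λ.nhd p, (((vertCurves o C).der : Module.End ℂ _) f).1 q =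
      (fun z => fderiv ℝ H z (vertVec (C : Matrix (Fin n) (Fin n) ℂ) z)) (Λ.κ q) := by
    intro C
    filter_upwards [LFrame.eventually_mem_source p, LFrame.eventually_eventually_nhd hfH]
      with q hq h
    exact vertCurves_der_apply hq hd h C
  have h2 : ∀ C D : su n, (((vertCurves o D).der : Module.End ℂ _)
      (((vertCurves o C).der : Module.End ℂ _) f)).1 p =
      fderiv ℝ H (Λ.κ p) (vertVec (C : Matrix (Fin n) (Fin n) ℂ)
        (vertVec (D : Matrix (Fin n) (Fin n) ℂ) (Λ.κ p))) +
      fderiv ℝ (fderiv ℝ H) (Λ.κ p) (vertVec (D : Matrix (Fin n) (Fin n) ℂ) (Λ.κ p))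
        (vertVec (C : Matrix (Fin n) (Fin n) ℂ) (Λ.κ p)) := by
    intro C D
    have h3 : ∀ z, HasFDerivAt (fun z => fderiv ℝ H z
        (vertVec (C : Matrix (Fin n) (Fin n) ℂ) z)) _ z := fun z =>
      (hd1 z).hasFDerivAt.clm_apply (vertVec (m := m) (C : Matrix (Fin n) (Fin n) ℂ)).hasFDerivAt
    rw [vertCurves_der_apply hp (fun z => (h3 z).differentiableAt) (h1 C) D, (h3 _).fderiv]
    rfl
  have h4 : IsSymmSndFDerivAt ℝ H (Λ.κ p) :=
    hH.contDiffAt.isSymmSndFDerivAt (n := ∞) (by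
      rw [minSmoothness_of_isRCLikeNormedField]
      exact WithTop.coe_le_coe.2 le_top)
  refine (vertCurves_der_apply hp hd hfH _).trans ?_
  rw [der_bracket_apply]
  change _ = (((vertCurves o A).der : Module.End ℂ _)
      (((vertCurves o B).der : Module.End ℂ _) f)).1 p - (((vertCurves o B).der : Module.End ℂ _)
      (((vertCurves o A).der : Module.End ℂ _) f)).1 p
  rw [h2, h2, LieSubalgebra.coe_bracket, vertVec_bracket, map_sub, h4.eq]
  ring

variable (o) in
/-- A constant matrix valued function. -/
def constMat : Matrix (Fin n) (Fin n) ℂ →ₐ[ℂ] MatAlg o :=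
  (Algebra.ofId ℂ (SmoothFun o)).mapMatrix

lemma evalHom_constMat (p : FrameBundle o) (C : Matrix (Fin n) (Fin n) ℂ) :
    evalHom p (constMat o C) = C := rfl

lemma mapDer_constMat (X : Der (SmoothFun o)) (C : Matrix (Fin n) (Fin n) ℂ) :
    (mapDer n X : Module.End ℂ (MatAlg o)) (constMat o C) = 0 := by
  ext1 i j
  have h : constMat o C i j = C i j • (1 : SmoothFun o) :=
    Algebra.algebraMap_eq_smul_one (R := ℂ) (A := SmoothFun o) (C i j)
  rw [mapDer_apply, h, map_smul, der_map_one, smul_zero]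
  rfl

variable (o) in
/-- The derivations `Aᵛ + ad_A`. -/
def vertDer : su n →ₗ[ℝ] Der (MatAlg o) :=
  derLift (fun A => derAdd (mapDer n (vertCurves o A).der) (adDer (constMat o A)))
    (fun A B b => by
      have h : (mapDer n (vertCurves o (A + B)).der : Module.End ℂ (MatAlg o)) b =
          (mapDer n (vertCurves o A).der : Module.End ℂ (MatAlg o)) b +
          (mapDer n (vertCurves o B).der : Module.End ℂ (MatAlg o)) b :=
        Matrix.ext fun i j => vertCurves_der_add A B (b i j)
      have h' : constMat o ((A + B : su n) : Matrix (Fin n) (Fin n) ℂ) =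
        constMat o (A : Matrix (Fin n) (Fin n) ℂ) + constMat o (B : Matrix (Fin n) (Fin n) ℂ) :=
        map_add _ _ _
      simp only [derAdd_apply, adDer_apply]
      rw [h, h', add_mul, mul_add]
      abel)
    (fun c A b => by
      have h : (mapDer n (vertCurves o (c • A)).der : Module.End ℂ (MatAlg o)) b =
          (c : ℂ) • (mapDer n (vertCurves o A).der : Module.End ℂ (MatAlg o)) b :=
        Matrix.ext fun i j => vertCurves_der_smul c A (b i j)
      have h' : constMat o ((c • A : su n) : Matrix (Fin n) (Fin n) ℂ) =
        (c : ℂ) • constMat o (A : Matrix (Fin n) (Fin n) ℂ) := by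
        rw [← map_smul]
        rfl
      simp only [derAdd_apply, adDer_apply]
      rw [h, h', smul_mul_assoc, mul_smul_comm]
      exact (smul_add_sub_aux _ _ _ _).symm)

lemma vertDer_apply (A : su n) (b : MatAlg o) : (vertDer o A : Module.End ℂ (MatAlg o)) b =
    (mapDer n (vertCurves o A).der : Module.End ℂ (MatAlg o)) b +
      (constMat o (A : Matrix (Fin n) (Fin n) ℂ) * b -
        b * constMat o (A : Matrix (Fin n) (Fin n) ℂ)) := rfl

lemma evalHom_vertDer (A : su n) (b : MatAlg o) (p : FrameBundle o) :
    evalHom p ((vertDer o A : Module.End ℂ (MatAlg o)) b) =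
      evalHom p ((mapDer n (vertCurves o A).der : Module.End ℂ (MatAlg o)) b) +
      ((A : Matrix (Fin n) (Fin n) ℂ) * evalHom p b -
        evalHom p b * (A : Matrix (Fin n) (Fin n) ℂ)) := by
  rw [vertDer_apply, map_add, map_sub, map_mul, map_mul, evalHom_constMat]

lemma isVertAddAd_vertDer (A : su n) : IsVertAddAd A (vertDer o A) := by
  intro b p i j
  have h := (vertCurves o A).hasDerivAt_evalHom b p i j
  have h1 := evalHom_vertDer A b p
  rw [← evalHom_apply, ← evalHom_apply, h1, Ring.lie_def, add_sub_cancel_right]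
  exact h

/-- Aᵛ kills constant matrices and so commutes with every ad_B. The bracket splits into that of the
vertical fields and that of the inner derivations. -/
lemma vertDer_bracket (A B : su n) : vertDer o ⁅A, B⁆ = ⁅vertDer o A, vertDer o B⁆ := by
  refine der_ext fun b => ?_
  rw [der_bracket_apply]
  simp only [vertDer_apply]
  have h1 : ∀ (X : Der (SmoothFun o)) (C : Matrix (Fin n) (Fin n) ℂ) (b : MatAlg o),
      (mapDer n X : Module.End ℂ (MatAlg o)) (constMat o C * b - b * constMat o C) =
        constMat o C * (mapDer n X : Module.End ℂ (MatAlg o)) b -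
          (mapDer n X : Module.End ℂ (MatAlg o)) b * constMat o C := by
    intro X C b
    rw [map_sub, der_leibniz, der_leibniz, mapDer_constMat]
    simp
  have h2 : (mapDer n (vertCurves o ⁅A, B⁆).der : Module.End ℂ (MatAlg o)) b =
      (mapDer n (vertCurves o A).der : Module.End ℂ (MatAlg o))
        ((mapDer n (vertCurves o B).der : Module.End ℂ (MatAlg o)) b) -
      (mapDer n (vertCurves o B).der : Module.End ℂ (MatAlg o))
        ((mapDer n (vertCurves o A).der : Module.End ℂ (MatAlg o)) b) := by
    rw [vertCurves_der_bracket]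
    rfl
  have h3 : constMat o ((⁅A, B⁆ : su n) : Matrix (Fin n) (Fin n) ℂ) =
      constMat o (A : Matrix (Fin n) (Fin n) ℂ) * constMat o (B : Matrix (Fin n) (Fin n) ℂ) -
      constMat o (B : Matrix (Fin n) (Fin n) ℂ) * constMat o (A : Matrix (Fin n) (Fin n) ℂ) := by
    rw [LieSubalgebra.coe_bracket, Ring.lie_def, map_sub, map_mul, map_mul]
  rw [h2, h3]
  simp only [map_add, h1]
  simp only [mul_add, add_mul, mul_sub, sub_mul, mul_assoc]
  abel

/-- On constant functions only ad_A acts. If two of these derivations agree, the difference of the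
matrices commutes with all matrices, so it is scalar, and a traceless scalar matrix is zero. A point
of M is needed to evaluate at a frame. -/
lemma vertDer_injective [Nonempty M] : Function.Injective (vertDer o) := by
  intro A B hAB
  obtain ⟨p, -⟩ := exists_base_eq o (Classical.arbitrary M)
  have h1 : ∀ C : Matrix (Fin n) (Fin n) ℂ,
      ((A - B : su n) : Matrix (Fin n) (Fin n) ℂ) * C =
      C * ((A - B : su n) : Matrix (Fin n) (Fin n) ℂ) := by
    intro C
    have h2 := evalHom_vertDer A (constMat o C) p
    rw [hAB, evalHom_vertDer, mapDer_constMat, mapDer_constMat, evalHom_constMat] at h2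
    have h3 := add_left_cancel h2
    have h4 : ((A - B : su n) : Matrix (Fin n) (Fin n) ℂ) = A - B := rfl
    rw [h4, sub_mul, mul_sub, ← sub_eq_zero]
    rw [← sub_eq_zero] at h3
    rw [← neg_eq_zero, ← h3]
    abel
  have h3 := eq_smul_one_of_commute h1
  have h4 := (A - B).2.2
  have h5 : (n : ℂ) ≠ 0 := Nat.cast_ne_zero.2 (NeZero.ne n)
  rw [h3, Matrix.trace_smul, Matrix.trace_one, Fintype.card_fin, smul_eq_mul,
    mul_eq_zero, or_iff_left h5] at h4
  rw [h4, zero_smul] at h3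
  exact sub_eq_zero.1 (Subtype.ext h3)

end CurveFields

end DerCalc

end

noncomputable section

namespace DerCalc

open Filter Topology

/-! ### Functions pulled back by colored coordinates, and locality of point derivations. -/

section Colors

variable {m n : ℕ} {M : Type*} [TopologicalSpace M]
  [ChartedSpace (EuclideanSpace ℝ (Fin m)) M] [IsManifold (𝓡 m) ∞ M]
  {E : M → Type*} [TopologicalSpace (Bundle.TotalSpace (EuclideanSpace ℂ (Fin n)) E)]
  [∀ x, NormedAddCommGroup (E x)] [∀ x, InnerProductSpace ℂ (E x)]
  [FiberBundle (EuclideanSpace ℂ (Fin n)) E] [VectorBundle ℂ (EuclideanSpace ℂ (Fin n)) E]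
  {o : BundleOrientation (m := m) n E}

variable (o) in
/-- A locally constant choice of local frames over an open set, with a cutoff function. -/
structure Color where
  O : Set M
  isOpen : IsOpen O
  lam : M → LFrame o
  mem : ∀ x ∈ O, x ∈ (lam x).φ.source
  loc : ∀ x ∈ O, ∀ᶠ y in 𝓝 x, lam y = lam x
  χ : M → ℝ
  smooth : ContMDiff (𝓡 m) 𝓘(ℝ, ℝ) ∞ χ
  supp : tsupport χ ⊆ O

namespace Color

variable (c : Color o)

/-- The local coordinates of a frame, in the local frame chosen by the color. -/
def κ (q : FrameBundle o) : CoordSp m n := (c.lam q.base).κ q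

omit [IsManifold (𝓡 m) ∞ M] in
lemma eventually_κ_eq {p : FrameBundle o} (hp : p.base ∈ c.O) :
    ∀ᶠ q in (c.lam p.base).nhd p, c.κ q = (c.lam p.base).κ q := by
  filter_upwards [(LFrame.tendsto_base (c.mem _ hp)).eventually (c.loc _ hp)] with q hq
  rw [κ, hq]

omit [IsManifold (𝓡 m) ∞ M] in
lemma mem_of_χ_ne {x : M} (h : c.χ x ≠ 0) : x ∈ c.O := c.supp (subset_tsupport _ h)

variable [IsSmoothHermitianBundle (m := m) n E] [NeZero n]

lemma contMDiff_χ : ContMDiff (𝓡 m) 𝓘(ℝ, ℂ) ∞ (fun x => (c.χ x : ℂ)) :=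
  (Complex.ofRealCLM.contDiff (n := ∞)).contMDiff.comp c.smooth

lemma pull_mem (H : SmoothSub (CoordSp m n)) :
    (fun q : FrameBundle o => (c.χ q.base : ℂ) * H.1 (c.κ q)) ∈ SmoothFun o := by
  refine mem_smoothFun_of_germ fun p => ?_
  by_cases hp : p.base ∈ c.O
  · refine ⟨c.lam p.base, c.mem _ hp,
      fun z => (c.χ ((c.lam p.base).φ.symm z.1) : ℂ) * H.1 z, ?_, ?_⟩
    · exact ((c.lam p.base).smoothNear_base isOpen_univ (c.mem _ hp) (Set.mem_univ _)
        c.contMDiff_χ.contMDiffOn).mul (ContDiff.smoothNear H.2 _)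
    · filter_upwards [c.eventually_κ_eq hp, LFrame.eventually_mem_source p] with q hq hqs
      have h0 : (c.lam p.base).φ.symm ((c.lam p.base).κ q).1 = q.base :=
        (c.lam p.base).φ.left_inv hqs
      rw [hq, h0]
  · obtain ⟨Λ, hΛ⟩ := LFrame.exists_mem o p.base
    refine ⟨Λ, hΛ, fun _ => 0, ContDiff.smoothNear contDiff_const _, ?_⟩
    have h1 : p.base ∉ tsupport c.χ := fun h => hp (c.supp h)
    filter_upwards [(LFrame.tendsto_base hΛ).eventually
      (notMem_tsupport_iff_eventuallyEq.1 h1)] with q hq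
    rw [hq]
    simp

/-- The smooth function on the frame bundle obtained from a smooth function of the local
coordinates. -/
def pull : SmoothSub (CoordSp m n) →ₗ[ℂ] SmoothFun o where
  toFun H := ⟨_, c.pull_mem H⟩
  map_add' H K := Subtype.ext (funext fun _ => mul_add _ _ _)
  map_smul' a H := Subtype.ext (funext fun _ => mul_left_comm _ _ _)

lemma pull_apply (H : SmoothSub (CoordSp m n)) (q : FrameBundle o) :
    (c.pull H).1 q = (c.χ q.base : ℂ) * H.1 (c.κ q) := rfl

lemma pull_germ {p : FrameBundle o} (hp : ∀ᶠ x in 𝓝 p.base, c.χ x = 1)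
    (H : SmoothSub (CoordSp m n)) :
    ∀ᶠ q in (c.lam p.base).nhd p, (c.pull H).1 q = H.1 ((c.lam p.base).κ q) := by
  have hp1 : c.χ p.base = 1 := hp.self_of_nhds
  have hpO : p.base ∈ c.O := c.mem_of_χ_ne (by rw [hp1]; exact one_ne_zero)
  filter_upwards [c.eventually_κ_eq hpO, (LFrame.tendsto_base (c.mem _ hpO)).eventually hp]
    with q h1 h2
  rw [pull_apply, h1, h2]
  simp

end Color

variable (m n) in
/-- The coordinate `y_i`, as a complex function. -/
def coordY (i : Fin m) : SmoothSub (CoordSp m n) :=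
  linSmooth ((EuclideanSpace.proj (𝕜 := ℝ) i).comp (ContinuousLinearMap.fst ℝ _ _))

variable (m n) in
/-- The coordinate `g_ij`. -/
def coordG (i j : Fin n) : SmoothSub (CoordSp m n) :=
  ⟨fun z => z.2 i j,
    ((contDiff_apply_apply ℝ ℂ i j).comp contDiff_snd : ContDiff ℝ ∞ fun z : CoordSp m n => z.2 i j)⟩

variable (m n) in
/-- The complex conjugate of the coordinate `g_ij`. -/
def coordGbar (i j : Fin n) : SmoothSub (CoordSp m n) :=
  ⟨fun z => (starRingEnd ℂ) (z.2 i j), ((Complex.conjCLE.contDiff (n := ∞)).comp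
    ((contDiff_apply_apply ℝ ℂ i j).comp contDiff_snd) :
      ContDiff ℝ ∞ fun z : CoordSp m n => (starRingEnd ℂ) (z.2 i j))⟩

/-- Real and imaginary parts of g are expressed by g and its conjugate. The latter coordinates are
the ones for which the orthogonality relation g*g = 1 can be differentiated over ℂ. -/
lemma linSmooth_eq (l : CoordSp m n →L[ℝ] ℝ) : linSmooth l =
    ∑ i, (l (EuclideanSpace.single i 1, 0) : ℂ) • coordY m n i +
    ∑ i, ∑ j, (((l (0, Pi.single i (Pi.single j 1)) : ℂ) / 2 -
        Complex.I * (l (0, Pi.single i (Pi.single j Complex.I)) : ℂ) / 2) • coordG m n i j +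
      ((l (0, Pi.single i (Pi.single j 1)) : ℂ) / 2 +
        Complex.I * (l (0, Pi.single i (Pi.single j Complex.I)) : ℂ) / 2) • coordGbar m n i j) := by
  refine Subtype.ext (funext fun z => ?_)
  have hz : z = ∑ i, z.1 i • ((EuclideanSpace.single i 1, 0) : CoordSp m n) +
      ∑ i, ∑ j, ((z.2 i j).re • ((0, Pi.single i (Pi.single j 1)) : CoordSp m n) +
        (z.2 i j).im • ((0, Pi.single i (Pi.single j Complex.I)) : CoordSp m n)) := by
    refine Prod.ext ?_ ?_
    · ext k
      simp [Prod.fst_sum, Pi.single_apply]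
    · funext k l
      simp only [Prod.snd_add, Prod.snd_sum, Prod.smul_mk, smul_zero, Finset.sum_const_zero,
        zero_add, Finset.sum_apply, Pi.add_apply, Pi.smul_apply]
      rw [Finset.sum_eq_single k, Finset.sum_eq_single l]
      · simp [Complex.re_add_im]
      · intro j _ hj
        simp [Pi.single_apply, hj.symm]
      · simp
      · intro i _ hi
        simp [Pi.single_apply, hi.symm]
      · simp
  change ((l z : ℝ) : ℂ) = _
  conv_lhs => rw [hz]
  simp only [map_add, map_sum, map_smul, smul_eq_mul]
  have e1 : ∀ (s : Finset (Fin m)) (F : Fin m → SmoothSub (CoordSp m n)),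
      (∑ i ∈ s, F i).1 z = ∑ i ∈ s, (F i).1 z := fun s F => by
    have : (∑ i ∈ s, F i).1 = ∑ i ∈ s, (F i).1 := map_sum (SmoothSub (CoordSp m n)).val F s
    rw [this, Finset.sum_apply]
  have e2 : ∀ (s : Finset (Fin n)) (F : Fin n → SmoothSub (CoordSp m n)),
      (∑ i ∈ s, F i).1 z = ∑ i ∈ s, (F i).1 z := fun s F => by
    have : (∑ i ∈ s, F i).1 = ∑ i ∈ s, (F i).1 := map_sum (SmoothSub (CoordSp m n)).val F s
    rw [this, Finset.sum_apply]
  have e3 : ∀ F G : SmoothSub (CoordSp m n), (F + G).1 z = F.1 z + G.1 z := fun _ _ => rfl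
  have e4 : ∀ (a : ℂ) (F : SmoothSub (CoordSp m n)), (a • F).1 z = a * F.1 z := fun _ _ => rfl
  rw [e3, e1, e2]
  simp only [e2, e3, e4]
  push_cast
  congr 1
  · refine Finset.sum_congr rfl fun i _ => ?_
    rw [mul_comm]
    rfl
  · refine Finset.sum_congr rfl fun i _ => Finset.sum_congr rfl fun j _ => ?_
    change _ = _ * z.2 i j + _ * (starRingEnd ℂ) (z.2 i j)
    have h1 : (starRingEnd ℂ) (z.2 i j) = (z.2 i j).re - (z.2 i j).im * Complex.I := by
      apply Complex.ext <;> simp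
    have h2 : z.2 i j = (z.2 i j).re + (z.2 i j).im * Complex.I := (Complex.re_add_im _).symm
    generalize z.2 i j = w at *
    rw [h1]
    conv_rhs => rw [h2]
    ring_nf
    simp only [Complex.add_re, Complex.ofReal_re, Complex.add_im, Complex.ofReal_im, Complex.I_sq]
    simp
    ring

/-- A linear map on smooth functions of the local coordinates that vanishes on the coordinates
vanishes on all real linear functions. -/
lemma map_linSmooth_eq_zero {W : Type*} [AddCommGroup W] [Module ℂ W]
    (T : SmoothSub (CoordSp m n) →ₗ[ℂ] W) (hY : ∀ i, T (coordY m n i) = 0)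
    (hG : ∀ i j, T (coordG m n i j) = 0) (hG' : ∀ i j, T (coordGbar m n i j) = 0)
    (l : CoordSp m n →L[ℝ] ℝ) : T (linSmooth l) = 0 := by
  rw [linSmooth_eq]
  simp [hY, hG, hG']

section Locality

variable [T2Space M] [SecondCountableTopology M] [IsSmoothHermitianBundle (m := m) n E] [NeZero n]

omit [IsSmoothHermitianBundle (m := m) n E] [NeZero n] in
/-- A color given by a single local frame. -/
lemma exists_color (Λ : LFrame o) {x : M} (hx : x ∈ Λ.φ.source) :
    ∃ c : Color o, (∀ y, c.lam y = Λ) ∧ c.O = Λ.φ.source ∧ ∀ᶠ y in 𝓝 x, c.χ y = 1 := by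
  obtain ⟨χ, hχ, h1, hs⟩ := exists_cutoff (m := m) (isClosed_singleton (x := x)) Λ.φ.open_source
    (Set.singleton_subset_iff.2 hx)
  exact ⟨⟨Λ.φ.source, Λ.φ.open_source, fun _ => Λ, fun _ h => h,
    fun _ _ => Eventually.of_forall fun _ => rfl, χ, hχ, hs⟩, fun _ => rfl, rfl, h1 x rfl⟩

/-- Multiply f by a function that is 1 at p and vanishes outside the region where f is known to be
zero. The product is 0, and the Leibniz rule at p reduces it to τ f. -/
lemma pointDerivation_local {p : FrameBundle o} {τ : SmoothFun o →ₗ[ℂ] ℂ}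
    (hτ : ∀ f g, τ (f * g) = f.1 p * τ g + g.1 p * τ f) {Λ : LFrame o}
    (hp : p.base ∈ Λ.φ.source) {f : SmoothFun o} (hf : ∀ᶠ q in Λ.nhd p, f.1 q = 0) : τ f = 0 := by
  obtain ⟨c, hc, hcO, h1⟩ := exists_color Λ hp
  obtain ⟨ε, hε, hD⟩ := Metric.eventually_nhds_iff_ball.1 (LFrame.eventually_nhd.1 hf)
  let b : ContDiffBump (Λ.κ p) := ⟨ε / 4, ε / 2, by positivity, by linarith⟩
  let H : SmoothSub (CoordSp m n) := ⟨fun z => (b z : ℂ),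
    (Complex.ofRealCLM.contDiff.comp b.contDiff : ContDiff ℝ ∞ _)⟩
  have hfp : f.1 p = 0 := LFrame.eventually_self hp hf
  have h2 : f * c.pull H = 0 := by
    refine Subtype.ext (funext fun q => ?_)
    change f.1 q * ((c.χ q.base : ℂ) * (b (c.κ q) : ℂ)) = 0
    by_cases h3 : c.χ q.base = 0
    · simp [h3]
    by_cases h4 : b (c.κ q) = 0
    · simp [h4]
    have h5 : c.κ q = Λ.κ q := by rw [Color.κ, hc]
    have h6 : Λ.κ q ∈ Metric.ball (Λ.κ p) ε := by
      rw [← h5]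
      have : c.κ q ∈ Function.support b := h4
      rw [b.support_eq] at this
      exact Metric.ball_subset_ball (by change ε / 2 ≤ ε; linarith) this
    have h7 : q.base ∈ Λ.φ.source := by
      rw [← hcO]; exact c.mem_of_χ_ne h3
    rw [hD _ h6 q rfl h7, zero_mul]
  have h3 : (c.pull H).1 p = 1 := by
    have h4 : b (Λ.κ p) = 1 := b.eventuallyEq_one.self_of_nhds
    rw [Color.pull_apply, Color.κ, hc, h1.self_of_nhds]
    change ((1 : ℝ) : ℂ) * (b (Λ.κ p) : ℂ) = 1
    rw [h4]
    simp
  have h4 := hτ f (c.pull H)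
  rw [h2, map_zero, hfp, h3, zero_mul, zero_add, one_mul] at h4
  exact h4.symm

lemma pointDerivation_congr {p : FrameBundle o} {τ : SmoothFun o →ₗ[ℂ] ℂ}
    (hτ : ∀ f g, τ (f * g) = f.1 p * τ g + g.1 p * τ f) {Λ : LFrame o}
    (hp : p.base ∈ Λ.φ.source) {f g : SmoothFun o} (hf : ∀ᶠ q in Λ.nhd p, f.1 q = g.1 q) :
    τ f = τ g := by
  rw [← sub_eq_zero, ← map_sub]
  refine pointDerivation_local hτ hp ?_
  filter_upwards [hf] with q hq
  change f.1 q - g.1 q = 0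
  rw [hq, sub_self]

/-- A point derivation of the smooth functions that vanishes on the coordinate functions is
zero. -/
lemma pointDerivation_smoothFun_eq_zero {p : FrameBundle o} {τ : SmoothFun o →ₗ[ℂ] ℂ}
    (hτ : ∀ f g, τ (f * g) = f.1 p * τ g + g.1 p * τ f) (c : Color o)
    (hc : ∀ᶠ x in 𝓝 p.base, c.χ x = 1) (hY : ∀ i, τ (c.pull (coordY m n i)) = 0)
    (hG : ∀ i j, τ (c.pull (coordG m n i j)) = 0)
    (hG' : ∀ i j, τ (c.pull (coordGbar m n i j)) = 0) (f : SmoothFun o) : τ f = 0 := by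
  have hp1 : c.χ p.base = 1 := hc.self_of_nhds
  have hpO : p.base ∈ c.O := c.mem_of_χ_ne (by rw [hp1]; exact one_ne_zero)
  have hps := c.mem _ hpO
  obtain ⟨H, hH, hfH⟩ := exists_germ f hps
  have h1 : ∀ K : SmoothSub (CoordSp m n), (c.pull K).1 p = K.1 ((c.lam p.base).κ p) := fun K =>
    LFrame.eventually_self hps (c.pull_germ hc K)
  -- `c.pull` is not multiplicative, since products acquire χ². It is multiplicative near p, where χ
  -- = 1, and locality makes this enough to transport τ to the coordinate space.
  have h2 := pointDerivation_eq_zero ((c.lam p.base).κ p) (τ.comp c.pull) (fun K L => by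
    rw [LinearMap.comp_apply, LinearMap.comp_apply, LinearMap.comp_apply, ← h1, ← h1, smul_eq_mul,
      smul_eq_mul, ← hτ]
    refine pointDerivation_congr hτ hps ?_
    filter_upwards [c.pull_germ hc K, c.pull_germ hc L, c.pull_germ hc (K * L)] with q h3 h4 h5
    change _ = (c.pull K).1 q * (c.pull L).1 q
    rw [h3, h4, h5]
    rfl) (map_linSmooth_eq_zero _ hY hG hG') ⟨H, hH⟩
  rw [← h2]
  refine pointDerivation_congr hτ hps ?_
  filter_upwards [hfH, c.pull_germ hc ⟨H, hH⟩] with q h3 h4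
  rw [h3, h4]

end Locality

end Colors

end DerCalc

end

noncomputable section

namespace DerCalc

open Filter Topology

/-! ### Point derivations of matrix algebras; equivariance from infinitesimal invariance. -/

section MatrixDerivations

variable {n : ℕ}

lemma hasDerivAt_mul_entries {X Y : ℝ → Matrix (Fin n) (Fin n) ℂ} {X' Y' : Matrix (Fin n) (Fin n) ℂ}
    {t : ℝ} (hX : ∀ i j, HasDerivAt (fun s => X s i j) (X' i j) t)
    (hY : ∀ i j, HasDerivAt (fun s => Y s i j) (Y' i j) t) (i j : Fin n) :
    HasDerivAt (fun s => (X s * Y s) i j) ((X' * Y t + X t * Y') i j) t := by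
  have h : HasDerivAt (fun s => ∑ k, X s i k * Y s k j)
      (∑ k, (X' i k * Y t k j + X t i k * Y' k j)) t :=
    HasDerivAt.fun_sum fun k _ => (hX i k).mul (hY k j)
  rw [Finset.sum_add_distrib] at h
  exact h

lemma hasDerivAt_star_expSU (A : su n) (t : ℝ) (i j : Fin n) :
    HasDerivAt (fun t : ℝ => star (expSU A t : Matrix (Fin n) (Fin n) ℂ) i j)
      ((-((A : Matrix (Fin n) (Fin n) ℂ) * star (expSU A t : Matrix (Fin n) (Fin n) ℂ))) i j) t := by
  have h := (hasDerivAt_expSU A t j i).star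
  have h1 : star ((expSU A t : Matrix (Fin n) (Fin n) ℂ) * (A : Matrix (Fin n) (Fin n) ℂ)) =
      -((A : Matrix (Fin n) (Fin n) ℂ) * star (expSU A t : Matrix (Fin n) (Fin n) ℂ)) := by
    have h2 : star (A : Matrix (Fin n) (Fin n) ℂ) = -(A : Matrix (Fin n) (Fin n) ℂ) := A.2.1
    rw [star_mul, h2, neg_mul]
  rw [← h1]
  exact h

variable {R : Type*} [CommRing R] [Algebra ℂ R]

lemma map_derivation_mul {ev : R →ₐ[ℂ] ℂ} {τ : R →ₗ[ℂ] ℂ}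
    (hτ : ∀ f g, τ (f * g) = ev f * τ g + ev g * τ f) (X Y : Matrix (Fin n) (Fin n) R) :
    (X * Y).map τ = X.map τ * ev.mapMatrix Y + ev.mapMatrix X * Y.map τ := by
  ext i j
  simp only [Matrix.map_apply, Matrix.mul_apply, Matrix.add_apply, map_sum, hτ,
    AlgHom.mapMatrix_apply, Finset.sum_add_distrib]
  rw [add_comm]
  congr 1
  exact Finset.sum_congr rfl fun k _ => mul_comm _ _

lemma map_derivation_algebraMap {ev : R →ₐ[ℂ] ℂ} {τ : R →ₗ[ℂ] ℂ}
    (hτ : ∀ f g, τ (f * g) = ev f * τ g + ev g * τ f) (a : ℂ) : τ (algebraMap ℂ R a) = 0 := by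
  have h := hτ 1 1
  rw [mul_one, map_one ev, one_mul] at h
  rw [Algebra.algebraMap_eq_smul_one, map_smul]
  have : τ 1 = 0 := by linear_combination -h
  rw [this, smul_zero]

/-- The derivative of the determinant at the identity is the trace. -/
lemma map_derivation_det {ev : R →ₐ[ℂ] ℂ} {τ : R →ₗ[ℂ] ℂ}
    (hτ : ∀ f g, τ (f * g) = ev f * τ g + ev g * τ f) {X : Matrix (Fin n) (Fin n) R}
    (hX : ev.mapMatrix X = 1) : τ X.det = (X.map τ).trace := by
  -- The map f ↦ ev f + ε τ f into the dual numbers is a ring homomorphism, hence compatible with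
  -- determinants, and det(1 + εN) = 1 + ε tr N.
  let φ : R →+* TrivSqZeroExt ℂ ℂ :=
    { toFun := fun f => TrivSqZeroExt.inl (ev f) + TrivSqZeroExt.inr (τ f)
      map_one' := by
        have := map_derivation_algebraMap hτ 1
        rw [map_one] at this
        rw [this]
        simp
      map_mul' := by
        intro f g
        rw [hτ]
        ext <;> simp [mul_comm]
      map_zero' := by simp
      map_add' := by
        intro f g
        ext <;> simp }
  have h1 : φ.mapMatrix X = 1 + (TrivSqZeroExt.inr 1 : TrivSqZeroExt ℂ ℂ) •
      (X.map τ).map (TrivSqZeroExt.inlHom ℂ ℂ) := by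
    ext i j
    · have := congrFun (congrFun hX i) j
      simp only [AlgHom.mapMatrix_apply, Matrix.map_apply] at this
      simp [φ, this, Matrix.one_apply, apply_ite TrivSqZeroExt.fst]
    · simp [φ, Matrix.one_apply, apply_ite TrivSqZeroExt.snd]
  have h2 := RingHom.map_det φ X
  rw [h1, Matrix.det_one_add_smul] at h2
  have h3 := congrArg TrivSqZeroExt.snd h2
  have h4 : ((X.map τ).map (TrivSqZeroExt.inlHom ℂ ℂ)).trace =
      TrivSqZeroExt.inl (X.map τ).trace :=
    (AddMonoidHom.map_trace (TrivSqZeroExt.inlHom ℂ ℂ) (X.map τ)).symm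
  rw [h4] at h3
  simpa [φ, pow_two] using h3

/-- Constants and scalar matrices generate. On constants δ is an inner derivation, by γ. A scalar
matrix is central, so differentiating this relation shows that its image commutes with all matrices
and is a scalar, which defines τ. -/
lemma exists_matrix_pointDerivation [NeZero n] (ev : R →ₐ[ℂ] ℂ)
    (δ : Matrix (Fin n) (Fin n) R →ₗ[ℂ] Matrix (Fin n) (Fin n) ℂ)
    (hδ : ∀ a b, δ (a * b) = δ a * ev.mapMatrix b + ev.mapMatrix a * δ b) :
    ∃ (γ : Matrix (Fin n) (Fin n) ℂ) (τ : R →ₗ[ℂ] ℂ),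
      (∀ f g, τ (f * g) = ev f * τ g + ev g * τ f) ∧
      ∀ b, δ b = b.map τ + (γ * ev.mapMatrix b - ev.mapMatrix b * γ) := by
  let C : Matrix (Fin n) (Fin n) ℂ →ₐ[ℂ] Matrix (Fin n) (Fin n) R := (Algebra.ofId ℂ R).mapMatrix
  have hevC : ∀ a, ev.mapMatrix (C a) = a := by
    intro a
    ext i j
    exact ev.commutes _
  let S : R →ₗ[ℂ] Matrix (Fin n) (Fin n) R :=
    (Algebra.linearMap R (Matrix (Fin n) (Fin n) R)).restrictScalars ℂ
  have hS : ∀ f, S f = algebraMap R _ f := fun f => rfl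
  have hevS : ∀ f, ev.mapMatrix (S f) = ev f • 1 := by
    intro f
    ext i j
    simp [hS, Matrix.algebraMap_matrix_apply, Matrix.one_apply, apply_ite ev]
  let D : Matrix (Fin n) (Fin n) ℂ →ₗ[ℂ] Matrix (Fin n) (Fin n) ℂ := δ.comp C.toLinearMap
  have hD : ∀ a b, D (a * b) = D a * b + a * D b := by
    intro a b
    have h := hδ (C a) (C b)
    rw [← map_mul, hevC, hevC] at h
    exact h
  have hγ := matrix_derivation_inner D hD
  set γ := ∑ k, D (Matrix.single k 0 1) * Matrix.single 0 k 1
  have hSc : ∀ f, δ (S f) = (δ (S f) 0 0) • 1 := by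
    intro f
    refine eq_smul_one_of_commute fun a => ?_
    have h1 := hδ (S f) (C a)
    have h2 := hδ (C a) (S f)
    rw [hS, Algebra.commutes, ← hS, h2, hevS, hevC, Matrix.mul_smul, Matrix.smul_mul, mul_one,
      one_mul] at h1
    exact (add_right_cancel (h1.symm.trans (add_comm _ _)))
  let τ : R →ₗ[ℂ] ℂ :=
    { toFun := fun f => δ (S f) 0 0
      map_add' := fun f g => by rw [map_add, map_add]; rfl
      map_smul' := fun a f => by rw [map_smul, map_smul]; rfl }
  have hτS : ∀ f, δ (S f) = τ f • 1 := hSc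
  refine ⟨γ, τ, fun f g => ?_, fun b => ?_⟩
  · have h := hδ (S f) (S g)
    have h1 : S f * S g = S (f * g) := by rw [hS, hS, hS, map_mul]
    rw [h1, hτS, hτS, hτS, hevS, hevS] at h
    have h2 := congrFun (congrFun h 0) 0
    simp at h2
    rw [h2]
    ring
  · have hb : b = ∑ i, ∑ j, S (b i j) * C (Matrix.single i j 1) := by
      conv_lhs => rw [Matrix.matrix_eq_sum_single b]
      refine Finset.sum_congr rfl fun i _ => Finset.sum_congr rfl fun j _ => ?_
      rw [hS, ← Algebra.smul_def]
      ext k l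
      simp [C, Matrix.single_apply, apply_ite (Algebra.ofId ℂ R)]
    have h1 : ∀ i j, δ (S (b i j) * C (Matrix.single i j 1)) = τ (b i j) • Matrix.single i j 1 +
        (γ * ev.mapMatrix (S (b i j) * C (Matrix.single i j 1)) -
          ev.mapMatrix (S (b i j) * C (Matrix.single i j 1)) * γ) := by
      intro i j
      have h2 : δ (C (Matrix.single i j 1)) = _ := hγ (Matrix.single i j 1)
      rw [hδ, hτS, map_mul, hevS, hevC, h2]
      simp only [Matrix.smul_mul, Matrix.mul_smul, one_mul, smul_sub]
    conv_lhs => rw [hb]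
    simp only [map_sum, h1, Finset.sum_add_distrib, Finset.sum_sub_distrib]
    congr 1
    · rw [Matrix.matrix_eq_sum_single (b.map τ)]
      refine Finset.sum_congr rfl fun i _ => Finset.sum_congr rfl fun j _ => ?_
      rw [Matrix.smul_single, smul_eq_mul, mul_one, Matrix.map_apply]
    · conv_rhs => rw [hb]
      simp only [map_sum, Finset.mul_sum, Finset.sum_mul]

end MatrixDerivations

section Invariants

variable {m n : ℕ} {M : Type*} [TopologicalSpace M]
  [ChartedSpace (EuclideanSpace ℝ (Fin m)) M] [IsManifold (𝓡 m) ∞ M]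
  {E : M → Type*} [TopologicalSpace (Bundle.TotalSpace (EuclideanSpace ℂ (Fin n)) E)]
  [∀ x, NormedAddCommGroup (E x)] [∀ x, InnerProductSpace ℂ (E x)]
  [FiberBundle (EuclideanSpace ℂ (Fin n)) E] [VectorBundle ℂ (EuclideanSpace ℂ (Fin n)) E]
  {o : BundleOrientation (m := m) n E} [IsSmoothHermitianBundle (m := m) n E] [NeZero n]

omit [NeZero n] in
lemma su_mul_star (g : Matrix.specialUnitaryGroup (Fin n) ℂ) :
    (g : Matrix (Fin n) (Fin n) ℂ) * star (g : Matrix (Fin n) (Fin n) ℂ) = 1 :=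
  Matrix.mem_unitaryGroup_iff.1 (Matrix.mem_specialUnitaryGroup_iff.1 g.2).1

omit [NeZero n] in
lemma su_star_mul (g : Matrix.specialUnitaryGroup (Fin n) ℂ) :
    star (g : Matrix (Fin n) (Fin n) ℂ) * (g : Matrix (Fin n) (Fin n) ℂ) = 1 :=
  Matrix.mem_unitaryGroup_iff'.1 (Matrix.mem_specialUnitaryGroup_iff.1 g.2).1

lemma vertDer_eq_zero_of_equivariant {b : MatAlg o} (hb : Equivariant b) (A : su n) :
    (vertDer o A : Module.End ℂ (MatAlg o)) b = 0 := by
  refine matAlg_ext fun p => ?_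
  rw [evalHom_vertDer, map_zero]
  ext i j
  have h1 := (vertCurves o A).hasDerivAt_evalHom b p i j
  have h2 : ∀ t, evalHom ((vertCurves o A).c p t) b =
      star (expSU A t : Matrix (Fin n) (Fin n) ℂ) * evalHom p b * expSU A t := fun t => hb p _
  simp only [h2] at h1
  have h3 := hasDerivAt_mul_entries (hasDerivAt_mul_entries (hasDerivAt_star_expSU A 0)
    (Y := fun _ => evalHom p b) (Y' := 0)
    (fun i j => hasDerivAt_const (0 : ℝ) (evalHom p b i j))) (hasDerivAt_expSU A 0) i j
  rw [Matrix.add_apply, h1.unique h3, expSU_zero, ← Matrix.add_apply, Submonoid.coe_one, star_one]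
  refine congrFun (congrFun (?_ : _ = (0 : Matrix (Fin n) (Fin n) ℂ)) i) j
  noncomm_ring

/-- With g(t) = exp(tA), the function g(t) b(p g(t)) g(t)* has derivative zero and is constant.
Every element of SU(n) is some g(1). -/
lemma equivariant_of_vertDer_eq_zero {b : MatAlg o}
    (hb : ∀ A : su n, (vertDer o A : Module.End ℂ (MatAlg o)) b = 0) : Equivariant b := by
  intro p g
  obtain ⟨A, rfl⟩ := exists_expSU_eq g
  have hN : ∀ t i j, HasDerivAt (fun s => evalHom (p.act (expSU A s)) b i j)
      ((evalHom (p.act (expSU A t)) b * (A : Matrix (Fin n) (Fin n) ℂ) -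
        (A : Matrix (Fin n) (Fin n) ℂ) * evalHom (p.act (expSU A t)) b) i j) t := by
    intro t i j
    have h1 := (vertCurves o A).hasDerivAt_evalHom b (p.act (expSU A t)) i j
    have h2 := evalHom_vertDer A b (p.act (expSU A t))
    rw [hb, map_zero] at h2
    have h3 : evalHom (p.act (expSU A t)) b * (A : Matrix (Fin n) (Fin n) ℂ) -
        (A : Matrix (Fin n) (Fin n) ℂ) * evalHom (p.act (expSU A t)) b =
        evalHom (p.act (expSU A t)) ((mapDer n (vertCurves o A).der : Module.End ℂ (MatAlg o)) b) := by
      rw [← sub_eq_zero, ← neg_eq_zero, h2]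
      abel
    rw [h3]
    have h4 : ∀ s, (vertCurves o A).c (p.act (expSU A t)) s = p.act (expSU A (t + s)) := by
      intro s
      rw [expSU_add, ← FrameBundle.act_act]
      rfl
    simp only [h4] at h1
    have h5 := HasDerivAt.comp_sub_const (x := t) (a := t)
      (f := fun s => evalHom (p.act (expSU A (t + s))) b i j) (by rw [sub_self]; exact h1)
    simpa using h5
  let F : ℝ → Matrix (Fin n) (Fin n) ℂ := fun t => (expSU A t : Matrix (Fin n) (Fin n) ℂ) *
    evalHom (p.act (expSU A t)) b * star (expSU A t : Matrix (Fin n) (Fin n) ℂ)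
  have hF : ∀ i j t, HasDerivAt (fun s => F s i j) 0 t := by
    intro i j t
    have h := hasDerivAt_mul_entries (hasDerivAt_mul_entries (hasDerivAt_expSU A t) (hN t))
      (hasDerivAt_star_expSU A t) i j
    convert h using 1
    have h0 : ((expSU A t : Matrix (Fin n) (Fin n) ℂ) * (A : Matrix (Fin n) (Fin n) ℂ) *
        evalHom (p.act (expSU A t)) b + (expSU A t : Matrix (Fin n) (Fin n) ℂ) *
        (evalHom (p.act (expSU A t)) b * (A : Matrix (Fin n) (Fin n) ℂ) -
        (A : Matrix (Fin n) (Fin n) ℂ) * evalHom (p.act (expSU A t)) b)) *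
        star (expSU A t : Matrix (Fin n) (Fin n) ℂ) + (expSU A t : Matrix (Fin n) (Fin n) ℂ) *
        evalHom (p.act (expSU A t)) b *
        -((A : Matrix (Fin n) (Fin n) ℂ) * star (expSU A t : Matrix (Fin n) (Fin n) ℂ)) = 0 := by
      noncomm_ring
    rw [h0]
    rfl
  have hF1 : F 1 = F 0 := by
    ext i j
    exact is_const_of_deriv_eq_zero (fun t => (hF i j t).differentiableAt)
      (fun t => (hF i j t).deriv) 1 0
  have h0 : F 0 = evalHom p b := by
    simp only [F, expSU_zero, FrameBundle.act_one]
    simp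
  rw [← h0, ← hF1]
  change _ = star (expSU A 1 : Matrix (Fin n) (Fin n) ℂ) * ((expSU A 1 : Matrix (Fin n) (Fin n) ℂ) *
    evalHom (p.act (expSU A 1)) b * star (expSU A 1 : Matrix (Fin n) (Fin n) ℂ)) * expSU A 1
  have h1 := su_star_mul (expSU A 1)
  simp only [← mul_assoc]
  rw [h1, one_mul, mul_assoc, h1, mul_one]

end Invariants

end DerCalc

end

noncomputable section

namespace DerCalc

open Filter Topology

/-! ### Derivations that vanish on equivariant functions are vertical. -/

section ColorMatrices

variable {m n : ℕ} {M : Type*} [TopologicalSpace M]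
  [ChartedSpace (EuclideanSpace ℝ (Fin m)) M] [IsManifold (𝓡 m) ∞ M]
  {E : M → Type*} [TopologicalSpace (Bundle.TotalSpace (EuclideanSpace ℂ (Fin n)) E)]
  [∀ x, NormedAddCommGroup (E x)] [∀ x, InnerProductSpace ℂ (E x)]
  [FiberBundle (EuclideanSpace ℂ (Fin n)) E] [VectorBundle ℂ (EuclideanSpace ℂ (Fin n)) E]
  {o : BundleOrientation (m := m) n E} [IsSmoothHermitianBundle (m := m) n E] [NeZero n]

namespace Color

variable (c : Color o)

/-- The matrix of a frame in the local frame chosen by the color. -/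
def gmat (q : FrameBundle o) : Matrix (Fin n) (Fin n) ℂ := Matrix.of (c.κ q).2

/-- The cut off matrix function `χ g`. -/
def G : MatAlg o := Matrix.of fun i j => c.pull (coordG m n i j)

/-- The cut off matrix function `χ g*`. -/
def Gst : MatAlg o := Matrix.of fun i j => c.pull (coordGbar m n j i)

/-- The equivariant function `χ² g* C g`. -/
def e : Matrix (Fin n) (Fin n) ℂ →ₗ[ℂ] MatAlg o :=
  (LinearMap.mulLeft ℂ c.Gst ∘ₗ LinearMap.mulRight ℂ c.G) ∘ₗ (constMat o).toLinearMap

lemma e_apply (C : Matrix (Fin n) (Fin n) ℂ) : c.e C = c.Gst * (constMat o C * c.G) := rfl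

/-- A smooth function of the coordinates of the base point. -/
def _root_.DerCalc.baseCoord : SmoothSub (EuclideanSpace ℝ (Fin m)) →ₗ[ℂ] SmoothSub (CoordSp m n) where
  toFun H := ⟨fun z => H.1 z.1,
    (ContDiff.comp (H.2 : ContDiff ℝ ∞ H.1) contDiff_fst : ContDiff ℝ ∞ fun z : CoordSp m n => H.1 z.1)⟩
  map_add' _ _ := rfl
  map_smul' _ _ := rfl

/-- The cut off scalar matrix function `χ H(y)`. -/
def f : SmoothSub (EuclideanSpace ℝ (Fin m)) →ₗ[ℂ] MatAlg o :=
  (Algebra.linearMap (SmoothFun o) (MatAlg o)).restrictScalars ℂ ∘ₗ c.pull ∘ₗ baseCoord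

lemma f_apply (H : SmoothSub (EuclideanSpace ℝ (Fin m))) :
    c.f H = algebraMap (SmoothFun o) (MatAlg o) (c.pull (baseCoord H)) := rfl

lemma evalHom_algebraMap (q : FrameBundle o) (h : SmoothFun o) :
    evalHom q (algebraMap (SmoothFun o) (MatAlg o) h) = h.1 q • 1 := by
  ext i j
  rw [evalHom_apply_apply, Matrix.algebraMap_matrix_apply, Matrix.smul_apply, Matrix.one_apply]
  by_cases h : i = j
  · simp [h]
  · simp [h]

lemma evalHom_G (q : FrameBundle o) : evalHom q c.G = (c.χ q.base : ℂ) • c.gmat q := rfl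

lemma evalHom_Gst (q : FrameBundle o) : evalHom q c.Gst = (c.χ q.base : ℂ) • star (c.gmat q) := rfl

lemma evalHom_e (q : FrameBundle o) (C : Matrix (Fin n) (Fin n) ℂ) :
    evalHom q (c.e C) = ((c.χ q.base : ℂ) * (c.χ q.base : ℂ)) •
      (star (c.gmat q) * C * c.gmat q) := by
  rw [e_apply, map_mul, map_mul, evalHom_G, evalHom_Gst, evalHom_constMat]
  simp only [Matrix.smul_mul, Matrix.mul_smul, smul_smul, mul_assoc]

lemma evalHom_f (q : FrameBundle o) (H : SmoothSub (EuclideanSpace ℝ (Fin m))) :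
    evalHom q (c.f H) = ((c.χ q.base : ℂ) * H.1 (c.κ q).1) • 1 := by
  rw [f_apply, evalHom_algebraMap]
  rfl

omit [IsManifold (𝓡 m) ∞ M] [IsSmoothHermitianBundle (m := m) n E] [NeZero n] in
lemma exists_gmat_eq {q : FrameBundle o} (hq : q.base ∈ c.O) :
    ∃ g : Matrix.specialUnitaryGroup (Fin n) ℂ, c.gmat q = g := by
  obtain ⟨g, hg⟩ := LFrame.exists_frame_act (c.mem _ hq)
  refine ⟨g, ?_⟩
  have h : (c.lam q.base).κ q = (c.lam q.base).κ (((c.lam q.base).frame q.base (c.mem _ hq)).act g) :=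
    congrArg _ hg
  rw [gmat, κ, h, LFrame.κ_frame_act]
  rfl

omit [IsManifold (𝓡 m) ∞ M] [IsSmoothHermitianBundle (m := m) n E] [NeZero n] in
lemma gmat_act (q : FrameBundle o) (g : Matrix.specialUnitaryGroup (Fin n) ℂ) :
    c.gmat (q.act g) = c.gmat q * g := by
  have h : c.κ (q.act g) = (c.lam q.base).κ (q.act g) := rfl
  rw [gmat, h, LFrame.κ_act]
  rfl

lemma equivariant_e (C : Matrix (Fin n) (Fin n) ℂ) : Equivariant (c.e C) := by
  intro q g
  rw [evalHom_e, evalHom_e, gmat_act, star_mul, Matrix.mul_smul, Matrix.smul_mul]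
  simp only [mul_assoc]
  rfl

lemma equivariant_f (H : SmoothSub (EuclideanSpace ℝ (Fin m))) : Equivariant (c.f H) := by
  intro q g
  have h : (c.κ (q.act g)).1 = (c.κ q).1 := rfl
  rw [evalHom_f, evalHom_f, h, Matrix.mul_smul, Matrix.smul_mul, mul_one, su_star_mul]
  rfl

end Color

lemma vertCurves_pull {c : Color o} {p : FrameBundle o} (hc : ∀ᶠ x in 𝓝 p.base, c.χ x = 1)
    (A : su n) (H : SmoothSub (CoordSp m n)) :
    (((vertCurves o A).der : Module.End ℂ _) (c.pull H)).1 p =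
      fderiv ℝ H.1 (c.κ p) (vertVec (A : Matrix (Fin n) (Fin n) ℂ) (c.κ p)) := by
  have hp1 : c.χ p.base = 1 := hc.self_of_nhds
  have hpO : p.base ∈ c.O := c.mem_of_χ_ne (by rw [hp1]; exact one_ne_zero)
  have hH : ContDiff ℝ ∞ H.1 := H.2
  exact vertCurves_der_apply (c.mem _ hpO) (hH.differentiable (by simp)) (c.pull_germ hc H) A

lemma vertCurves_pull_clm {c : Color o} {p : FrameBundle o} (hc : ∀ᶠ x in 𝓝 p.base, c.χ x = 1)
    (A : su n) {H : SmoothSub (CoordSp m n)} (l : CoordSp m n →L[ℝ] ℂ) (hl : H.1 = l) :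
    (((vertCurves o A).der : Module.End ℂ _) (c.pull H)).1 p =
      l (vertVec (A : Matrix (Fin n) (Fin n) ℂ) (c.κ p)) := by
  rw [vertCurves_pull hc, hl, l.fderiv]

lemma vertCurves_coordY {c : Color o} {p : FrameBundle o} (hc : ∀ᶠ x in 𝓝 p.base, c.χ x = 1)
    (A : su n) (i : Fin m) :
    (((vertCurves o A).der : Module.End ℂ _) (c.pull (coordY m n i))).1 p = 0 := by
  refine (vertCurves_pull_clm hc A (Complex.ofRealCLM.comp
    ((EuclideanSpace.proj (𝕜 := ℝ) i).comp (ContinuousLinearMap.fst ℝ _ _))) rfl).trans ?_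
  simp [vertVec_apply]

lemma vertCurves_coordG {c : Color o} {p : FrameBundle o} (hc : ∀ᶠ x in 𝓝 p.base, c.χ x = 1)
    (A : su n) (i j : Fin n) :
    (((vertCurves o A).der : Module.End ℂ _) (c.pull (coordG m n i j))).1 p =
      (c.gmat p * (A : Matrix (Fin n) (Fin n) ℂ)) i j :=
  vertCurves_pull_clm hc A ((ContinuousLinearMap.proj (R := ℝ) (φ := fun _ : Fin n => ℂ) j).comp
    ((ContinuousLinearMap.proj (R := ℝ) (φ := fun _ : Fin n => Fin n → ℂ) i).comp
    (ContinuousLinearMap.snd ℝ (EuclideanSpace ℝ (Fin m)) (Fin n → Fin n → ℂ)))) rfl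

lemma vertCurves_coordGbar {c : Color o} {p : FrameBundle o} (hc : ∀ᶠ x in 𝓝 p.base, c.χ x = 1)
    (A : su n) (i j : Fin n) :
    (((vertCurves o A).der : Module.End ℂ _) (c.pull (coordGbar m n i j))).1 p =
      (-((A : Matrix (Fin n) (Fin n) ℂ) * star (c.gmat p))) j i := by
  have h2 : star (A : Matrix (Fin n) (Fin n) ℂ) = -(A : Matrix (Fin n) (Fin n) ℂ) := A.2.1
  have h3 : -((A : Matrix (Fin n) (Fin n) ℂ) * star (c.gmat p)) =
      star (c.gmat p * (A : Matrix (Fin n) (Fin n) ℂ)) := by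
    rw [star_mul, h2, neg_mul]
  rw [h3]
  exact vertCurves_pull_clm hc A ((Complex.conjCLE : ℂ →L[ℝ] ℂ).comp
    ((ContinuousLinearMap.proj (R := ℝ) (φ := fun _ : Fin n => ℂ) j).comp
    ((ContinuousLinearMap.proj (R := ℝ) (φ := fun _ : Fin n => Fin n → ℂ) i).comp
    (ContinuousLinearMap.snd ℝ (EuclideanSpace ℝ (Fin m)) (Fin n → Fin n → ℂ))))) rfl

variable [T2Space M] [SecondCountableTopology M]

/-- Γ is g* τ(g), with g the matrix coordinate. Differentiating g*g = 1 gives τ(g*), and det g = 1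
gives trace zero. The vanishing on the equivariant functions g*Cg for all C forces γ - Γ to commute
with everything. As τ is only complex linear, Γ need not be skew. -/
lemma exists_trace_zero {p : FrameBundle o} {γ : Matrix (Fin n) (Fin n) ℂ}
    {τ : SmoothFun o →ₗ[ℂ] ℂ} (hτ : ∀ f g, τ (f * g) = pointEval p f * τ g + pointEval p g * τ f)
    {c : Color o} (hc : ∀ᶠ x in 𝓝 p.base, c.χ x = 1)
    (hY : ∀ C, (c.e C).map τ + (γ * evalHom p (c.e C) - evalHom p (c.e C) * γ) = 0) :
    ∃ Γ : Matrix (Fin n) (Fin n) ℂ, Γ.trace = 0 ∧ c.G.map τ = c.gmat p * Γ ∧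
      c.Gst.map τ = -(Γ * star (c.gmat p)) ∧ γ = (γ - Γ) 0 0 • 1 + Γ := by
  have hτ' : ∀ f g, τ (f * g) = f.1 p * τ g + g.1 p * τ f := hτ
  have hp1 : c.χ p.base = 1 := hc.self_of_nhds
  have hpO : p.base ∈ c.O := c.mem_of_χ_ne (by rw [hp1]; exact one_ne_zero)
  have hps := c.mem _ hpO
  obtain ⟨g, hg⟩ := c.exists_gmat_eq hpO
  have hGp : evalHom p c.G = g := by rw [c.evalHom_G, hp1, hg]; simp
  have hGstp : evalHom p c.Gst = star (g : Matrix (Fin n) (Fin n) ℂ) := by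
    rw [c.evalHom_Gst, hp1, hg]; simp
  have hmul : ∀ X X' : MatAlg o, (X * X').map τ = X.map τ * evalHom p X' + evalHom p X * X'.map τ :=
    map_derivation_mul hτ
  have hcst : ∀ C : Matrix (Fin n) (Fin n) ℂ, (constMat o C).map τ = 0 := fun C =>
    Matrix.ext fun i j => map_derivation_algebraMap hτ (C i j)
  have hloc : ∀ X X' : MatAlg o, (∀ᶠ x in 𝓝 p.base, ∀ q : FrameBundle o, q.base = x →
      evalHom q X = evalHom q X') → X.map τ = X'.map τ := by
    intro X X' h
    ext i j
    refine pointDerivation_congr hτ' hps ?_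
    filter_upwards [(LFrame.tendsto_base hps).eventually h] with q hq
    exact congrFun (congrFun (hq q rfl) i) j
  generalize hT : c.G.map τ = T at *
  generalize hS : c.Gst.map τ = S at *
  obtain ⟨Γ, hΓ⟩ : ∃ Γ, Γ = star (g : Matrix (Fin n) (Fin n) ℂ) * T := ⟨_, rfl⟩
  have hTΓ : T = g * Γ := by rw [hΓ, ← mul_assoc, su_mul_star, one_mul]
  have hSΓ : S = -(Γ * star (g : Matrix (Fin n) (Fin n) ℂ)) := by
    have h1 : (c.Gst * c.G).map τ = (1 : MatAlg o).map τ := by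
      refine hloc _ _ ?_
      filter_upwards [hc] with x hx q hq
      subst hq
      have hqO : q.base ∈ c.O := c.mem_of_χ_ne (by rw [hx]; exact one_ne_zero)
      obtain ⟨g', hg'⟩ := c.exists_gmat_eq hqO
      rw [map_mul, map_one, c.evalHom_G, c.evalHom_Gst, hx, hg']
      simp [su_star_mul]
    have h2 : (1 : MatAlg o).map τ = 0 := by
      rw [← map_one (constMat o), hcst]
    rw [hmul, hGp, hGstp, h2, hS, hT, ← hΓ] at h1
    have h3 : S * g * star (g : Matrix (Fin n) (Fin n) ℂ) =
        -(Γ * star (g : Matrix (Fin n) (Fin n) ℂ)) := by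
      rw [eq_neg_of_add_eq_zero_left h1, neg_mul]
    rwa [mul_assoc, su_mul_star, mul_one] at h3
  have hcomm : ∀ C : Matrix (Fin n) (Fin n) ℂ, (γ - Γ) * C = C * (γ - Γ) := by
    intro C
    -- The constant is conjugated by g so that the equivariant function takes the value C at p.
    have h1 := hY ((g : Matrix (Fin n) (Fin n) ℂ) * C *
      star (g : Matrix (Fin n) (Fin n) ℂ))
    have h2 : evalHom p (c.e ((g : Matrix (Fin n) (Fin n) ℂ) * C *
        star (g : Matrix (Fin n) (Fin n) ℂ))) = C := by
      rw [c.evalHom_e, hp1, hg]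
      simp only [← mul_assoc]
      rw [su_star_mul, one_mul, mul_assoc, su_star_mul]
      simp
    rw [h2, c.e_apply, hmul, hmul, hcst, map_mul, evalHom_constMat, hGp, hGstp, hS, hT,
      hSΓ, hTΓ] at h1
    have h3 : -(Γ * star (g : Matrix (Fin n) (Fin n) ℂ)) *
        ((g : Matrix (Fin n) (Fin n) ℂ) * C * star (g : Matrix (Fin n) (Fin n) ℂ) * g) =
        -(Γ * C) := by
      rw [mul_assoc ((g : Matrix (Fin n) (Fin n) ℂ) * C), su_star_mul, mul_one, neg_mul, mul_assoc,
        ← mul_assoc (star (g : Matrix (Fin n) (Fin n) ℂ)), su_star_mul, one_mul]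
    have h4 : star (g : Matrix (Fin n) (Fin n) ℂ) * (0 * (g : Matrix (Fin n) (Fin n) ℂ) +
        (g : Matrix (Fin n) (Fin n) ℂ) * C * star (g : Matrix (Fin n) (Fin n) ℂ) * (g * Γ)) =
        C * Γ := by
      rw [zero_mul, zero_add, ← mul_assoc _ (g : Matrix (Fin n) (Fin n) ℂ) Γ,
        mul_assoc _ (star (g : Matrix (Fin n) (Fin n) ℂ)), su_star_mul, mul_one, mul_assoc,
        ← mul_assoc (star (g : Matrix (Fin n) (Fin n) ℂ)), su_star_mul, one_mul]
    rw [h3, h4] at h1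
    rw [← sub_eq_zero, ← h1]
    noncomm_ring
  have hγ := eq_smul_one_of_commute hcomm
  have htr : Γ.trace = 0 := by
    have h1 : (constMat o (star (g : Matrix (Fin n) (Fin n) ℂ)) * c.G).map τ = Γ := by
      rw [hmul, hcst, zero_mul, zero_add, evalHom_constMat, hT, hΓ]
    have h2 := map_derivation_det (ev := pointEval p) hτ
      (X := constMat o (star (g : Matrix (Fin n) (Fin n) ℂ)) * c.G) (by
        change evalHom p _ = 1
        rw [map_mul, evalHom_constMat, hGp, su_star_mul])
    rw [h1] at h2
    rw [← h2]
    have h3 : τ 1 = 0 := by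
      rw [← map_one (algebraMap ℂ (SmoothFun o))]
      exact map_derivation_algebraMap hτ 1
    rw [← h3]
    refine pointDerivation_congr hτ' hps ?_
    filter_upwards [(LFrame.tendsto_base hps).eventually hc] with q hq
    have hqO : q.base ∈ c.O := c.mem_of_χ_ne (by rw [hq]; exact one_ne_zero)
    obtain ⟨g', hg'⟩ := c.exists_gmat_eq hqO
    have h4 := (pointEval q).map_det (constMat o (star (g : Matrix (Fin n) (Fin n) ℂ)) * c.G)
    refine h4.trans ?_
    change (evalHom q _).det = 1
    rw [map_mul, evalHom_constMat, c.evalHom_G, hq, hg', Matrix.det_mul, Complex.ofReal_one,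
      one_smul]
    have h5 : ∀ h : Matrix.specialUnitaryGroup (Fin n) ℂ, (h : Matrix (Fin n) (Fin n) ℂ).det = 1 :=
      fun h => (Matrix.mem_specialUnitaryGroup_iff.1 h.2).2
    rw [h5, Matrix.star_eq_conjTranspose, Matrix.det_conjTranspose, h5]
    simp
  refine ⟨Γ, htr, ?_, ?_, sub_eq_iff_eq_add.1 hγ⟩
  · rw [hg, hTΓ]
  · rw [hg, hSΓ]

/-- Both sides are point derivations, so it is enough to compare them on the coordinates y, g and
the conjugate of g. The last are independent data because Γ is not skew. -/
lemma pointDerivation_eq_vert {p : FrameBundle o} {τ : SmoothFun o →ₗ[ℂ] ℂ}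
    (hτ : ∀ f g, τ (f * g) = f.1 p * τ g + g.1 p * τ f) {c : Color o}
    (hc : ∀ᶠ x in 𝓝 p.base, c.χ x = 1) (hY : ∀ i, τ (c.pull (coordY m n i)) = 0) {A B : su n}
    {Γ : Matrix (Fin n) (Fin n) ℂ}
    (hAB : Γ = (A : Matrix (Fin n) (Fin n) ℂ) + Complex.I • (B : Matrix (Fin n) (Fin n) ℂ))
    (hG : c.G.map τ = c.gmat p * Γ) (hG' : c.Gst.map τ = -(Γ * star (c.gmat p)))
    (f : SmoothFun o) : τ f = (((vertCurves o A).der : Module.End ℂ _) f).1 p +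
      Complex.I * (((vertCurves o B).der : Module.End ℂ _) f).1 p := by
  obtain ⟨τ₁, hτ₁⟩ : ∃ τ₁ : SmoothFun o →ₗ[ℂ] ℂ, ∀ f, τ₁ f =
    (((vertCurves o A).der : Module.End ℂ _) f).1 p :=
    ⟨(pointEval p).toLinearMap ∘ₗ ((vertCurves o A).der : Module.End ℂ _), fun _ => rfl⟩
  obtain ⟨τ₂, hτ₂⟩ : ∃ τ₂ : SmoothFun o →ₗ[ℂ] ℂ, ∀ f, τ₂ f =
    (((vertCurves o B).der : Module.End ℂ _) f).1 p :=
    ⟨(pointEval p).toLinearMap ∘ₗ ((vertCurves o B).der : Module.End ℂ _), fun _ => rfl⟩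
  have hvert : ∀ (X : Der (SmoothFun o)) (f g : SmoothFun o),
      ((X : Module.End ℂ _) (f * g)).1 p = f.1 p * ((X : Module.End ℂ _) g).1 p +
        g.1 p * ((X : Module.End ℂ _) f).1 p := by
    intro X f g
    rw [der_leibniz]
    change ((X : Module.End ℂ _) f).1 p * g.1 p + f.1 p * ((X : Module.End ℂ _) g).1 p = _
    ring
  rw [← hτ₁, ← hτ₂]
  refine sub_eq_zero.1 (pointDerivation_smoothFun_eq_zero (p := p)
    (τ := τ - (τ₁ + Complex.I • τ₂)) ?_ c hc ?_ ?_ ?_ f)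
  · intro f g
    have h1 : τ₁ (f * g) = f.1 p * τ₁ g + g.1 p * τ₁ f := by
      rw [hτ₁, hτ₁, hτ₁, hvert]
    have h2 : τ₂ (f * g) = f.1 p * τ₂ g + g.1 p * τ₂ f := by
      rw [hτ₂, hτ₂, hτ₂, hvert]
    simp only [LinearMap.sub_apply, LinearMap.add_apply, LinearMap.smul_apply, hτ, h1, h2,
      smul_eq_mul]
    ring
  · intro i
    simp only [LinearMap.sub_apply, LinearMap.add_apply, LinearMap.smul_apply, hτ₁, hτ₂, hY,
      vertCurves_coordY hc]
    simp
  · intro i j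
    have h3 : τ (c.pull (coordG m n i j)) = (c.gmat p * Γ) i j := by
      rw [← hG]
      rfl
    simp only [LinearMap.sub_apply, LinearMap.add_apply, LinearMap.smul_apply, hτ₁, hτ₂,
      vertCurves_coordG hc, h3, hAB]
    rw [mul_add, Matrix.mul_smul, Matrix.add_apply, Matrix.smul_apply, sub_self]
  · intro i j
    have h3 : τ (c.pull (coordGbar m n i j)) = (-(Γ * star (c.gmat p))) j i := by
      rw [← hG']
      rfl
    simp only [LinearMap.sub_apply, LinearMap.add_apply, LinearMap.smul_apply, hτ₁, hτ₂,
      vertCurves_coordGbar hc, h3, hAB]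
    rw [add_mul, Matrix.smul_mul, Matrix.neg_apply, Matrix.neg_apply, Matrix.neg_apply,
      Matrix.add_apply, Matrix.smul_apply, smul_neg]
    ring

/-- A derivation that annihilates the equivariant functions at a point is vertical there. -/
lemma exists_vertical {p : FrameBundle o} (Y : Der (MatAlg o))
    (hY : ∀ b : MatAlg o, Equivariant b → evalHom p ((Y : Module.End ℂ (MatAlg o)) b) = 0) :
    ∃ A B : su n, ∀ b : MatAlg o, evalHom p ((Y : Module.End ℂ (MatAlg o)) b) =
      evalHom p ((vertDer o A : Module.End ℂ (MatAlg o)) b) +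
      Complex.I • evalHom p ((vertDer o B : Module.End ℂ (MatAlg o)) b) := by
  obtain ⟨γ, τ, hτ, hδ⟩ := exists_matrix_pointDerivation (pointEval p)
    ((evalHom p).toLinearMap ∘ₗ (Y : Module.End ℂ (MatAlg o))) (by
      intro a b
      rw [LinearMap.comp_apply, der_leibniz]
      exact (map_add (evalHom p) _ _).trans
        (congrArg₂ _ (map_mul (evalHom p) _ _) (map_mul (evalHom p) _ _)))
  replace hδ : ∀ b : MatAlg o, evalHom p ((Y : Module.End ℂ (MatAlg o)) b) =
    b.map τ + (γ * evalHom p b - evalHom p b * γ) := hδ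
  have hτ' : ∀ f g, τ (f * g) = f.1 p * τ g + g.1 p * τ f := hτ
  obtain ⟨Λ, hΛ⟩ := LFrame.exists_mem o p.base
  obtain ⟨c, -, -, hc⟩ := exists_color Λ hΛ
  obtain ⟨Γ, htr, hG, hG', hγ⟩ := exists_trace_zero (γ := γ) hτ hc fun C => by
    rw [← hδ, hY _ (c.equivariant_e C)]
  obtain ⟨A, B, hAB⟩ := exists_su_add_I_smul Γ htr
  refine ⟨A, B, fun b => ?_⟩
  have hYc : ∀ i, τ (c.pull (coordY m n i)) = 0 := by
    intro i
    -- Functions of the base point are scalar, hence equivariant and unaffected by the inner part;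
    -- so τ vanishes on the base coordinates.
    have h3 := hY _ (c.equivariant_f (linSmooth (EuclideanSpace.proj (𝕜 := ℝ) i)))
    rw [hδ, c.evalHom_f, Matrix.mul_smul, Matrix.smul_mul, mul_one, one_mul, sub_self,
      add_zero] at h3
    have h5 := congrFun (congrFun h3 0) 0
    rw [Matrix.map_apply, c.f_apply, Matrix.algebraMap_matrix_apply, if_pos rfl] at h5
    exact h5
  have h1 : b.map τ = evalHom p ((mapDer n (vertCurves o A).der : Module.End ℂ (MatAlg o)) b) +
      Complex.I • evalHom p ((mapDer n (vertCurves o B).der : Module.End ℂ (MatAlg o)) b) :=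
    Matrix.ext fun i j => pointDerivation_eq_vert hτ' hc hYc hAB hG hG' (b i j)
  rw [hδ, evalHom_vertDer, evalHom_vertDer, h1, hγ, hAB]
  simp only [add_mul, mul_add, Matrix.smul_mul, Matrix.mul_smul, one_mul, mul_one, smul_add,
    smul_sub]
  abel

end ColorMatrices

end DerCalc

end

noncomputable section

namespace DerCalc

open Filter Topology

/-! ### Equivariant lifts of the coordinate vector fields. -/

section HorizontalLifts

variable {m n : ℕ} {M : Type*} [TopologicalSpace M]
  [ChartedSpace (EuclideanSpace ℝ (Fin m)) M] [IsManifold (𝓡 m) ∞ M]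
  {E : M → Type*} [TopologicalSpace (Bundle.TotalSpace (EuclideanSpace ℂ (Fin n)) E)]
  [∀ x, NormedAddCommGroup (E x)] [∀ x, InnerProductSpace ℂ (E x)]
  [FiberBundle (EuclideanSpace ℂ (Fin n)) E] [VectorBundle ℂ (EuclideanSpace ℂ (Fin n)) E]
  {o : BundleOrientation (m := m) n E}

omit [IsManifold (𝓡 m) ∞ M] in
lemma LFrame.κ_injOn {Λ : LFrame o} {q q' : FrameBundle o} (hq : q.base ∈ Λ.φ.source)
    (hq' : q'.base ∈ Λ.φ.source) (h : Λ.κ q = Λ.κ q') : q = q' := by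
  have hb : q.base = q'.base := Λ.φ.injOn hq hq' (congrArg Prod.fst h)
  have hv := @LFrame.vec_eq _ _ _ _ _ _ _ _ _ _ _ _ Λ q hq
  have hv' := @LFrame.vec_eq _ _ _ _ _ _ _ _ _ _ _ _ Λ q' hq'
  rw [h] at hv
  obtain ⟨x, u, h1, h2⟩ := q
  obtain ⟨x', u', h1', h2'⟩ := q'
  dsimp only at hb
  subst hb
  exact FrameBundle.ext_vec (funext fun j => (hv j).trans (hv' j).symm)

namespace Color

variable (c : Color o)

open Classical in
/-- The curve in the frame bundle, with constant matrix, over the coordinate line in direction `i`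
traversed with speed `χ`. -/
def lift (i : Fin m) (q : FrameBundle o) (t : ℝ) : FrameBundle o :=
  if h : c.χ q.base ≠ 0 ∧ (c.κ q).1 + (t * c.χ q.base) • EuclideanSpace.single i (1 : ℝ) ∈
      (c.lam q.base).φ.target then
    ((c.lam q.base).frame ((c.lam q.base).φ.symm
      ((c.κ q).1 + (t * c.χ q.base) • EuclideanSpace.single i (1 : ℝ)))
      ((c.lam q.base).φ.map_target h.2)).act (LFrame.exists_frame_act (c.mem _ (c.mem_of_χ_ne h.1))).choose
  else q

omit [IsManifold (𝓡 m) ∞ M] in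
lemma lift_of_χ_eq_zero (i : Fin m) {q : FrameBundle o} (h : c.χ q.base = 0) (t : ℝ) :
    c.lift i q t = q := dif_neg fun h' => h'.1 h

omit [IsManifold (𝓡 m) ∞ M] in
lemma κ_lift (i : Fin m) {q : FrameBundle o} {t : ℝ} (h : c.χ q.base ≠ 0)
    (ht : (c.κ q).1 + (t * c.χ q.base) • EuclideanSpace.single i (1 : ℝ) ∈
      (c.lam q.base).φ.target) :
    (c.lift i q t).base ∈ (c.lam q.base).φ.source ∧ (c.lam q.base).κ (c.lift i q t) =
      ((c.κ q).1 + (t * c.χ q.base) • EuclideanSpace.single i (1 : ℝ), (c.κ q).2) := by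
  have hO := c.mem_of_χ_ne h
  have hg := (LFrame.exists_frame_act (c.mem _ hO)).choose_spec
  rw [lift, dif_pos ⟨h, ht⟩]
  refine ⟨(c.lam q.base).φ.map_target ht, ?_⟩
  rw [LFrame.κ_frame_act, (c.lam q.base).φ.right_inv ht]
  refine Prod.ext rfl ?_
  have h1 : c.κ q = (c.lam q.base).κ (((c.lam q.base).frame q.base (c.mem _ hO)).act
    (LFrame.exists_frame_act (c.mem _ hO)).choose) := congrArg (c.lam q.base).κ hg
  rw [LFrame.κ_frame_act] at h1
  exact (congrArg Prod.snd h1).symm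

omit [IsManifold (𝓡 m) ∞ M] in
lemma lift_zero (i : Fin m) (q : FrameBundle o) : c.lift i q 0 = q := by
  by_cases h : c.χ q.base = 0
  · exact c.lift_of_χ_eq_zero i h 0
  · have hO := c.mem_of_χ_ne h
    have h0 : (c.κ q).1 + ((0 : ℝ) * c.χ q.base) • EuclideanSpace.single i (1 : ℝ) = (c.κ q).1 := by
      rw [zero_mul, zero_smul, add_zero]
    have h1 : (c.κ q).1 ∈ (c.lam q.base).φ.target := (c.lam q.base).φ.map_source (c.mem _ hO)
    have h2 := c.κ_lift i (t := 0) h (by rwa [h0])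
    rw [h0] at h2
    exact LFrame.κ_injOn h2.1 (c.mem _ hO) h2.2

omit [IsManifold (𝓡 m) ∞ M] in
lemma eventually_κ_lift (i : Fin m) {q : FrameBundle o} (hq : q.base ∈ c.O) :
    ∀ᶠ t in 𝓝 (0 : ℝ), (c.lift i q t).base ∈ (c.lam q.base).φ.source ∧
      (c.lam q.base).κ (c.lift i q t) =
      ((c.κ q).1 + (t * c.χ q.base) • EuclideanSpace.single i (1 : ℝ), (c.κ q).2) := by
  by_cases h : c.χ q.base = 0
  · refine Eventually.of_forall fun t => ?_
    rw [c.lift_of_χ_eq_zero i h, h]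
    refine ⟨c.mem _ hq, ?_⟩
    rw [mul_zero, zero_smul, add_zero]
    rfl
  · have hcont : Continuous fun t : ℝ =>
        (c.κ q).1 + (t * c.χ q.base) • EuclideanSpace.single i (1 : ℝ) := by fun_prop
    have h0 : (c.κ q).1 + ((0 : ℝ) * c.χ q.base) • EuclideanSpace.single i (1 : ℝ) ∈
        (c.lam q.base).φ.target := by
      rw [zero_mul, zero_smul, add_zero]
      exact (c.lam q.base).φ.map_source (c.mem _ hq)
    filter_upwards [hcont.continuousAt.eventually ((c.lam q.base).φ.open_target.mem_nhds h0)]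
      with t ht
    exact c.κ_lift i h ht

omit [IsManifold (𝓡 m) ∞ M] in
lemma hasDerivAt_κ_lift (i : Fin m) {q : FrameBundle o} (hq : q.base ∈ c.O) :
    HasDerivAt (fun t => (c.lam q.base).κ (c.lift i q t))
      ((c.χ q.base • EuclideanSpace.single i (1 : ℝ), 0) : CoordSp m n) 0 := by
  have h1 : HasDerivAt (fun t : ℝ => (((c.κ q).1 + (t * c.χ q.base) •
      EuclideanSpace.single i (1 : ℝ), (c.κ q).2) : CoordSp m n))
      (c.χ q.base • EuclideanSpace.single i (1 : ℝ), 0) 0 := by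
    refine HasDerivAt.prodMk ?_ (hasDerivAt_const _ _)
    have h2 := ((hasDerivAt_id (0 : ℝ)).mul_const (c.χ q.base)).smul_const
      (EuclideanSpace.single i (1 : ℝ))
    simpa using h2.const_add (c.κ q).1
  refine h1.congr_of_eventuallyEq ?_
  filter_upwards [c.eventually_κ_lift i hq] with t ht using ht.2

omit [IsManifold (𝓡 m) ∞ M] in
-- The lift keeps the matrix in the local frame constant, while SU(n) multiplies this matrix on the
-- right and fixes the base point. Hence the derivation along the lifts preserves equivariance.
lemma lift_act (i : Fin m) (q : FrameBundle o) (g : Matrix.specialUnitaryGroup (Fin n) ℂ) (t : ℝ) :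
    c.lift i (q.act g) t = (c.lift i q t).act g := by
  by_cases h : c.χ q.base ≠ 0 ∧ (c.κ q).1 + (t * c.χ q.base) • EuclideanSpace.single i (1 : ℝ) ∈
      (c.lam q.base).φ.target
  · have h1 := c.κ_lift i h.1 h.2
    have h2 := c.κ_lift i (q := q.act g) h.1 h.2
    refine LFrame.κ_injOn (Λ := c.lam q.base) h2.1 h1.1 ?_
    have h3 := LFrame.κ_act (Λ := c.lam q.base) (c.lift i q t) g
    rw [h1.2] at h3
    have h4 : (c.κ (q.act g)).2 = fun i j => ∑ k, (c.κ q).2 i k *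
        (g : Matrix (Fin n) (Fin n) ℂ) k j :=
      congrArg Prod.snd (LFrame.κ_act (Λ := c.lam q.base) q g)
    refine h2.2.trans (Eq.trans ?_ h3.symm)
    rw [h4]
    rfl
  · have e1 : c.lift i (q.act g) t = q.act g := dif_neg h
    have e2 : c.lift i q t = q := dif_neg h
    rw [e1, e2]

variable [IsSmoothHermitianBundle (m := m) n E] [NeZero n]

/-- The family of curves `lift`. -/
def liftCurves (i : Fin m) : CurveField o where
  c := c.lift i
  zero := c.lift_zero i
  vel p := by
    by_cases hp : p.base ∈ c.O
    · refine ⟨c.lam p.base, c.mem _ hp, fun z =>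
        (c.χ ((c.lam p.base).φ.symm z.1) • EuclideanSpace.single i (1 : ℝ), 0), ?_, ?_⟩
      · refine SmoothNear.prodMk ?_ (ContDiff.smoothNear contDiff_const _)
        refine ((c.lam p.base).smoothNear_base isOpen_univ (c.mem _ hp) (Set.mem_univ _)
          c.smooth.contMDiffOn).comp_left (G := fun s : ℝ => s • EuclideanSpace.single i (1 : ℝ)) ?_
        fun_prop
      · filter_upwards [(LFrame.tendsto_base (c.mem _ hp)).eventually (c.loc _ hp),
          (LFrame.tendsto_base (c.mem _ hp)).eventually (c.isOpen.mem_nhds hp),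
          LFrame.eventually_mem_source p] with q h1 h2 h3
        have h4 : (c.lam p.base).φ.symm ((c.lam p.base).κ q).1 = q.base :=
          (c.lam p.base).φ.left_inv h3
        have h5 := c.eventually_κ_lift i h2
        have h6 := c.hasDerivAt_κ_lift i h2
        rw [h1] at h5 h6
        rw [h4]
        exact ⟨h5.mono fun t ht => ht.1, h6⟩
    -- Outside the colored set χ vanishes near the base point of p, so nearby curves are constant.
    · obtain ⟨Λ, hΛ⟩ := LFrame.exists_mem o p.base
      refine ⟨Λ, hΛ, fun _ => 0, ContDiff.smoothNear contDiff_const _, ?_⟩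
      have h1 : p.base ∉ tsupport c.χ := fun h => hp (c.supp h)
      filter_upwards [(LFrame.tendsto_base hΛ).eventually
        (notMem_tsupport_iff_eventuallyEq.1 h1), LFrame.eventually_mem_source p] with q hq hqs
      simp only [c.lift_of_χ_eq_zero i hq]
      exact ⟨Eventually.of_forall fun _ => hqs, hasDerivAt_const _ _⟩

/-- The derivation of the matrix valued functions along the curves `lift`. -/
def liftDer (i : Fin m) : Der (MatAlg o) := mapDer n (c.liftCurves i).der

lemma hasDerivAt_liftDer (i : Fin m) (b : MatAlg o) (q : FrameBundle o) (k l : Fin n) :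
    HasDerivAt (fun t => evalHom (c.lift i q t) b k l)
      (evalHom q ((c.liftDer i : Module.End ℂ (MatAlg o)) b) k l) 0 :=
  (c.liftCurves i).hasDerivAt_evalHom b q k l

lemma equivariant_liftDer (i : Fin m) {b : MatAlg o} (hb : Equivariant b) :
    Equivariant ((c.liftDer i : Module.End ℂ (MatAlg o)) b) := by
  intro q g
  ext k l
  have h1 := c.hasDerivAt_liftDer i b (q.act g) k l
  simp only [c.lift_act i q g, hb _ g] at h1
  have h2 := hasDerivAt_mul_entries (hasDerivAt_mul_entries
    (X := fun _ => star (g : Matrix (Fin n) (Fin n) ℂ)) (X' := 0)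
    (fun i j => hasDerivAt_const (0 : ℝ) (star (g : Matrix (Fin n) (Fin n) ℂ) i j))
    (c.hasDerivAt_liftDer i b q)) (Y := fun _ => (g : Matrix (Fin n) (Fin n) ℂ)) (Y' := 0)
    (fun i j => hasDerivAt_const (0 : ℝ) ((g : Matrix (Fin n) (Fin n) ℂ) i j)) k l
  rw [h1.unique h2, zero_mul, zero_add, mul_zero, add_zero]

variable {c} {p : FrameBundle o} (hc : ∀ᶠ x in 𝓝 p.base, c.χ x = 1)
include hc

lemma eventually_lift (i : Fin m) : ∀ᶠ t in 𝓝 (0 : ℝ), c.χ (c.lift i p t).base = 1 ∧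
    c.κ (c.lift i p t) = ((c.κ p).1 + t • EuclideanSpace.single i (1 : ℝ), (c.κ p).2) := by
  have hp1 : c.χ p.base = 1 := hc.self_of_nhds
  have hpO : p.base ∈ c.O := c.mem_of_χ_ne (by rw [hp1]; exact one_ne_zero)
  have h1 := c.eventually_κ_lift i hpO
  have h2 : Tendsto (c.lift i p) (𝓝 0) ((c.lam p.base).nhd p) := by
    have h3 := (c.hasDerivAt_κ_lift i hpO).continuousAt.tendsto
    rw [c.lift_zero] at h3
    exact LFrame.tendsto_nhd h3 (h1.mono fun t ht => ht.1)
  filter_upwards [h1, h2.eventually ((LFrame.tendsto_base (c.mem _ hpO)).eventually hc),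
    h2.eventually (c.eventually_κ_eq hpO)] with t h3 h4 h5
  rw [hp1, mul_one] at h3
  exact ⟨h4, h5.trans h3.2⟩

/-- Near p the cutoff is 1 and the matrix of the frame is constant along the lift, so g*Cg does not
change. With `evalHom_liftDer_f` this says that the lifts are dual to the base coordinates and
trivial on the matrix part. -/
lemma evalHom_liftDer_e (i : Fin m) (C : Matrix (Fin n) (Fin n) ℂ) :
    evalHom p ((c.liftDer i : Module.End ℂ (MatAlg o)) (c.e C)) = 0 := by
  ext k l
  refine (c.hasDerivAt_liftDer i (c.e C) p k l).unique ?_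
  refine (hasDerivAt_const (0 : ℝ) ((star (c.gmat p) * C * c.gmat p) k l)).congr_of_eventuallyEq ?_
  filter_upwards [eventually_lift hc i] with t ht
  rw [c.evalHom_e, ht.1]
  have h : c.gmat (c.lift i p t) = c.gmat p := by
    rw [gmat, ht.2]
    rfl
  rw [h]
  simp

lemma evalHom_liftDer_f (i j : Fin m) :
    evalHom p ((c.liftDer i : Module.End ℂ (MatAlg o))
      (c.f (linSmooth (EuclideanSpace.proj (𝕜 := ℝ) j)))) = if i = j then 1 else 0 := by
  ext k l
  refine (c.hasDerivAt_liftDer i (c.f (linSmooth (EuclideanSpace.proj (𝕜 := ℝ) j))) p k l).unique ?_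
  have h1 : HasDerivAt (fun t : ℝ => ((((c.κ p).1 j + t * (if i = j then 1 else 0) : ℝ) : ℂ) *
      (1 : Matrix (Fin n) (Fin n) ℂ) k l))
      ((((1 * (if i = j then 1 else 0) : ℝ)) : ℂ) * (1 : Matrix (Fin n) (Fin n) ℂ) k l) 0 :=
    ((((hasDerivAt_id (0 : ℝ)).mul_const _).const_add _).ofReal_comp).mul_const _
  have h2 : ((((1 * (if i = j then 1 else 0) : ℝ)) : ℂ) * (1 : Matrix (Fin n) (Fin n) ℂ) k l) =
      (if i = j then 1 else 0 : Matrix (Fin n) (Fin n) ℂ) k l := by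
    by_cases h : i = j
    · simp [h]
    · simp [h]
  rw [← h2]
  refine h1.congr_of_eventuallyEq ?_
  filter_upwards [eventually_lift hc i] with t ht
  rw [c.evalHom_f, ht.1, ht.2, Matrix.smul_apply]
  change ((1 : ℝ) : ℂ) * ((((c.κ p).1 + t • EuclideanSpace.single i (1 : ℝ)) j : ℝ) : ℂ) * _ = _
  rw [Complex.ofReal_one, one_mul]
  have h3 : ((c.κ p).1 + t • EuclideanSpace.single i (1 : ℝ)) j =
      (c.κ p).1 j + t * (if i = j then 1 else 0) := by
    rw [PiLp.add_apply, PiLp.smul_apply, PiLp.single_apply, smul_eq_mul]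
    simp only [eq_comm]
  rw [h3]

end Color

end HorizontalLifts

end DerCalc

end

noncomputable section

namespace DerCalc

open Filter Topology

/-! ### Derivations of the algebra of equivariant functions at a point. -/

section PointDerivations

variable {n : ℕ} {A : Type*} [Ring A] [Algebra ℂ A]

/-- `δ` is a derivation of `A` at the point `ev`. -/
def IsPointDer (ev : A →ₐ[ℂ] Matrix (Fin n) (Fin n) ℂ)
    (δ : A →ₗ[ℂ] Matrix (Fin n) (Fin n) ℂ) : Prop :=
  ∀ a b, δ (a * b) = δ a * ev b + ev a * δ b

variable {ev : A →ₐ[ℂ] Matrix (Fin n) (Fin n) ℂ} {δ : A →ₗ[ℂ] Matrix (Fin n) (Fin n) ℂ}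

lemma isPointDer_comp (ev : A →ₐ[ℂ] Matrix (Fin n) (Fin n) ℂ) (X : Der A) :
    IsPointDer ev (ev.toLinearMap ∘ₗ (X : Module.End ℂ A)) := by
  intro a b
  simp only [LinearMap.comp_apply, der_leibniz, AlgHom.toLinearMap_apply, map_add, map_mul]

lemma IsPointDer.sub_sum {I : Type*} [Fintype I] (hδ : IsPointDer ev δ)
    {δ' : I → A →ₗ[ℂ] Matrix (Fin n) (Fin n) ℂ} (hδ' : ∀ i, IsPointDer ev (δ' i)) (s : I → ℂ) :
    IsPointDer ev (δ - ∑ i, s i • δ' i) := by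
  intro a b
  have h : ∀ i, δ' i (a * b) = δ' i a * ev b + ev a * δ' i b := fun i => hδ' i a b
  simp only [LinearMap.sub_apply, LinearMap.sum_apply, LinearMap.smul_apply, hδ a b, h, smul_add,
    Finset.sum_add_distrib, sub_mul, mul_sub, Finset.sum_mul, Finset.mul_sum, smul_mul_assoc,
    mul_smul_comm]
  abel

lemma IsPointDer.map_of_central [NeZero n] (hδ : IsPointDer ev δ) (hev : Function.Surjective ev)
    {z : A} (hz : ∀ a, z * a = a * z) : δ z = δ z 0 0 • 1 := by
  have hz' := eq_smul_one_of_commute (γ := ev z) fun C => by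
    obtain ⟨a, rfl⟩ := hev C
    rw [← map_mul, hz, map_mul]
  refine eq_smul_one_of_commute fun C => ?_
  obtain ⟨a, rfl⟩ := hev C
  have h := congrArg δ (hz a)
  rw [hδ, hδ, hz'] at h
  rw [Matrix.smul_mul, Matrix.mul_smul, one_mul, mul_one, add_comm (_ • δ a)] at h
  exact add_right_cancel h

lemma sum_single_mul_mul_single (γ : Matrix (Fin n) (Fin n) ℂ) (r s : Fin n) :
    ∑ c, Matrix.single c r 1 * γ * Matrix.single s c 1 = γ r s • (1 : Matrix (Fin n) (Fin n) ℂ) := by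
  ext i j
  simp [Matrix.sum_apply, Matrix.single_mul_mul_single, Matrix.single_apply, Matrix.one_apply]
  by_cases h : i = j
  · subst h
    simp
  · rw [if_neg h]
    refine Finset.sum_eq_zero fun c _ => if_neg ?_
    rintro ⟨rfl, rfl⟩
    exact h rfl

variable [NeZero n] {e : Matrix (Fin n) (Fin n) ℂ →ₗ[ℂ] A} {U V : Matrix (Fin n) (Fin n) ℂ}

variable (δ e U V) in
/-- The matrix that implements, up to conjugation, a derivation at a point on a copy of the
matrix algebra. -/
def innerMat : Matrix (Fin n) (Fin n) ℂ :=
  ∑ k, U * δ (e (Matrix.single k 0 1)) * V * Matrix.single 0 k 1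

/-- Conjugation by U turns δ ∘ e into a derivation of the matrix algebra, which is inner. The
multiplicativity of e is asked for only after applying δ, because cutoffs make e multiplicative only
near the point. -/
lemma IsPointDer.map_matrix (hδ : IsPointDer ev δ) (hUV : U * V = 1) (hVU : V * U = 1)
    (hev : ∀ C, ev (e C) = V * C * U) (he : ∀ C C', δ (e (C * C')) = δ (e C * e C'))
    (C : Matrix (Fin n) (Fin n) ℂ) :
    δ (e C) = V * (innerMat δ e U V * C - C * innerMat δ e U V) * U := by
  let D : Matrix (Fin n) (Fin n) ℂ →ₗ[ℂ] Matrix (Fin n) (Fin n) ℂ :=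
    (LinearMap.mulLeft ℂ U ∘ₗ LinearMap.mulRight ℂ V) ∘ₗ δ ∘ₗ e
  have hD' : ∀ C, D C = U * δ (e C) * V := fun C => (mul_assoc _ _ _).symm
  have hD := matrix_derivation_inner D (fun a b => by
    rw [hD', hD', hD', he, hδ, hev, hev]
    have h1 : U * (V * a * U * δ (e b)) = a * U * δ (e b) := by
      simp only [← mul_assoc, hUV, one_mul]
    have h2 : δ (e a) * (V * b * U) * V = δ (e a) * V * b := by
      rw [mul_assoc, mul_assoc _ U, hUV, mul_one]
      simp only [← mul_assoc]
    rw [mul_add, add_mul, h1, mul_assoc U, h2]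
    simp only [← mul_assoc]) C
  have h3 : δ (e C) = V * D C * U := by
    rw [hD']
    simp only [← mul_assoc, hVU, one_mul]
    rw [mul_assoc, hVU, mul_one]
  rw [h3, hD]
  simp only [hD']
  rfl

/-- The entries of `innerMat` are to be values of one-forms ∑ u dv w with coefficients in A. Summing
e_{cr} γ e_{sc} over c turns the entry γ_{rs} into a scalar matrix, which does not depend on the
conjugation by U. -/
lemma sum_innerMat (hUV : U * V = 1) (hVU : V * U = 1) (hev : ∀ C, ev (e C) = V * C * U)
    (r s : Fin n) :
    ∑ k : Fin n × Fin n, ev (e (Matrix.single k.1 r 1)) * δ (e (Matrix.single k.2 0 1)) *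
      ev (e (Matrix.single 0 k.2 1) * e (Matrix.single s k.1 1)) =
      innerMat δ e U V r s • 1 := by
  have h1 : innerMat δ e U V r s • (1 : Matrix (Fin n) (Fin n) ℂ) =
      V * (innerMat δ e U V r s • 1) * U := by
    rw [Matrix.mul_smul, Matrix.smul_mul, mul_one, hVU]
  rw [h1, ← sum_single_mul_mul_single, Fintype.sum_prod_type, innerMat, Finset.mul_sum,
    Finset.sum_mul]
  refine Finset.sum_congr rfl fun c _ => ?_
  rw [Finset.mul_sum, Finset.sum_mul, Finset.mul_sum, Finset.sum_mul]
  refine Finset.sum_congr rfl fun k _ => ?_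
  rw [map_mul, hev, hev, hev]
  have h2 : V * Matrix.single 0 k 1 * U * (V * Matrix.single s c 1 * U) =
      V * Matrix.single 0 k 1 * Matrix.single s c 1 * U := by
    rw [mul_assoc _ U, mul_assoc V _ U, ← mul_assoc U, hUV, one_mul]
    simp only [← mul_assoc]
  rw [h2]
  simp only [← mul_assoc]

end PointDerivations

section Models

variable {m n : ℕ} {M : Type*} [TopologicalSpace M]
  [ChartedSpace (EuclideanSpace ℝ (Fin m)) M] [IsManifold (𝓡 m) ∞ M]
  {E : M → Type*} [TopologicalSpace (Bundle.TotalSpace (EuclideanSpace ℂ (Fin n)) E)]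
  [∀ x, NormedAddCommGroup (E x)] [∀ x, InnerProductSpace ℂ (E x)]
  [FiberBundle (EuclideanSpace ℂ (Fin n)) E] [VectorBundle ℂ (EuclideanSpace ℂ (Fin n)) E]
  {o : BundleOrientation (m := m) n E}
  {A : Type*} [Ring A] [Algebra ℂ A]

/-- `ι` identifies `A` with the algebra of equivariant functions. -/
structure IsModel (ι : A →ₐ[ℂ] MatAlg o) : Prop where
  injective : Function.Injective ι
  equivariant_iff : ∀ b, Equivariant b ↔ ∃ a, ι a = b

namespace IsModel

variable {ι : A →ₐ[ℂ] MatAlg o} (hι : IsModel ι)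
include hι

omit [IsManifold (𝓡 m) ∞ M] in
lemma ext {a b : A} (h : ∀ q, evalHom q (ι a) = evalHom q (ι b)) : a = b :=
  hι.injective (matAlg_ext h)

omit [IsManifold (𝓡 m) ∞ M] in
lemma exists_lift {W : Type*} [AddCommGroup W] [Module ℂ W] (F : W →ₗ[ℂ] MatAlg o)
    (hF : ∀ w, Equivariant (F w)) : ∃ G : W →ₗ[ℂ] A, ∀ w, ι (G w) = F w := by
  let e := LinearEquiv.ofInjective ι.toLinearMap hι.injective
  let F' : W →ₗ[ℂ] LinearMap.range ι.toLinearMap :=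
    F.codRestrict _ fun w => (hι.equivariant_iff _).1 (hF w)
  refine ⟨e.symm.toLinearMap ∘ₗ F', fun w => ?_⟩
  exact congrArg Subtype.val (e.apply_symm_apply (F' w))

omit [IsManifold (𝓡 m) ∞ M] in
lemma exists_der (Y : Der (MatAlg o)) (hY : ∀ b, Equivariant b →
    Equivariant ((Y : Module.End ℂ (MatAlg o)) b)) :
    ∃ X : Der A, ∀ a, ι ((X : Module.End ℂ A) a) = (Y : Module.End ℂ (MatAlg o)) (ι a) := by
  obtain ⟨G, hG⟩ := hι.exists_lift ((Y : Module.End ℂ (MatAlg o)) ∘ₗ ι.toLinearMap) fun a =>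
    hY _ ((hι.equivariant_iff _).2 ⟨a, rfl⟩)
  refine ⟨⟨G, fun a b => hι.injective ?_⟩, hG⟩
  rw [map_add, map_mul ι, map_mul ι, hG, hG, hG]
  change (Y : Module.End ℂ (MatAlg o)) (ι (a * b)) = _
  rw [map_mul, der_leibniz]
  rfl

variable [IsSmoothHermitianBundle (m := m) n E] [NeZero n] [T2Space M] [SecondCountableTopology M]
  {p : FrameBundle o} {δ : A →ₗ[ℂ] Matrix (Fin n) (Fin n) ℂ}

/-- The cutoff has to be equivariant here; a function of the base point, supported where a vanishes,
serves as a scalar factor z with z a = 0 and value 1 at p. -/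
lemma pointDer_local (hδ : IsPointDer ((evalHom p).comp ι) δ) {a : A}
    (h : ∀ᶠ x in 𝓝 p.base, ∀ q : FrameBundle o, q.base = x → evalHom q (ι a) = 0) : δ a = 0 := by
  obtain ⟨Λ, hΛ⟩ := LFrame.exists_mem o p.base
  obtain ⟨U, hU, hUo, hpU⟩ := eventually_nhds_iff.1 h
  obtain ⟨χ, hχ, h1, hs⟩ := exists_cutoff (m := m) (isClosed_singleton (x := p.base))
    (Λ.φ.open_source.inter hUo) (Set.singleton_subset_iff.2 ⟨hΛ, hpU⟩)
  let c : Color o := ⟨Λ.φ.source, Λ.φ.open_source, fun _ => Λ, fun _ h => h,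
    fun _ _ => Eventually.of_forall fun _ => rfl, χ, hχ, hs.trans Set.inter_subset_left⟩
  obtain ⟨z, hz⟩ := (hι.equivariant_iff _).1 (c.equivariant_f 1)
  have hz' : ∀ q, evalHom q (ι z) = (χ q.base : ℂ) • 1 := by
    intro q
    rw [hz, c.evalHom_f]
    change ((χ q.base : ℂ) * 1) • _ = _
    rw [mul_one]
  have h2 : z * a = 0 := hι.ext fun q => by
    rw [map_mul, map_mul, hz', map_zero, map_zero]
    by_cases hq : χ q.base = 0
    · rw [hq, Complex.ofReal_zero, zero_smul, zero_mul]
    · rw [hU q.base (hs (subset_tsupport _ hq)).2 q rfl, mul_zero]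
  have h3 := hδ z a
  have h4 : ((evalHom p).comp ι) a = 0 := h.self_of_nhds p rfl
  have h5 : ((evalHom p).comp ι) z = 1 := by
    refine (hz' p).trans ?_
    rw [(h1 p.base rfl).self_of_nhds, Complex.ofReal_one, one_smul]
  rw [h2, h4, h5, map_zero, mul_zero, zero_add, one_mul] at h3
  exact h3.symm

lemma pointDer_congr (hδ : IsPointDer ((evalHom p).comp ι) δ) {a b : A}
    (h : ∀ᶠ x in 𝓝 p.base, ∀ q : FrameBundle o, q.base = x →
      evalHom q (ι a) = evalHom q (ι b)) : δ a = δ b := by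
  rw [← sub_eq_zero, ← map_sub]
  refine hι.pointDer_local hδ ?_
  filter_upwards [h] with x hx q hq
  rw [map_sub, map_sub, hx q hq, sub_self]

variable {c : Color o} (hc : ∀ᶠ x in 𝓝 p.base, c.χ x = 1)
  {f : SmoothSub (EuclideanSpace ℝ (Fin m)) →ₗ[ℂ] A} (hf : ∀ H, ι (f H) = c.f H)
  {e : Matrix (Fin n) (Fin n) ℂ →ₗ[ℂ] A} (he : ∀ C, ι (e C) = c.e C)
include hc hf

lemma pointDer_f_eq_zero (hδ : IsPointDer ((evalHom p).comp ι) δ)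
    (h1 : ∀ k, δ (f (linSmooth (EuclideanSpace.proj (𝕜 := ℝ) k))) = 0)
    (H : SmoothSub (EuclideanSpace ℝ (Fin m))) : δ (f H) = 0 := by
  have hp1 : c.χ p.base = 1 := hc.self_of_nhds
  have hev : ∀ H, ((evalHom p).comp ι) (f H) = H.1 (c.κ p).1 • 1 := by
    intro H
    refine (congrArg (evalHom p) (hf H)).trans ?_
    rw [c.evalHom_f, hp1, Complex.ofReal_one, one_mul]
  refine pointDerivation_eq_zero (c.κ p).1 (δ ∘ₗ f) (fun F G => ?_) (fun l => ?_) H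
  · have h2 : δ (f (F * G)) = δ (f F * f G) := by
      refine hι.pointDer_congr hδ ?_
      filter_upwards [hc] with x hx q hq
      subst hq
      rw [map_mul ι, map_mul (evalHom q), hf, hf, hf, c.evalHom_f, c.evalHom_f, c.evalHom_f, hx,
        Matrix.smul_mul, one_mul, smul_smul, Complex.ofReal_one, one_mul, one_mul, one_mul]
      rfl
    change δ (f (F * G)) = F.1 (c.κ p).1 • δ (f G) + G.1 (c.κ p).1 • δ (f F)
    rw [h2, hδ, hev, hev, Matrix.mul_smul, mul_one, Matrix.smul_mul, one_mul, add_comm]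
  · have h3 : linSmooth l = ∑ k, (l (EuclideanSpace.single k 1) : ℂ) •
        linSmooth (EuclideanSpace.proj (𝕜 := ℝ) k) := by
      refine Subtype.ext (funext fun y => ?_)
      have hy : y = ∑ k, y k • EuclideanSpace.single k (1 : ℝ) := by
        ext i
        simp [Pi.single_apply]
      change ((l y : ℝ) : ℂ) = _
      conv_lhs => rw [hy]
      simp only [map_sum, map_smul, smul_eq_mul, AddSubmonoidClass.coe_finsetSum,
        SetLike.val_smul, Finset.sum_apply, Pi.smul_apply]
      push_cast
      exact Finset.sum_congr rfl fun k _ => mul_comm _ _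
    rw [LinearMap.comp_apply, h3, map_sum, map_sum]
    refine Finset.sum_eq_zero fun k _ => ?_
    rw [map_smul, map_smul, h1, smul_zero]

include he

/-- Near p an equivariant function is ∑ Kᵢⱼ(y) g*Eᵢⱼg, where the Kᵢⱼ are its entries along the local
frame. So δ is determined by its values on the f and e, and Hadamard's lemma reduces the f to base
coordinates. -/
lemma pointDer_eq_zero (hδ : IsPointDer ((evalHom p).comp ι) δ)
    (h1 : ∀ k, δ (f (linSmooth (EuclideanSpace.proj (𝕜 := ℝ) k))) = 0)
    (h2 : ∀ C, δ (e C) = 0) (a : A) : δ a = 0 := by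
  have hp1 : c.χ p.base = 1 := hc.self_of_nhds
  have hpO : p.base ∈ c.O := c.mem_of_χ_ne (by rw [hp1]; exact one_ne_zero)
  obtain ⟨Λ, hΛc⟩ : ∃ Λ, Λ = c.lam p.base := ⟨_, rfl⟩
  have hΛ : p.base ∈ Λ.φ.source := by rw [hΛc]; exact c.mem _ hpO
  choose H hH hbH using fun i j => exists_germ (ι a i j) (p := Λ.frame p.base hΛ) hΛ
  have h3 : ∀ᶠ x in 𝓝 p.base, ∀ hx : x ∈ Λ.φ.source, ∀ i j,
      evalHom (Λ.frame x hx) (ι a) i j = H i j (Λ.φ x, fun i j => if i = j then 1 else 0) := by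
    have h4 : ∀ᶠ q in Λ.nhd (Λ.frame p.base hΛ), ∀ i j, (ι a i j).1 q = H i j (Λ.κ q) :=
      eventually_all.2 fun i => eventually_all.2 fun j => hbH i j
    have h5 := LFrame.eventually_nhd.1 h4
    rw [LFrame.κ_frame hΛ] at h5
    have h6 : Tendsto (fun x => ((Λ.φ x, fun i j => if i = j then 1 else 0) : CoordSp m n))
        (𝓝 p.base) (𝓝 (Λ.φ p.base, fun i j => if i = j then 1 else 0)) :=
      (Λ.φ.continuousAt hΛ).tendsto.prodMk_nhds tendsto_const_nhds
    filter_upwards [h6.eventually h5] with x hx hxs i j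
    have h7 := hx (Λ.frame x hxs) (LFrame.κ_frame hxs) hxs i j
    rw [LFrame.κ_frame hxs] at h7
    exact h7
  let K : Fin n → Fin n → SmoothSub (EuclideanSpace ℝ (Fin m)) := fun i j =>
    ⟨fun y => H i j (y, fun i j => if i = j then 1 else 0),
      ((hH i j).comp (contDiff_id.prodMk contDiff_const) : ContDiff ℝ ∞ _)⟩
  have h8 : δ a = δ (∑ i, ∑ j, f (K i j) * e (Matrix.single i j 1)) := by
    refine hι.pointDer_congr hδ ?_
    filter_upwards [h3, hc, c.loc _ hpO, Λ.φ.open_source.mem_nhds hΛ] with x hx hx1 hxl hxs q hq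
    subst hq
    rw [← hΛc] at hxl
    obtain ⟨g, hg⟩ := LFrame.exists_frame_act hxs
    have hκ : c.κ q = (Λ.φ q.base, (g : Matrix (Fin n) (Fin n) ℂ)) := by
      rw [Color.κ, hxl]
      exact (congrArg Λ.κ hg).trans (LFrame.κ_frame_act hxs g)
    have hgm : c.gmat q = g := by rw [Color.gmat, hκ]; rfl
    have h9 : evalHom q (ι a) = star (g : Matrix (Fin n) (Fin n) ℂ) *
        evalHom (Λ.frame q.base hxs) (ι a) * g := by
      rw [← (hι.equivariant_iff _).2 ⟨a, rfl⟩ _ g, ← hg]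
    have h10 : evalHom (Λ.frame q.base hxs) (ι a) =
        ∑ i, ∑ j, (K i j).1 (c.κ q).1 • Matrix.single i j 1 := by
      rw [hκ]
      conv_lhs => rw [Matrix.matrix_eq_sum_single (evalHom (Λ.frame q.base hxs) (ι a))]
      refine Finset.sum_congr rfl fun i _ => Finset.sum_congr rfl fun j _ => ?_
      rw [hx hxs, Matrix.smul_single, smul_eq_mul, mul_one]
    rw [h9, h10]
    simp only [map_sum, map_mul, hf, he, c.evalHom_f, c.evalHom_e, hx1, hgm, Finset.mul_sum,
      Finset.sum_mul, Complex.ofReal_one, one_mul, one_smul, Matrix.smul_mul, Matrix.mul_smul]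
  rw [h8, map_sum]
  refine Finset.sum_eq_zero fun i _ => ?_
  rw [map_sum]
  refine Finset.sum_eq_zero fun j _ => ?_
  rw [hδ, h2, hι.pointDer_f_eq_zero hc hf hδ h1, zero_mul, mul_zero, add_zero]

end IsModel

end Models

end DerCalc

end

noncomputable section

namespace DerCalc

open Filter Topology

/-! ### The local dual family of derivations and one-forms. -/

section LocalDual

variable {m n : ℕ} {M : Type*} [TopologicalSpace M]
  [ChartedSpace (EuclideanSpace ℝ (Fin m)) M] [IsManifold (𝓡 m) ∞ M]
  {E : M → Type*} [TopologicalSpace (Bundle.TotalSpace (EuclideanSpace ℂ (Fin n)) E)]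
  [∀ x, NormedAddCommGroup (E x)] [∀ x, InnerProductSpace ℂ (E x)]
  [FiberBundle (EuclideanSpace ℂ (Fin n)) E] [VectorBundle ℂ (EuclideanSpace ℂ (Fin n)) E]
  {o : BundleOrientation (m := m) n E}
  {A : Type*} [Ring A] [Algebra ℂ A]
  [IsSmoothHermitianBundle (m := m) n E] [NeZero n] [T2Space M] [SecondCountableTopology M]

namespace IsModel

variable {ι : A →ₐ[ℂ] MatAlg o} (hι : IsModel ι) {c : Color o}
  {f : SmoothSub (EuclideanSpace ℝ (Fin m)) →ₗ[ℂ] A} (hf : ∀ H, ι (f H) = c.f H)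
  {e : Matrix (Fin n) (Fin n) ℂ →ₗ[ℂ] A} (he : ∀ C, ι (e C) = c.e C)
include hι

omit [T2Space M] [SecondCountableTopology M] in
include hf in
lemma f_mul_comm (H : SmoothSub (EuclideanSpace ℝ (Fin m))) (a : A) : f H * a = a * f H :=
  hι.injective (by rw [map_mul, map_mul, hf, c.f_apply, Algebra.commutes])

variable {p : FrameBundle o} (hc : ∀ᶠ x in 𝓝 p.base, c.χ x = 1) {U V : Matrix (Fin n) (Fin n) ℂ}
  (hUV : U * V = 1) (hVU : V * U = 1)
  (hev : ∀ C, ((evalHom p).comp ι) (e C) = V * C * U)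
  {δ : A →ₗ[ℂ] Matrix (Fin n) (Fin n) ℂ} (hδ : IsPointDer ((evalHom p).comp ι) δ)
include he hc hδ

/-- The cutoff enters e C once and a product of two of them twice, so e is multiplicative only where
χ = 1. Locality of δ bridges the difference. -/
lemma pointDer_e_mul (C C' : Matrix (Fin n) (Fin n) ℂ) : δ (e (C * C')) = δ (e C * e C') := by
  refine hι.pointDer_congr hδ ?_
  filter_upwards [hc] with x hx q hq
  subst hq
  have hqO : q.base ∈ c.O := c.mem_of_χ_ne (by rw [hx]; exact one_ne_zero)
  obtain ⟨g, hg⟩ := c.exists_gmat_eq hqO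
  rw [map_mul ι, map_mul (evalHom q), he, he, he, c.evalHom_e, c.evalHom_e, c.evalHom_e, hx, hg,
    Complex.ofReal_one, one_mul, one_smul, one_smul, one_smul]
  have h1 : (g : Matrix (Fin n) (Fin n) ℂ) * (star (g : Matrix (Fin n) (Fin n) ℂ) * C' * g) =
      C' * g := by
    rw [← mul_assoc, ← mul_assoc, su_mul_star, one_mul]
  rw [mul_assoc (_ * C), h1]
  simp only [← mul_assoc]

include hf hUV hVU hev

/-- Subtract the right-hand side: the lifts account for the values on base coordinates and kill the
e C, while the inner derivations account for the e C and kill the central base coordinates. The n²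
inner derivations are redundant, as the sum over diagonal units acts trivially. -/
lemma pointDer_eq_sum {X : Fin m → Der A} (hX : ∀ i a, ι ((X i : Module.End ℂ A) a) =
      (c.liftDer i : Module.End ℂ (MatAlg o)) (ι a)) (a : A) :
    δ a = ∑ i, δ (f (linSmooth (EuclideanSpace.proj (𝕜 := ℝ) i))) 0 0 •
        ((evalHom p).comp ι) ((X i : Module.End ℂ A) a) +
      ∑ k : Fin n × Fin n, innerMat δ e U V k.1 k.2 •
        ((evalHom p).comp ι) ((adDer (e (Matrix.single k.1 k.2 1)) : Module.End ℂ A) a) := by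
  have hsurj : Function.Surjective ((evalHom p).comp ι) := fun C => ⟨e (U * C * V), by
    rw [hev]
    simp only [← mul_assoc]
    rw [hVU, one_mul, mul_assoc, hVU, mul_one]⟩
  obtain ⟨t, ht⟩ : ∃ t : Fin m ⊕ (Fin n × Fin n) → ℂ, t = Sum.elim
    (fun i => δ (f (linSmooth (EuclideanSpace.proj (𝕜 := ℝ) i))) 0 0)
    (fun k => innerMat δ e U V k.1 k.2) := ⟨_, rfl⟩
  obtain ⟨Z, hZ⟩ : ∃ Z : Fin m ⊕ (Fin n × Fin n) → Der A, Z = Sum.elim X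
    (fun k => adDer (e (Matrix.single k.1 k.2 1))) := ⟨_, rfl⟩
  have hδ₁ := hδ.sub_sum (fun i => isPointDer_comp ((evalHom p).comp ι) (Z i)) t
  have happ : ∀ a, (δ - ∑ i, t i • (((evalHom p).comp ι).toLinearMap ∘ₗ (Z i : Module.End ℂ A))) a =
      δ a - (∑ i, δ (f (linSmooth (EuclideanSpace.proj (𝕜 := ℝ) i))) 0 0 •
        ((evalHom p).comp ι) ((X i : Module.End ℂ A) a) +
      ∑ k : Fin n × Fin n, innerMat δ e U V k.1 k.2 •
        ((evalHom p).comp ι) ((adDer (e (Matrix.single k.1 k.2 1)) : Module.End ℂ A) a)) := by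
    intro a
    rw [LinearMap.sub_apply, LinearMap.sum_apply, Fintype.sum_sum_type, ht, hZ]
    rfl
  have h0 := hι.pointDer_eq_zero hc hf he hδ₁ (fun k => ?_) (fun C => ?_) a
  · rw [happ] at h0
    exact sub_eq_zero.1 h0
  · rw [happ, sub_eq_zero]
    have h1 : ∀ i, ((evalHom p).comp ι) ((X i : Module.End ℂ A)
        (f (linSmooth (EuclideanSpace.proj (𝕜 := ℝ) k)))) = if i = k then 1 else 0 := by
      intro i
      refine (congrArg (evalHom p) (hX i _)).trans ?_
      rw [hf, Color.evalHom_liftDer_f hc]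
    have h2 : ∀ b : A, (adDer b : Module.End ℂ A)
        (f (linSmooth (EuclideanSpace.proj (𝕜 := ℝ) k))) = 0 := by
      intro b
      rw [adDer_apply, hι.f_mul_comm hf, sub_self]
    simp only [h1, h2, map_zero, smul_zero, Finset.sum_const_zero, add_zero, smul_ite,
      Finset.sum_ite_eq', Finset.mem_univ, if_true]
    exact hδ.map_of_central hsurj (hι.f_mul_comm hf _)
  · rw [happ, sub_eq_zero]
    have h1 : ∀ i, ((evalHom p).comp ι) ((X i : Module.End ℂ A) (e C)) = 0 := by
      intro i
      refine (congrArg (evalHom p) (hX i _)).trans ?_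
      rw [he, Color.evalHom_liftDer_e hc]
    have h2 : ∀ C', ((evalHom p).comp ι) ((adDer (e C') : Module.End ℂ A) (e C)) =
        V * (C' * C - C * C') * U := by
      intro C'
      have h3 : ∀ C C' : Matrix (Fin n) (Fin n) ℂ, V * C * U * (V * C' * U) = V * (C * C') * U := by
        intro C C'
        rw [mul_assoc _ U, mul_assoc V C', ← mul_assoc U, hUV, one_mul]
        simp only [← mul_assoc]
      rw [adDer_apply, map_sub, map_mul, map_mul, hev, hev, h3, h3, mul_sub, sub_mul]
    simp only [h1, h2, smul_zero, Finset.sum_const_zero, zero_add]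
    rw [hδ.map_matrix hUV hVU hev (hι.pointDer_e_mul he hc hδ)]
    generalize innerMat δ e U V = γ
    have h4 : γ = ∑ k : Fin n × Fin n, γ k.1 k.2 • Matrix.single k.1 k.2 1 := by
      conv_lhs => rw [Matrix.matrix_eq_sum_single γ]
      rw [Fintype.sum_prod_type]
      simp [Matrix.smul_single]
    conv_lhs => rw [h4]
    simp only [Finset.sum_mul, Finset.mul_sum, ← Finset.sum_sub_distrib, Matrix.smul_mul,
      Matrix.mul_smul, ← smul_sub]

omit hf he hc hUV hVU hev hδ in
/-- Derivations and one-forms of `A` that are dual to each other where `ρ = 1`. -/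
lemma exists_local_dual (c : Color o) {ρ : M → ℝ} (hρ : ContMDiff (𝓡 m) 𝓘(ℝ, ℝ) ∞ ρ)
    (h1 : ∀ x, ρ x ≠ 0 → ∀ᶠ y in 𝓝 x, c.χ y = 1) (hs : tsupport ρ ⊆ c.O) :
    ∃ (X : Fin m ⊕ (Fin n × Fin n) → Der A) (Y : Fin m ⊕ (Fin n × Fin n) → Der (MatAlg o))
      (u v w : Fin m ⊕ (Fin n × Fin n) → Fin n × Fin n → A),
      (∀ i a, ι ((X i : Module.End ℂ A) a) = (Y i : Module.End ℂ (MatAlg o)) (ι a)) ∧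
      ∀ (p : FrameBundle o) (δ : A →ₗ[ℂ] Matrix (Fin n) (Fin n) ℂ),
        IsPointDer ((evalHom p).comp ι) δ → ∃ s : Fin m ⊕ (Fin n × Fin n) → ℂ,
        (∀ i, ∑ k, ((evalHom p).comp ι) (u i k) * δ (v i k) * ((evalHom p).comp ι) (w i k) =
          s i • 1) ∧
        ∀ a, (ρ p.base : ℂ) • δ a =
          ∑ i, s i • ((evalHom p).comp ι) ((X i : Module.End ℂ A) a) := by
  obtain ⟨f, hf⟩ := hι.exists_lift c.f c.equivariant_f
  obtain ⟨e, he⟩ := hι.exists_lift c.e c.equivariant_e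
  let c' : Color o := ⟨c.O, c.isOpen, c.lam, c.mem, c.loc, ρ, hρ, hs⟩
  obtain ⟨r, hr⟩ := (hι.equivariant_iff _).1 (c'.equivariant_f 1)
  have hr' : ∀ p, ((evalHom p).comp ι) r = (ρ p.base : ℂ) • 1 := by
    intro p
    refine (congrArg (evalHom p) hr).trans ?_
    rw [c'.evalHom_f]
    change ((ρ p.base : ℂ) * 1) • _ = _
    rw [mul_one]
  choose X hX using fun i => hι.exists_der (c.liftDer i) fun b => c.equivariant_liftDer i
  -- The factor r, with value ρ, sits in u and localizes the one-forms. For a lift only the index k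
  -- = 0 contributes and the form is r dyᵢ; for a matrix unit the sum over k is that of
  -- `sum_innerMat`.
  refine ⟨Sum.elim X fun k => adDer (e (Matrix.single k.1 k.2 1)),
    Sum.elim c.liftDer fun k => adDer (c.e (Matrix.single k.1 k.2 1)),
    Sum.elim (fun _ k => if k = 0 then r else 0) fun i k => r * e (Matrix.single k.1 i.1 1),
    Sum.elim (fun i _ => f (linSmooth (EuclideanSpace.proj (𝕜 := ℝ) i)))
      fun _ k => e (Matrix.single k.2 0 1),
    Sum.elim (fun _ _ => 1) fun i k => e (Matrix.single 0 k.2 1) * e (Matrix.single i.2 k.1 1),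
    ?_, fun p δ hδ => ?_⟩
  · rintro (i | i) a
    · exact hX i a
    · refine (congrArg ι (adDer_apply _ _)).trans (Eq.trans ?_ (adDer_apply _ _).symm)
      rw [map_sub, map_mul, map_mul, he]
  -- Where ρ vanishes nothing is known about χ, but then u vanishes at p and all coefficients can be
  -- taken zero.
  · by_cases hp : ρ p.base = 0
    · refine ⟨0, fun i => ?_, fun a => ?_⟩
      · rw [Pi.zero_apply, zero_smul]
        have hr0 := hr' p
        rw [hp, Complex.ofReal_zero, zero_smul] at hr0
        refine Finset.sum_eq_zero fun k _ => ?_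
        obtain (i | i) := i
        · have h2 : ((evalHom p).comp ι) (if k = 0 then r else 0) = 0 := by
            by_cases hk : k = 0
            · rw [if_pos hk, hr0]
            · rw [if_neg hk, map_zero]
          simp only [Sum.elim_inl, h2, zero_mul]
        · simp only [Sum.elim_inr, map_mul _ r, hr0, zero_mul]
      · simp [hp]
    · have hc := h1 _ hp
      have hp1 : c.χ p.base = 1 := hc.self_of_nhds
      have hpO : p.base ∈ c.O := c.mem_of_χ_ne (by rw [hp1]; exact one_ne_zero)
      obtain ⟨g, hg⟩ := c.exists_gmat_eq hpO
      have hUV := su_mul_star g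
      have hVU := su_star_mul g
      have hev : ∀ C, ((evalHom p).comp ι) (e C) = star (g : Matrix (Fin n) (Fin n) ℂ) * C * g := by
        intro C
        refine (congrArg (evalHom p) (he C)).trans ?_
        rw [c.evalHom_e, hp1, hg, Complex.ofReal_one, one_mul, one_smul]
      refine ⟨fun i => ρ p.base * Sum.elim
        (fun i => δ (f (linSmooth (EuclideanSpace.proj (𝕜 := ℝ) i))) 0 0)
        (fun k => innerMat δ e g (star (g : Matrix (Fin n) (Fin n) ℂ)) k.1 k.2) i, ?_, fun a => ?_⟩
      · rintro (i | i)
        · have h3 : δ (f (linSmooth (EuclideanSpace.proj (𝕜 := ℝ) i))) =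
              δ (f (linSmooth (EuclideanSpace.proj (𝕜 := ℝ) i))) 0 0 • 1 := by
            refine hδ.map_of_central (fun C => ⟨e (g * C * star (g : Matrix (Fin n) (Fin n) ℂ)), ?_⟩)
              (hι.f_mul_comm hf _)
            rw [hev]
            simp only [← mul_assoc]
            rw [hVU, one_mul, mul_assoc, hVU, mul_one]
          simp only [Sum.elim_inl, map_one, mul_one]
          rw [← Finset.sum_mul, ← map_sum, Finset.sum_ite_eq' Finset.univ, if_pos (Finset.mem_univ _),
            hr', Matrix.smul_mul, one_mul, mul_smul, ← h3]
        · simp only [Sum.elim_inr, map_mul _ r, hr', Matrix.smul_mul, one_mul]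
          rw [← Finset.smul_sum, sum_innerMat hUV hVU hev, smul_smul]
      · conv_lhs => rw [hι.pointDer_eq_sum hf he hc hUV hVU hev hδ hX a]
        rw [Fintype.sum_sum_type]
        simp only [Sum.elim_inl, Sum.elim_inr, mul_smul, smul_add, Finset.smul_sum]

end IsModel

end LocalDual

end DerCalc

end

noncomputable section

namespace DerCalc

/-! ### Comparison of the two calculi by matched derivations and Euler's identity. -/

section Comparison

variable {A B : Type*} [Ring A] [Algebra ℂ A] [Ring B] [Algebra ℂ B] {ι : A →ₐ[ℂ] B}
  {n : ℕ} {ev : B →ₐ[ℂ] Matrix (Fin n) (Fin n) ℂ}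

variable (ι ev) in
/-- The forms `α` and `β` take the same values, at the point `ev`, on derivations that are related
by `ι` at this point. -/
def Comparable (α : Cochain A) (β : Cochain B) : Prop :=
  ∀ (q : ℕ) (X : Fin q → Der A) (Y : Fin q → Der B),
    (∀ j a, ev ((Y j : Module.End ℂ B) (ι a)) = ev (ι ((X j : Module.End ℂ A) a))) →
    ev (β q Y) = ev (ι (α q X))

lemma Comparable.wedge {α α' : Cochain A} {β β' : Cochain B} (h : Comparable ι ev α β)
    (h' : Comparable ι ev α' β') : Comparable ι ev (wedge α α') (DerCalc.wedge β β') := by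
  intro q X Y hXY
  simp only [DerCalc.wedge, map_sum, map_zsmul, map_mul]
  refine Finset.sum_congr rfl fun S _ => ?_
  rw [h S.card _ _ fun j => hXY _, h' Sᶜ.card _ _ fun j => hXY _]

lemma comparable_ofAlg (a : A) : Comparable ι ev (ofAlg a) (ofAlg (ι a)) := by
  intro q X Y _
  cases q with
  | zero => rfl
  | succ q => simp [ofAlg]

lemma dDer_ofAlg_one_apply (a : A) (X : Fin 1 → Der A) :
    dDer (ofAlg a) 1 X = (X 0 : Module.End ℂ A) a := by
  have h := congrFun (congrFun (contr_dDer_ofAlg (X 0) a) 0) (Fin.tail X)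
  rwa [contr, Fin.cons_self_tail] at h

lemma comparable_dDer_ofAlg (a : A) :
    Comparable ι ev (dDer (ofAlg a)) (dDer (ofAlg (ι a))) := by
  intro q X Y hXY
  by_cases hq : q = 1
  · subst hq
    rw [dDer_ofAlg_one_apply, dDer_ofAlg_one_apply, hXY]
  · rw [isHomogeneous_dDer_ofAlg a q hq, isHomogeneous_dDer_ofAlg (ι a) q hq]
    simp

/-- Words see derivations only through their values on letters, and the letters on the side of B lie
in ι(A). -/
lemma FormPair.comparable {α : Cochain A} {β : Cochain B} (h : FormPair ι α β) :
    Comparable ι ev α β := by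
  induction h with
  | of a => exact comparable_ofAlg a
  | add _ _ h h' =>
    intro q X Y hXY
    simp only [Pi.add_apply, map_add, h q X Y hXY, h' q X Y hXY]
  | smul c _ h =>
    intro q X Y hXY
    simp only [Pi.smul_apply, map_smul, h q X Y hXY]
  | mulLeft a _ h => exact (comparable_ofAlg a).wedge h
  | dLeft a _ h => exact (comparable_dDer_ofAlg a).wedge h

lemma FormPair.eq_of_id {α β : Cochain A} (h : FormPair (AlgHom.id ℂ A) α β) : β = α := by
  induction h with
  | of a => rfl
  | add _ _ h h' => rw [h, h']
  | smul c _ h => rw [h]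
  | mulLeft a _ h => rw [h]; rfl
  | dLeft a _ h => rw [h]; rfl

/-- Comparison of a form with itself, for ι the identity: forms are tensorial, so at a point only
the values of the derivations there matter. -/
lemma apply_congr_of_mem {β : Cochain B} (hβ : β ∈ OmegaDer B) {q : ℕ} {Y Y' : Fin q → Der B}
    (h : ∀ j b, ev ((Y j : Module.End ℂ B) b) = ev ((Y' j : Module.End ℂ B) b)) :
    ev (β q Y) = ev (β q Y') := by
  obtain ⟨β', hβ'⟩ := FormPair.exists_right (AlgHom.id ℂ B) hβ
  have h1 := hβ'.comparable (ev := ev) q Y' Y h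
  rw [hβ'.eq_of_id] at h1
  exact h1

end Comparison

/-- Finitely many derivations `X i` of `A` and one-forms `∑ k, u i k d(v i k) w i k` that are dual
to each other at all points of a family, and extensions `Y i` of the derivations to `B`. -/
structure DualBasis {A B : Type*} [Ring A] [Algebra ℂ A] [Ring B] [Algebra ℂ B] (ι : A →ₐ[ℂ] B)
    {P : Type*} {n : ℕ} (ev : P → B →ₐ[ℂ] Matrix (Fin n) (Fin n) ℂ) where
  I : Type
  K : Type
  [fintypeI : Fintype I]
  [fintypeK : Fintype K]
  X : I → Der A
  Y : I → Der B
  u : I → K → A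
  v : I → K → A
  w : I → K → A
  map_X : ∀ i a, ι ((X i : Module.End ℂ A) a) = (Y i : Module.End ℂ B) (ι a)
  exists_coord : ∀ (p : P) (δ : A →ₗ[ℂ] Matrix (Fin n) (Fin n) ℂ),
    IsPointDer ((ev p).comp ι) δ → ∃ s : I → ℂ,
      (∀ i, ∑ k, ev p (ι (u i k)) * δ (v i k) * ev p (ι (w i k)) = s i • 1) ∧
      ∀ a, δ a = ∑ i, s i • ev p (ι ((X i : Module.End ℂ A) a))

attribute [instance] DualBasis.fintypeI DualBasis.fintypeK

/-- `ι` identifies `A` with the elements of `B` that are killed by the derivations `L x`, and these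
derivations span at each point the derivations that vanish on `A`. -/
structure IsPrincipal {A B : Type*} [Ring A] [Algebra ℂ A] [Ring B] [Algebra ℂ B] (ι : A →ₐ[ℂ] B)
    {P : Type*} {n : ℕ} (ev : P → B →ₐ[ℂ] Matrix (Fin n) (Fin n) ℂ) {𝔤 : Type*}
    (L : 𝔤 → Der B) : Prop where
  injective : Function.Injective ι
  ext : ∀ b b', (∀ p, ev p b = ev p b') → b = b'
  map_ι : ∀ x a, (L x : Module.End ℂ B) (ι a) = 0
  exists_ι : ∀ b, (∀ x, (L x : Module.End ℂ B) b = 0) → ∃ a, ι a = b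
  exists_vertical : ∀ (p : P) (Y : Der B), (∀ a, ev p ((Y : Module.End ℂ B) (ι a)) = 0) →
    ∃ x y, ∀ b, ev p ((Y : Module.End ℂ B) b) = ev p ((L x : Module.End ℂ B) b) +
      Complex.I • ev p ((L y : Module.End ℂ B) b)

section Principal

variable {A B : Type*} [Ring A] [Algebra ℂ A] [Ring B] [Algebra ℂ B] {ι : A →ₐ[ℂ] B}
  {P : Type*} {n : ℕ} {ev : P → B →ₐ[ℂ] Matrix (Fin n) (Fin n) ℂ} {𝔤 : Type*} {L : 𝔤 → Der B}

lemma coe_sum_smul_apply {I : Type*} [Fintype I] (s : I → ℂ) (X : I → Der A) (a : A) :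
    ((∑ i, s i • X i : Der A) : Module.End ℂ A) a = ∑ i, s i • (X i : Module.End ℂ A) a := by
  rw [AddSubmonoidClass.coe_finsetSum, LinearMap.sum_apply]
  rfl

namespace DualBasis

variable (D : DualBasis ι ev)

include D in
-- The restriction of Y to ι(A) is a derivation of A at p, so it has coefficients in the dual basis;
-- these constants define X, which matches Y at this one point.
lemma exists_matched_left (p : P) (Y : Der B) : ∃ X : Der A,
    ∀ a, ev p ((Y : Module.End ℂ B) (ι a)) = ev p (ι ((X : Module.End ℂ A) a)) := by
  obtain ⟨s, -, hs⟩ := D.exists_coord p ((ev p).toLinearMap ∘ₗ (Y : Module.End ℂ B) ∘ₗ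
    ι.toLinearMap) (by
      intro a b
      simp only [LinearMap.comp_apply, AlgHom.toLinearMap_apply, map_mul, der_leibniz, map_add,
        AlgHom.comp_apply])
  refine ⟨∑ i, s i • D.X i, fun a => (hs a).trans ?_⟩
  simp only [coe_sum_smul_apply, map_sum, map_smul]

include D in
lemma exists_matched_right (p : P) (X : Der A) : ∃ Y : Der B,
    ∀ a, ev p ((Y : Module.End ℂ B) (ι a)) = ev p (ι ((X : Module.End ℂ A) a)) := by
  obtain ⟨s, -, hs⟩ := D.exists_coord p ((ev p).toLinearMap ∘ₗ ι.toLinearMap ∘ₗ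
    (X : Module.End ℂ A)) (by
      intro a b
      simp only [LinearMap.comp_apply, AlgHom.toLinearMap_apply, map_mul, der_leibniz, map_add,
        AlgHom.comp_apply])
  refine ⟨∑ i, s i • D.Y i, fun a => Eq.trans ?_ (hs a).symm⟩
  simp only [coe_sum_smul_apply, map_sum, map_smul, D.map_X]

/-- The one-forms of a dual basis, as forms on `B`. -/
def theta (i : D.I) : Cochain B :=
  ∑ k, wedge (ofAlg (ι (D.u i k))) (wedge (dDer (ofAlg (ι (D.v i k)))) (ofAlg (ι (D.w i k))))

lemma exists_formPair_theta (i : D.I) : ∃ α, FormPair ι α (D.theta i) :=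
  ⟨_, FormPair.sum _ fun k _ => ((FormPair.of (D.w i k)).dLeft (D.v i k)).mulLeft (D.u i k)⟩

lemma contr_theta (Z : Der B) (i : D.I) : contr Z (D.theta i) =
    ofAlg (∑ k, ι (D.u i k) * ((Z : Module.End ℂ B) (ι (D.v i k)) * ι (D.w i k))) := by
  rw [theta, contr_sum]
  have h : ∀ f : D.K → B, ofAlg (∑ k, f k) = ∑ k, (ofAlg (f k) : Cochain B) := by
    intro f
    exact map_sum (AddMonoidHom.mk' (fun b : B => (ofAlg b : Cochain B)) ofAlg_add) f _
  rw [h]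
  refine Finset.sum_congr rfl fun k _ => ?_
  rw [contr_ofAlg_wedge, contr_dDer_ofAlg_wedge, contr_ofAlg, wedge_zero_right, sub_zero,
    ofAlg_mul, ofAlg_mul]

lemma parity_theta (i : D.I) : parity (D.theta i) = -D.theta i := by
  have h : parity (D.theta i) = ∑ k, parity (wedge (ofAlg (ι (D.u i k)))
      (wedge (dDer (ofAlg (ι (D.v i k)))) (ofAlg (ι (D.w i k))))) :=
    map_sum (AddMonoidHom.mk' (parity (A := B)) parity_add) _ _
  rw [h, theta, ← Finset.sum_neg_distrib]
  refine Finset.sum_congr rfl fun k _ => ?_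
  rw [parity_wedge, parity_wedge, parity_ofAlg, parity_ofAlg, parity_dDer, parity_ofAlg,
    wedge_neg_left, wedge_neg_right]

lemma theta_zero_apply (i : D.I) (Z : Fin 0 → Der B) : D.theta i 0 Z = 0 := by
  rw [theta, Finset.sum_apply, Finset.sum_apply]
  refine Finset.sum_eq_zero fun k _ => ?_
  rw [wedge_zero_apply, wedge_zero_apply, dDer_zero_apply, zero_mul, mul_zero]

/-- The Euler operator `∑ i, θ i ∧ i_{Y i} β`. -/
def euler (β : Cochain B) : Cochain B := ∑ i, wedge (D.theta i) (contr (D.Y i) β)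

end DualBasis

namespace IsPrincipal

variable (hL : IsPrincipal ι ev L) (D : DualBasis ι ev)
include hL

lemma exists_range {β : Cochain B} (hβ : IsHomogeneous 0 β)
    (h : ∀ x, lieDer (L x) β = 0) : ∃ a, ofAlg (ι a) = β := by
  obtain ⟨a, ha⟩ := hL.exists_ι (β 0 Fin.elim0) fun x => by
    rw [← lieDer_zero_apply, h]
    rfl
  refine ⟨a, ?_⟩
  funext q Y
  cases q with
  | zero => rw [Subsingleton.elim Y Fin.elim0]; exact ha
  | succ q => rw [hβ (q + 1) (by omega)]; rfl

/-- At p the derivation W equals some L x + i L y, and a form depends only on the value of W at p.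
No global vertical extension of W is required. -/
lemma contr_apply_eq_zero {β : Cochain B} (hβ : β ∈ OmegaDer B) (h : ∀ x, contr (L x) β = 0)
    {p : P} {W : Der B} (hW : ∀ a, ev p ((W : Module.End ℂ B) (ι a)) = 0) {q : ℕ}
    (Z : Fin q → Der B) : ev p (contr W β q Z) = 0 := by
  obtain ⟨x, y, hxy⟩ := hL.exists_vertical p W hW
  have h1 : ev p (contr W β q Z) = ev p (contr (L x + Complex.I • L y) β q Z) := by
    refine apply_congr_of_mem hβ fun j => ?_
    refine Fin.cases (fun b => ?_) (fun j b => ?_) j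
    · rw [Fin.cons_zero, Fin.cons_zero, hxy, ← map_smul, ← map_add]
      rfl
    · rw [Fin.cons_succ, Fin.cons_succ]
  rw [h1, contr_add_left _ _ hβ, contr_smul_left _ _ hβ, h, h, smul_zero, add_zero]
  exact map_zero _

lemma contr_eq_zero {β : Cochain B} (hβ : β ∈ OmegaDer B) (h : ∀ x, contr (L x) β = 0)
    {W : Der B} (hW : ∀ a, (W : Module.End ℂ B) (ι a) = 0) : contr W β = 0 := by
  funext q Z
  refine hL.ext _ _ fun p => ?_
  rw [hL.contr_apply_eq_zero hβ h fun a => by rw [hW, map_zero]]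
  exact (map_zero _).symm

/-- At each point p the difference Z - ∑ θᵢ(Z)(p) Yᵢ kills ι(A), so it is vertical there and
horizontal forms do not see it. -/
lemma sum_contr_theta {β : Cochain B} (hβ : β ∈ OmegaDer B) (h : ∀ x, contr (L x) β = 0)
    (Z : Der B) :
    ∑ i, wedge (contr Z (D.theta i)) (contr (D.Y i) β) = contr Z β := by
  funext q T
  refine hL.ext _ _ fun p => ?_
  obtain ⟨s, hs, hs'⟩ := D.exists_coord p ((ev p).toLinearMap ∘ₗ (Z : Module.End ℂ B) ∘ₗ
    ι.toLinearMap) (by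
      intro a b
      simp only [LinearMap.comp_apply, AlgHom.toLinearMap_apply, map_mul, der_leibniz, map_add,
        AlgHom.comp_apply])
  have hmem : ev p (contr (Z - ∑ i, s i • D.Y i) β q T) = 0 := by
    refine hL.contr_apply_eq_zero hβ h (fun a => ?_) T
    have h1 : ((Z - ∑ i, s i • D.Y i : Der B) : Module.End ℂ B) (ι a) =
        (Z : Module.End ℂ B) (ι a) - ∑ i, s i • (D.Y i : Module.End ℂ B) (ι a) := by
      rw [← coe_sum_smul_apply]
      rfl
    rw [h1, map_sub, map_sum, sub_eq_zero]
    refine (hs' a).trans (Finset.sum_congr rfl fun i _ => ?_)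
    rw [map_smul, D.map_X]
  have h2 : contr Z β = contr (Z - ∑ i, s i • D.Y i) β + ∑ i, s i • contr (D.Y i) β := by
    conv_lhs => rw [← sub_add_cancel Z (∑ i, s i • D.Y i)]
    rw [contr_add_left _ _ hβ, contr_sum_left _ _ hβ]
    simp only [contr_smul_left _ _ hβ]
  rw [h2, Pi.add_apply, Pi.add_apply, map_add, hmem, zero_add, Finset.sum_apply,
    Finset.sum_apply, Finset.sum_apply, Finset.sum_apply, map_sum, map_sum]
  refine Finset.sum_congr rfl fun i _ => ?_
  rw [D.contr_theta, ofAlg_wedge, map_mul, map_sum, Pi.smul_apply, Pi.smul_apply, map_smul]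
  have h3 : ∑ k, ev p (ι (D.u i k) * ((Z : Module.End ℂ B) (ι (D.v i k)) * ι (D.w i k))) =
      s i • 1 := by
    rw [← hs i]
    refine Finset.sum_congr rfl fun k _ => ?_
    rw [map_mul, map_mul, ← mul_assoc]
    rfl
  rw [h3, Matrix.smul_mul, one_mul]

/-- Contracting the Euler operator with Z yields i_Z β from the θᵢ and the Euler operator of i_Z β
from the rest, the two signs cancelling. So each degree raises the eigenvalue by 1. -/
lemma euler_eq_smul {q : ℕ} {β : Cochain B} (hβ : β ∈ OmegaDer B) (hq : IsHomogeneous q β)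
    (h : ∀ x, contr (L x) β = 0) : D.euler β = (q : ℂ) • β := by
  induction q generalizing β with
  | zero =>
    rw [DualBasis.euler, Nat.cast_zero, zero_smul]
    refine Finset.sum_eq_zero fun i _ => ?_
    rw [contr_eq_zero_of_isHomogeneous _ hq, wedge_zero_right]
  | succ q ih =>
    refine cochain_ext (fun Z => ?_) fun Z => ?_
    · rw [DualBasis.euler, Finset.sum_apply, Finset.sum_apply, Pi.smul_apply, hq 0 (by omega)]
      rw [smul_zero, Pi.zero_apply]
      refine Finset.sum_eq_zero fun i _ => ?_
      rw [wedge_zero_apply, D.theta_zero_apply, zero_mul]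
    · have h1 : D.euler (contr Z β) = (q : ℂ) • contr Z β :=
        ih (contr_mem Z hβ) (isHomogeneous_contr Z hq) fun x => by
          rw [contr_anticomm' _ _ hβ, h, contr_zero, neg_zero]
      rw [contr_smul, Nat.cast_add, Nat.cast_one, add_smul, one_smul, ← h1,
        ← hL.sum_contr_theta D hβ h Z, DualBasis.euler, DualBasis.euler, contr_sum,
        ← Finset.sum_add_distrib]
      refine Finset.sum_congr rfl fun i _ => ?_
      rw [hL.sum_contr_theta D hβ h Z, contr_wedge, D.parity_theta, wedge_neg_left,
        contr_anticomm' Z _ hβ, wedge_neg_right, neg_neg, add_comm]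

include D in
-- By Euler's identity β is 1/(q + 1) times ∑ θᵢ ∧ i_{Yᵢ} β. The θᵢ come from A, and the
-- contractions are basic of degree q, so they come from A by induction.
lemma exists_formPair_of_isHomogeneous {q : ℕ} {β : Cochain B} (hβ : β ∈ OmegaDer B)
    (hq : IsHomogeneous q β) (h : ∀ x, contr (L x) β = 0) (h' : ∀ x, lieDer (L x) β = 0) :
    ∃ α, FormPair ι α β := by
  induction q generalizing β with
  | zero =>
    obtain ⟨a, rfl⟩ := hL.exists_range hq h'
    exact ⟨_, FormPair.of a⟩
  | succ q ih =>
    have h1 : ∀ i, ∃ α, FormPair ι α (contr (D.Y i) β) := by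
      intro i
      refine ih (contr_mem _ hβ) (isHomogeneous_contr _ hq) (fun x => ?_) fun x => ?_
      · rw [contr_anticomm' _ _ hβ, h, contr_zero, neg_zero]
      -- Invariance of the contraction reduces to contraction with the bracket of L x and Yᵢ. It
      -- kills ι(A), since Yᵢ maps ι(A) to itself and L x annihilates it; horizontality of β
      -- finishes.
      · have h2 := lieDer_contr_comm (L x) (D.Y i) β
        rw [h', contr_zero, sub_zero] at h2
        rw [h2]
        refine hL.contr_eq_zero hβ h fun a => ?_
        rw [der_bracket_apply, ← D.map_X, hL.map_ι, hL.map_ι, map_zero, sub_zero]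
    choose α hα using h1
    choose θ hθ using D.exists_formPair_theta
    have h2 := FormPair.smul ((q + 1 : ℂ)⁻¹)
      (FormPair.sum Finset.univ fun i _ => (hθ i).mul (hα i))
    have h3 := hL.euler_eq_smul D hβ hq h
    rw [DualBasis.euler, Nat.cast_add, Nat.cast_one] at h3
    rw [h3, smul_smul, inv_mul_cancel₀ (by exact_mod_cast Nat.succ_ne_zero q), one_smul] at h2
    exact ⟨_, h2⟩

include D in
lemma exists_formPair {β : Cochain B} (hβ : β ∈ OmegaDer B) (h : ∀ x, contr (L x) β = 0)
    (h' : ∀ x, lieDer (L x) β = 0) : ∃ α, FormPair ι α β := by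
  have hz : ∀ p, component p (0 : Cochain B) = 0 := by
    intro p
    funext q X
    simp [component]
  have h1 : ∀ p, ∃ α, FormPair ι α (component p β) := by
    intro p
    refine hL.exists_formPair_of_isHomogeneous D (component_mem p hβ)
      (isHomogeneous_component p β) (fun x => ?_) fun x => ?_
    · cases p with
      | zero => exact contr_eq_zero_of_isHomogeneous _ (isHomogeneous_component 0 β)
      | succ p => rw [contr_component, h, hz]
    · rw [lieDer_component, h', hz]
  choose α hα using h1
  obtain ⟨N, hN⟩ := exists_eq_sum_component hβ
  rw [hN]
  exact ⟨_, FormPair.sum _ fun p _ => hα p⟩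

omit D in
lemma contr_formPair {α : Cochain A} {β : Cochain B} (h : FormPair ι α β) (x : 𝔤) :
    contr (L x) β = 0 := by
  induction h with
  | of a => exact contr_ofAlg _ _
  | add _ _ h h' => rw [contr_add, h, h', add_zero]
  | smul c _ h => rw [contr_smul, h, smul_zero]
  | mulLeft a _ h => rw [contr_ofAlg_wedge, h, wedge_zero_right]
  | dLeft a _ h =>
    rw [contr_dDer_ofAlg_wedge, h, hL.map_ι, ofAlg_zero, wedge_zero_left, wedge_zero_right,
      sub_zero]

include D in
-- Any tuple of derivations of B is matched at p by derivations of A, on which α vanishes. This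
-- makes the map well defined; arguing in one degree at a time also shows that it preserves degrees.
lemma formPair_zero_left {α : Cochain A} {β : Cochain B} (h : FormPair ι α β) {q : ℕ}
    (hα : α q = 0) : β q = 0 := by
  funext Y
  refine hL.ext _ _ fun p => ?_
  choose X hX using fun j => D.exists_matched_left p (Y j)
  rw [h.comparable (ev := ev p) q X Y hX, hα]
  simp

include D in
lemma formPair_zero_right {α : Cochain A} {β : Cochain B} (h : FormPair ι α β) {q : ℕ}
    (hβ : β q = 0) : α q = 0 := by
  funext X
  refine hL.injective (hL.ext _ _ fun p => ?_)
  choose Y hY using fun j => D.exists_matched_right p (X j)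
  rw [← h.comparable (ev := ev p) q X Y hY, hβ]
  simp

include D in
/-- The differential calculus on `A` is the basic part of the differential calculus on `B`. -/
theorem exists_omegaHom : ∃ Φ : OmegaDer A →ₗ[ℂ] OmegaDer B,
    (∀ a, Φ (OmegaDer.of a) = OmegaDer.of (ι a)) ∧
    (∀ α β, Φ (OmegaDer.mul α β) = OmegaDer.mul (Φ α) (Φ β)) ∧
    (∀ α, Φ (OmegaDer.d α) = OmegaDer.d (Φ α)) ∧
    (∀ (p : ℕ) (α : OmegaDer A), IsHomogeneous p α.1 → IsHomogeneous p (Φ α).1) ∧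
    Function.Injective Φ ∧
    ∀ β : OmegaDer B, β ∈ Set.range Φ ↔ IsBasic (fun x => contr (L x)) β.1 := by
  -- The choice of right members is arbitrary, but uniqueness forces it to be linear, multiplicative
  -- and compatible with d.
  choose F hF using fun α : OmegaDer A => FormPair.exists_right ι α.2
  have huniq : ∀ (α : OmegaDer A) (β : Cochain B), FormPair ι α.1 β → F α = β := by
    intro α β h
    have h1 := (hF α).sub h
    rw [sub_self] at h1
    refine sub_eq_zero.1 (funext fun q => hL.formPair_zero_left D h1 rfl)
  let Φ : OmegaDer A →ₗ[ℂ] OmegaDer B :=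
    { toFun := fun α => ⟨F α, (hF α).mem_right⟩
      map_add' := fun α β => Subtype.ext (huniq _ _ ((hF α).add (hF β)))
      map_smul' := fun c α => Subtype.ext (huniq _ _ ((hF α).smul c)) }
  refine ⟨Φ, fun a => Subtype.ext (huniq _ _ (FormPair.of a)),
    fun α β => Subtype.ext (huniq _ _ ((hF α).mul (hF β))),
    fun α => Subtype.ext (huniq _ _ (hF α).d),
    fun p α h q hq => hL.formPair_zero_left D (hF α) (h q hq), ?_, fun β => ⟨?_, ?_⟩⟩
  · refine (injective_iff_map_eq_zero Φ).2 fun α h => Subtype.ext (funext fun q => ?_)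
    have h1 : F α = 0 := congrArg Subtype.val h
    exact hL.formPair_zero_right D (hF α) (congrFun h1 q)
  · rintro ⟨α, rfl⟩
    refine ⟨(Φ α).2, hL.contr_formPair (hF α), fun x => ?_⟩
    change contr (L x) (dDer (F α)) + dDer (contr (L x) (F α)) = 0
    rw [hL.contr_formPair (hF α), hL.contr_formPair (hF α).d, dDer_zero, add_zero]
  · rintro ⟨h1, h2, h3⟩
    obtain ⟨α, hα⟩ := hL.exists_formPair D h1 h2 fun x => by
      rw [← lieD_contr]
      exact h3 x
    exact ⟨⟨α, hα.mem_left⟩, Subtype.ext (huniq _ _ hα)⟩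

end IsPrincipal

end Principal

end DerCalc

end

noncomputable section

namespace DerCalc

open Filter Topology

/-! ### The frame bundle satisfies the hypotheses of the comparison. -/

section FrameBundleCalculus

variable {m n : ℕ} {M : Type*} [TopologicalSpace M]
  [ChartedSpace (EuclideanSpace ℝ (Fin m)) M] [IsManifold (𝓡 m) ∞ M]
  {E : M → Type*} [TopologicalSpace (Bundle.TotalSpace (EuclideanSpace ℂ (Fin n)) E)]
  [∀ x, NormedAddCommGroup (E x)] [∀ x, InnerProductSpace ℂ (E x)]
  [FiberBundle (EuclideanSpace ℂ (Fin n)) E] [VectorBundle ℂ (EuclideanSpace ℂ (Fin n)) E]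
  [IsSmoothHermitianBundle (m := m) n E]

section Positive

variable {o : BundleOrientation (m := m) n E} [NeZero n] [T2Space M] [SecondCountableTopology M]

lemma isModel_repHom : IsModel (repHom (E := E) o) where
  injective := repHom_injective
  equivariant_iff _ := ⟨exists_repHom_eq, fun ⟨a, ha⟩ => ha ▸ equivariant_repHom a⟩

lemma isPrincipal_repHom : IsPrincipal (repHom (E := E) o) (evalHom (o := o))
    (fun A : su n => vertDer o A) where
  injective := repHom_injective
  ext _ _ h := matAlg_ext h
  map_ι A a := vertDer_eq_zero_of_equivariant (equivariant_repHom a) A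
  exists_ι _ h := exists_repHom_eq (equivariant_of_vertDer_eq_zero h)
  exists_vertical p Y h := exists_vertical Y fun b hb => by
    obtain ⟨a, rfl⟩ := exists_repHom_eq hb
    exact h a

variable (o) in
/-- A finite family of colors that covers the base, with a partition of unity. -/
lemma exists_colors [Nonempty M] : ∃ (c : (Fin m → Bool) × Fin 3 → Color o)
    (ρ : (Fin m → Bool) × Fin 3 → M → ℝ), (∀ j, ContMDiff (𝓡 m) 𝓘(ℝ, ℝ) ∞ (ρ j)) ∧
    (∀ j x, ρ j x ≠ 0 → ∀ᶠ y in 𝓝 x, (c j).χ y = 1) ∧ (∀ j, tsupport (ρ j) ⊆ (c j).O) ∧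
    ∀ x, ∑ j, ρ j x = 1 := by
  have hlc : LocallyCompactSpace M :=
    ChartedSpace.locallyCompactSpace (EuclideanSpace ℝ (Fin m)) M
  have hsc : SigmaCompactSpace M := inferInstance
  have hne : Nonempty (LFrame o) := by
    obtain ⟨x⟩ := ‹Nonempty M›
    obtain ⟨Λ, -⟩ := LFrame.exists_mem o x
    exact ⟨Λ⟩
  obtain ⟨O, l, hO, hcov, hl⟩ := exists_finite_coloring m (U := fun Λ : LFrame o => Λ.φ.source)
    (fun Λ => Λ.φ.open_source) (LFrame.exists_mem o)
  obtain ⟨ρ, hρ⟩ := SmoothPartitionOfUnity.exists_isSubordinate (𝓡 m) isClosed_univ O hO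
    fun x _ => Set.mem_iUnion.2 (hcov x (Set.mem_univ x))
  -- The second cutoff is 1 near the whole support of ρ, so the cut off coordinates are exact
  -- wherever ρ does not vanish.
  choose χ hχ h1 hs using fun j =>
    exists_cutoff (m := m) (isClosed_tsupport (ρ j)) (hO j) (hρ j)
  refine ⟨fun j => ⟨O j, hO j, l j, fun x hx => (hl j x hx).1, fun x hx => (hl j x hx).2, χ j,
    hχ j, hs j⟩, fun j => ρ j, fun j => (ρ j).contMDiff, fun j x hx =>
    h1 j x (subset_tsupport _ hx), hρ, fun x => ?_⟩
  rw [← finsum_eq_sum_of_fintype]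
  exact ρ.sum_eq_one (Set.mem_univ x)

/-- The local identities already carry the factor ρⱼ, and the ρⱼ sum to 1, so adding them over the
colors is enough. The finite number of colors makes the index set finite. -/
lemma IsModel.nonempty_dualBasis [Nonempty M] {A : Type*} [Ring A] [Algebra ℂ A]
    {ι : A →ₐ[ℂ] MatAlg o} (hι : IsModel ι) : Nonempty (DualBasis ι (evalHom (o := o))) := by
  obtain ⟨c, ρ, hρ, h1, hs, hsum⟩ := exists_colors o
  choose X Y u v w hX h using fun j => hι.exists_local_dual (c j) (hρ j) (h1 j) (hs j)
  refine ⟨{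
    I := ((Fin m → Bool) × Fin 3) × (Fin m ⊕ (Fin n × Fin n))
    K := Fin n × Fin n
    X := fun i => X i.1 i.2
    Y := fun i => Y i.1 i.2
    u := fun i => u i.1 i.2
    v := fun i => v i.1 i.2
    w := fun i => w i.1 i.2
    map_X := fun i => hX i.1 i.2
    exists_coord := fun p δ hδ => ?_ }⟩
  choose s hs h' using fun j => h j p δ hδ
  refine ⟨fun i => s i.1 i.2, fun i => hs i.1 i.2, fun a => ?_⟩
  rw [Fintype.sum_prod_type]
  refine Eq.trans ?_ (Finset.sum_congr rfl fun j _ => h' j a)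
  rw [← Finset.sum_smul, ← Complex.ofReal_sum, hsum, Complex.ofReal_one, one_smul]

end Positive

omit [IsManifold (𝓡 m) ∞ M] [IsSmoothHermitianBundle (m := m) n E] in
lemma subsingleton_endAlg [IsEmpty (Fin n)] : Subsingleton (EndAlg (m := m) n E) := by
  refine ⟨fun a b => Subtype.ext (funext fun x => ContinuousLinearMap.ext fun v => ?_)⟩
  exact ((trivializationAt (EuclideanSpace ℂ (Fin n)) E x).continuousLinearEquivAt ℂ x
    (mem_baseSet_trivializationAt _ _ _)).injective (Subsingleton.elim _ _)

end FrameBundleCalculus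

end DerCalc

end

theorem mainTheorem2 {m n : ℕ} {M : Type*} [TopologicalSpace M] [T2Space M]
    [SecondCountableTopology M] [Nonempty M]
    [ChartedSpace (EuclideanSpace ℝ (Fin m)) M] [IsManifold (𝓡 m) ∞ M]
    (E : M → Type*) [TopologicalSpace (Bundle.TotalSpace (EuclideanSpace ℂ (Fin n)) E)]
    [∀ x, NormedAddCommGroup (E x)] [∀ x, InnerProductSpace ℂ (E x)]
    [FiberBundle (EuclideanSpace ℂ (Fin n)) E] [VectorBundle ℂ (EuclideanSpace ℂ (Fin n)) E]
    [IsSmoothHermitianBundle (m := m) n E] (o : BundleOrientation (m := m) n E) :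
    -- the Lie algebra `{Aᵛ + ad_A}`, isomorphic to `su(n)`, and its operation
    ∃ L : su n →ₗ[ℝ] Der (MatAlg o),
      (∀ A : su n, IsVertAddAd A (L A)) ∧
      (∀ A B : su n, L ⁅A, B⁆ = ⁅L A, L B⁆) ∧
      Function.Injective L ∧
      IsCartanOperation (MatAlg o) (fun A : su n => contr (L A)) ∧
      -- the canonical inclusion of `𝔄` into `𝔅`
      ∃ ι : EndAlg (m := m) n E →ₐ[ℂ] MatAlg o,
        (∀ a, Represents (ι a) a) ∧ Function.Injective ι ∧
        -- it extends to an isomorphism from `Ω_Der(𝔄)` onto the basic subalgebra of `Ω_Der(𝔅)`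
        ∃ Φ : OmegaDer (EndAlg (m := m) n E) →ₗ[ℂ] OmegaDer (MatAlg o),
          (∀ a, Φ (OmegaDer.of a) = OmegaDer.of (ι a)) ∧
          (∀ α β, Φ (OmegaDer.mul α β) = OmegaDer.mul (Φ α) (Φ β)) ∧
          (∀ α, Φ (OmegaDer.d α) = OmegaDer.d (Φ α)) ∧
          (∀ (p : ℕ) (α : OmegaDer (EndAlg (m := m) n E)),
            IsHomogeneous p α.1 → IsHomogeneous p (Φ α).1) ∧
          Function.Injective Φ ∧
          ∀ β : OmegaDer (MatAlg o),
            β ∈ Set.range Φ ↔ IsBasic (fun A : su n => contr (L A)) β.1 := by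
  -- For n = 0 both algebras and su(0) are trivial. This case is separated because the constructions
  -- above use a first matrix index.
  refine Or.elim (isEmpty_or_nonempty (Fin n)) (fun hn => ?_) fun hn => ?_
  · have hE : Subsingleton (EndAlg (m := m) n E) := subsingleton_endAlg
    have hB : Subsingleton (MatAlg o) := ⟨fun a b => Matrix.ext fun i => hn.elim i⟩
    have hS : Subsingleton (su n) := ⟨fun a b => Subtype.ext (Matrix.ext fun i => hn.elim i)⟩
    have hD : Subsingleton (Der (MatAlg o)) := ⟨fun X Y => der_ext fun _ => Subsingleton.elim _ _⟩
    have hΩ : Subsingleton (OmegaDer (EndAlg (m := m) n E)) :=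
      ⟨fun _ _ => Subtype.ext (Subsingleton.elim _ _)⟩
    have hΩ' : Subsingleton (OmegaDer (MatAlg o)) :=
      ⟨fun _ _ => Subtype.ext (Subsingleton.elim _ _)⟩
    have hC := isCartanOperation_contr (0 : su n →ₗ[ℝ] Der (MatAlg o))
      fun _ _ => Subsingleton.elim _ _
    refine ⟨0, ?_⟩
    refine ⟨fun _ _ _ i => hn.elim i, ?_⟩
    refine ⟨fun _ _ => Subsingleton.elim _ _, ?_⟩
    refine ⟨fun _ _ _ => Subsingleton.elim _ _, ?_⟩
    refine ⟨hC, ?_⟩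
    refine ⟨AlgHom.ofLinearMap 0 (Subsingleton.elim _ _) fun _ _ => Subsingleton.elim _ _, ?_⟩
    refine ⟨fun _ _ i => hn.elim i, ?_⟩
    refine ⟨fun _ _ _ => Subsingleton.elim _ _, ?_⟩
    refine ⟨0, ?_⟩
    refine ⟨fun _ => Subsingleton.elim _ _, ?_⟩
    refine ⟨fun _ _ => Subsingleton.elim _ _, ?_⟩
    refine ⟨fun _ => Subsingleton.elim _ _, ?_⟩
    refine ⟨fun _ _ _ _ _ => Subsingleton.elim _ _, ?_⟩
    refine ⟨fun _ _ _ => Subsingleton.elim _ _, fun β => ⟨fun _ => ?_, fun _ => ?_⟩⟩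
    · exact ⟨β.2, fun _ => Subsingleton.elim _ _, fun _ => Subsingleton.elim _ _⟩
    · exact ⟨0, Subsingleton.elim _ _⟩
  · have : NeZero n := ⟨Fin.pos_iff_nonempty.2 hn |>.ne'⟩
    have D := Classical.choice (isModel_repHom (E := E) (o := o)).nonempty_dualBasis
    have hP := isPrincipal_repHom (E := E) (o := o)
    have hΦ := hP.exists_omegaHom D
    have hC := isCartanOperation_contr (vertDer o) vertDer_bracket
    refine ⟨vertDer o, ?_⟩
    refine ⟨isVertAddAd_vertDer, ?_⟩
    refine ⟨vertDer_bracket, ?_⟩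
    refine ⟨vertDer_injective, ?_⟩
    refine ⟨hC, ?_⟩
    refine ⟨repHom o, ?_⟩
    refine ⟨fun a p i j => rfl, ?_⟩
    refine ⟨repHom_injective, ?_⟩
    exact hΦ
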